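/- **Theorem.** There are an algorithm (a single real RAM program) and a constant $C$ such that, for every polytope $P\subset\mathbb R^3$ with triangulated boundary, given as the list of its $n$ facial triangles (each by the real coordinates of its three vertices, in no particular order or orientation), the algorithm halts after at most $C\,n^2$ steps and decides correctly whether $P$ can be carved by half-planes. If the answer is affirmative, the algorithm also outputs $n$ half-planes $H_1,\dots,H_n$ (not necessarily distinct) such that $\{H_1,\dots,H_n\}$ carves $P$. Here: * A *polytope* $P$, not necessarily convex, is a compact subset of $\mathbb R^3$ that is the closure of its interior $\operatorname{int}P$, where $\operatorname{int} P$ is nonempty and connected, and whose boundary is the union of finitely many distinct nondegenerate closed triangles, the *facial triangles*, any two of which intersect in the convex hull of their common vertices (a common edge, a common vertex, or nothing). * A *half-plane* is a closed half-plane of some plane in $\mathbb R^3$: all points of the plane on one side of, or on, some line contained in the plane. It is output as a point of its boundary line, a nonzero vector along that line, and a vector of the plane that points into the half-plane. * A set $\mathcal H$ of half-planes *carves* $P$ if for every set $C'\supseteq P$ the set $C'\setminus\bigcup_{H\in\mathcal H}H$ has a connected component equal to $\operatorname{int}P$. $P$ *can be carved by half-planes* if some finite set of half-planes carves it. * The *real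 RAM* has unbounded integer and real arrays with indirect addressing by integers. Constants, memory accesses, integer additions and (truncated) subtractions, the four arithmetic operations on reals, comparisons, assignments and control steps cost one unit each. There is no rounding, no root and no conversion between reals and integers. -/

import Mathlib

namespace Carving

/-! ### Geometry -/

/-- Three-dimensional space. Only its affine structure and its topology are used. -/
abbrev Space : Type := Fin 3 → ℝ

/-- For linearly independent `u`, `v`, this is the closed half-plane inside the plane
`p + span {u, v}` which is bounded by the line `p + ℝ u` and lies on the side of `v`. -/
def halfPlane (p u v : Space) : Set Space :=
  {x | ∃ s t : ℝ, 0 ≤ t ∧ x = p + s • u + t • v}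

/-- `H` is a closed half-plane of some plane in space. -/
def IsHalfPlane (H : Set Space) : Prop :=
  ∃ p u v : Space, LinearIndependent ℝ ![u, v] ∧ H = halfPlane p u v

/-- The closed triangle with the three given vertices. -/
def triangle (t : Fin 3 → Space) : Set Space := convexHull ℝ (Set.range t)

/-- `P` is a (not necessarily convex) polytope, and `T 0, …, T (n - 1)` are the triangles of a
triangulation of its boundary: `P` is bounded and is the closure of its connected interior, and
its boundary is the union of the triangles, which are nondegenerate, pairwise distinct, and
meet two at a time in a common face (a common edge, a common vertex, or nothing). -/
structure IsTriangulatedPolytope (P : Set Space) {n : ℕ} (T : Fin n → Fin 3 → Space) :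
    Prop where
  isCompact : IsCompact P
  closure_interior : closure (interior P) = P
  isConnected_interior : IsConnected (interior P)
  affineIndependent : ∀ i, AffineIndependent ℝ (T i)
  frontier_eq : frontier P = ⋃ i, triangle (T i)
  range_ne : ∀ i j, i ≠ j → Set.range (T i) ≠ Set.range (T j)
  inter_eq : ∀ i j, i ≠ j →
    triangle (T i) ∩ triangle (T j) = convexHull ℝ (Set.range (T i) ∩ Set.range (T j))

/-- The cuts in `W` carve `P`: out of every set `C` that contains `P`, they cut the interior
of `P` as a connected component of what is left of `C`. -/
def Carves (W : Set (Set Space)) (P : Set Space) : Prop :=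
  ∀ C : Set Space, P ⊆ C → ∃ x ∈ C \ ⋃₀ W, connectedComponentIn (C \ ⋃₀ W) x = interior P

/-- `P` can be carved by finitely many half-plane cuts. -/
def Carveable (P : Set Space) : Prop :=
  ∃ W : Set (Set Space), W.Finite ∧ (∀ H ∈ W, IsHalfPlane H) ∧ Carves W P

/-! ### The real RAM -/

/-- The memory of a real random access machine: integer arrays and real arrays, all of unbounded
length. The first argument is the name of the array (a program mentions only finitely many
names), the second one is the index. -/
structure Memory : Type where
  nat : ℕ → ℕ → ℕ
  real : ℕ → ℕ → ℝ

/-- Integer expressions: constants, array cells, sum and truncated difference. -/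
inductive NExp : Type
  | const (k : ℕ)
  | get (a : ℕ) (i : NExp)
  | add (e f : NExp)
  | sub (e f : NExp)

/-- Real expressions: integer constants, array cells and the four field operations.
There is no conversion between real and integer values, no rounding, and no root. -/
inductive RExp : Type
  | const (k : ℤ)
  | get (a : ℕ) (i : NExp)
  | add (e f : RExp)
  | sub (e f : RExp)
  | mul (e f : RExp)
  | div (e f : RExp)

/-- Tests: comparisons and their Boolean combinations. -/
inductive BExp : Type
  | ltN (e f : NExp)
  | ltR (e f : RExp)
  | not (b : BExp)
  | and (b c : BExp)

/-- Programs. `setN a i e` and `setR a i e` assign the value of `e` to cell `i` of array `a`. -/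
inductive Program : Type
  | skip
  | setN (a : ℕ) (i e : NExp)
  | setR (a : ℕ) (i : NExp) (e : RExp)
  | seq (c d : Program)
  | cond (b : BExp) (c d : Program)
  | loop (b : BExp) (c : Program)

def NExp.eval (s : Memory) : NExp → ℕ
  | const k => k
  | get a i => s.nat a (i.eval s)
  | add e f => e.eval s + f.eval s
  | sub e f => e.eval s - f.eval s

noncomputable def RExp.eval (s : Memory) : RExp → ℝ
  | const k => (k : ℝ)
  | get a i => s.real a (i.eval s)
  | add e f => e.eval s + f.eval s
  | sub e f => e.eval s - f.eval s
  | mul e f => e.eval s * f.eval s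
  | div e f => e.eval s / f.eval s

def BExp.Holds (s : Memory) : BExp → Prop
  | ltN e f => e.eval s < f.eval s
  | ltR e f => e.eval s < f.eval s
  | not b => ¬ b.Holds s
  | and b c => b.Holds s ∧ c.Holds s

/-- Unit cost: the number of constants, memory accesses and operations in the expression. -/
def NExp.cost : NExp → ℕ
  | const _ => 1
  | get _ i => i.cost + 1
  | add e f => e.cost + f.cost + 1
  | sub e f => e.cost + f.cost + 1

/-- Unit cost: the number of constants, memory accesses and operations in the expression. -/
def RExp.cost : RExp → ℕ
  | const _ => 1
  | get _ i => i.cost + 1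
  | add e f => e.cost + f.cost + 1
  | sub e f => e.cost + f.cost + 1
  | mul e f => e.cost + f.cost + 1
  | div e f => e.cost + f.cost + 1

/-- Unit cost: the number of constants, memory accesses and operations in the test. -/
def BExp.cost : BExp → ℕ
  | ltN e f => e.cost + f.cost + 1
  | ltR e f => e.cost + f.cost + 1
  | not b => b.cost + 1
  | and b c => b.cost + c.cost + 1

/-- Replace the content of cell `i` of the integer array `a` by `k`. -/
def Memory.setNat (s : Memory) (a i k : ℕ) : Memory :=
  ⟨Function.update s.nat a (Function.update (s.nat a) i k), s.real⟩

/-- Replace the content of cell `i` of the real array `a` by `r`. -/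
def Memory.setReal (s : Memory) (a i : ℕ) (r : ℝ) : Memory :=
  ⟨s.nat, Function.update s.real a (Function.update (s.real a) i r)⟩

/-- `Runs c s t s'`: started on the memory `s`, the program `c` halts after exactly `t` steps
and leaves the memory `s'`. -/
inductive Runs : Program → Memory → ℕ → Memory → Prop
  | skip (s : Memory) : Runs .skip s 1 s
  | setN (a : ℕ) (i e : NExp) (s : Memory) :
      Runs (.setN a i e) s (i.cost + e.cost + 1) (s.setNat a (i.eval s) (e.eval s))
  | setR (a : ℕ) (i : NExp) (e : RExp) (s : Memory) :
      Runs (.setR a i e) s (i.cost + e.cost + 1) (s.setReal a (i.eval s) (e.eval s))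
  | seq {c d : Program} {s s' s'' : Memory} {t t' : ℕ} :
      Runs c s t s' → Runs d s' t' s'' → Runs (.seq c d) s (t + t') s''
  | condTrue {b : BExp} {c d : Program} {s s' : Memory} {t : ℕ} :
      b.Holds s → Runs c s t s' → Runs (.cond b c d) s (b.cost + t + 1) s'
  | condFalse {b : BExp} {c d : Program} {s s' : Memory} {t : ℕ} :
      ¬ b.Holds s → Runs d s t s' → Runs (.cond b c d) s (b.cost + t + 1) s'
  | loopFalse {b : BExp} {c : Program} {s : Memory} :
      ¬ b.Holds s → Runs (.loop b c) s (b.cost + 1) s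
  | loopTrue {b : BExp} {c : Program} {s s' s'' : Memory} {t t' : ℕ} :
      b.Holds s → Runs c s t s' → Runs (.loop b c) s' t' s'' →
        Runs (.loop b c) s (b.cost + t + t' + 1) s''

/-- The machine is deterministic, so running time and result are well defined. -/
theorem Runs.deterministic {c : Program} {s s₁ s₂ : Memory} {t₁ t₂ : ℕ}
    (h₁ : Runs c s t₁ s₁) (h₂ : Runs c s t₂ s₂) : t₁ = t₂ ∧ s₁ = s₂ := by
  induction h₁ generalizing t₂ s₂ with
  | skip s => cases h₂; exact ⟨rfl, rfl⟩
  | setN a i e s => cases h₂; exact ⟨rfl, rfl⟩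
  | setR a i e s => cases h₂; exact ⟨rfl, rfl⟩
  | seq _ _ ih ih' =>
    cases h₂ with
    | seq k k' =>
      obtain ⟨rfl, rfl⟩ := ih k
      obtain ⟨rfl, rfl⟩ := ih' k'
      exact ⟨rfl, rfl⟩
  | condTrue hb _ ih =>
    cases h₂ with
    | condTrue _ k =>
      obtain ⟨rfl, rfl⟩ := ih k
      exact ⟨rfl, rfl⟩
    | condFalse hb' _ => exact absurd hb hb'
  | condFalse hb _ ih =>
    cases h₂ with
    | condTrue hb' _ => exact absurd hb' hb
    | condFalse _ k =>
      obtain ⟨rfl, rfl⟩ := ih k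
      exact ⟨rfl, rfl⟩
  | loopFalse hb =>
    cases h₂ with
    | loopFalse _ => exact ⟨rfl, rfl⟩
    | loopTrue hb' _ _ => exact absurd hb' hb
  | loopTrue hb _ _ ih ih' =>
    cases h₂ with
    | loopFalse hb' => exact absurd hb hb'
    | loopTrue _ k k' =>
      obtain ⟨rfl, rfl⟩ := ih k
      obtain ⟨rfl, rfl⟩ := ih' k'
      exact ⟨rfl, rfl⟩

/-! ### Input and output -/

/-- The initial memory for the triangles `T 0, …, T (n - 1)`: cell `0` of the integer array `0`
holds `n`, cell `9 i + 3 j + k` of the real array `0` holds the `k`-th coordinate of the `j`-th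
vertex of `T i`, and all other cells hold `0`. -/
def inputMemory {n : ℕ} (T : Fin n → Fin 3 → Space) : Memory where
  nat a m := if a = 0 ∧ m = 0 then n else 0
  real a m :=
    if h : a = 0 ∧ m / 9 < n then
      T ⟨m / 9, h.2⟩ (Fin.ofNat 3 (m % 9 / 3)) (Fin.ofNat 3 (m % 3))
    else 0

/-- The answer is read off cell `0` of the integer array `1`. -/
def outputAnswer (s : Memory) : ℕ := s.nat 1 0

/-- The `j`-th vector (`j = 0, 1, 2`) of the `i`-th item of the output is read off the cells
`9 i + 3 j`, `9 i + 3 j + 1`, `9 i + 3 j + 2` of the real array `1`. -/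
def outputVector (s : Memory) (i j : ℕ) : Space := fun k => s.real 1 (9 * i + 3 * j + k)

/-- The `i`-th half-plane of the output: its three vectors are a point of the boundary line,
a direction of the boundary line, and a direction into the half-plane. -/
def outputHalfPlane (s : Memory) (i : ℕ) : Set Space :=
  halfPlane (outputVector s i 0) (outputVector s i 1) (outputVector s i 2)

end Carving

/-!
A finite set of half-planes carves `P` if and only if the half-planes cover the boundary of `P` and
avoid its interior: a connected set that avoids the boundary stays inside or outside
(`IsTriangulatedPolytope.carves`, `IsTriangulatedPolytope.of_carves`).

Suppose that this is the case, and let `t` be a facial triangle. The relative interior of `t` does not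
meet the convex hull of the section of `P` by the plane of `t`. Otherwise the two sets overlap in an
open part of the plane, which finitely many half-planes cover; one of these lies in the plane and
meets the convex hull, although the section, hence also its convex hull, is in the convex complement
of that half-plane (`exists_halfPlane_convex`). Thus a line separates `t` from the section. It may
be moved until it passes through a vertex of `t`, and then it bounds a half-plane of the plane of `t`
that contains `t` and avoids the interior of `P` (`IsTriangulatedPolytope.exists_inCone`).
Conversely, one such half-plane for each facial triangle carves `P`. So the facial triangles can be
treated one by one, and only lines through vertices matter.

For a vertex `A` of `t`, the half-planes `0 ≤ F · (x - A)` that contain `t` form a plane cone of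
normal vectors `F`. The section is not convex and not explicitly known, but its convex hull is spanned
by at most linearly many points: crossing points of edges with the plane, vertices in the plane at
triangles that cross it, and ends of those edges in the plane next to which the section has interior
points (`IsCut`). Each of them amounts to one inequality `F · z ≤ 0`
(`SectionNonpos.cuts`, `IsTriangulatedPolytope.dot_neg_of_cuts`); every interior point in the plane is
between two boundary points of this kind on a line in general position. The cone is clipped by the
inequalities one after the other, in constant time each (`IsClipped.replace`), so that a facial
triangle takes linear time.

Two tables tell on which side of an edge there are interior points. The inward normal vector of
a facial triangle is found by counting modulo two the triangles that a ray from its centroid meets,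
where the direction `(1, s, s ^ 2)` with `s` infinitely large avoids all degeneracies
(`RayHits`, `IsTriangulatedPolytope.mem_interior_iff_odd`). For each edge of a facial triangle, the
angle to the next facial triangle around this edge in inward direction bounds a wedge of interior
points, and these wedges are all there is (`IsTriangulatedPolytope.eventually_mem_of_lt_next`,
`IsTriangulatedPolytope.exists_lt_next`). Angles are measured by a piecewise rational function
(`diamondAngle`), since the machine has no roots. Both tables take quadratic time.

The machine program is obtained from a structured program in which loops run through the input and
are nested to depth two (`Routine.runs_compile`, `Routine.exists_time_le`).
-/

open Matrix
open Filter Topology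

set_option linter.unusedSimpArgs false

namespace Carving

/-! ### Triangles in space -/

/-- The normal vector of a triangle that the order of its vertices determines. -/
def normal (t : Fin 3 → Space) : Space := (t 1 - t 0) ⨯₃ (t 2 - t 0)

/-- The points of a triangle whose barycentric coordinates are all positive. -/
def openTriangle (t : Fin 3 → Space) : Set Space :=
  {x | ∃ w : Fin 3 → ℝ, (∀ k, 0 < w k) ∧ ∑ k, w k = 1 ∧ ∑ k, w k • t k = x}

/-- The `k`-th barycentric coordinate with respect to a triangle, extended to all of space so
that it is constant along the normal direction. -/
noncomputable def bary (t : Fin 3 → Space) (k : Fin 3) (x : Space) : ℝ :=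
  (x - t (k + 1)) ⬝ᵥ (normal t ⨯₃ (t (k + 2) - t (k + 1))) / (normal t ⬝ᵥ normal t)

theorem cross_zero (u v : Space) : (u ⨯₃ v) 0 = u 1 * v 2 - u 2 * v 1 := by simp [cross_apply]

theorem cross_one (u v : Space) : (u ⨯₃ v) 1 = u 2 * v 0 - u 0 * v 2 := by simp [cross_apply]

theorem cross_two (u v : Space) : (u ⨯₃ v) 2 = u 0 * v 1 - u 1 * v 0 := by simp [cross_apply]

theorem dotProduct_self_pos {v : Space} (h : v ≠ 0) : 0 < v ⬝ᵥ v := by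
  have h0 : 0 ≤ v ⬝ᵥ v := by
    rw [vec3_dotProduct]; nlinarith [sq_nonneg (v 0), sq_nonneg (v 1), sq_nonneg (v 2)]
  exact lt_of_le_of_ne h0 fun h' => h (dotProduct_self_eq_zero.1 h'.symm)

theorem mem_triangle_iff {t : Fin 3 → Space} {x : Space} :
    x ∈ triangle t ↔ ∃ w : Fin 3 → ℝ, (∀ k, 0 ≤ w k) ∧ ∑ k, w k = 1 ∧ ∑ k, w k • t k = x := by
  rw [triangle, convexHull_range_eq_exists_affineCombination (R := ℝ)]
  constructor
  · rintro ⟨s, w, h0, h1, rfl⟩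
    refine ⟨fun k => if k ∈ s then w k else 0, fun k => ?_, ?_, ?_⟩
    · dsimp only; split_ifs with h
      exacts [h0 k h, le_rfl]
    · simpa using h1
    · rw [Finset.affineCombination_eq_linear_combination _ _ _ h1]
      simp [ite_smul]
  · rintro ⟨w, h0, h1, rfl⟩
    refine ⟨Finset.univ, w, fun k _ => h0 k, h1, ?_⟩
    exact Finset.univ.affineCombination_eq_linear_combination t w h1

theorem openTriangle_subset (t : Fin 3 → Space) : openTriangle t ⊆ triangle t := by
  rintro x ⟨w, h0, h1, h2⟩
  exact mem_triangle_iff.2 ⟨w, fun k => (h0 k).le, h1, h2⟩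

theorem isCompact_triangle (t : Fin 3 → Space) : IsCompact (triangle t) :=
  (Set.finite_range t).isCompact_convexHull ℝ

theorem isClosed_triangle (t : Fin 3 → Space) : IsClosed (triangle t) :=
  (isCompact_triangle t).isClosed

theorem vertex_mem_triangle (t : Fin 3 → Space) (k : Fin 3) : t k ∈ triangle t :=
  subset_convexHull ℝ _ ⟨k, rfl⟩

theorem normal_ne_zero {t : Fin 3 → Space} (h : AffineIndependent ℝ t) : normal t ≠ 0 := by
  rw [normal, crossProduct_ne_zero_iff_linearIndependent]
  rw [affineIndependent_iff_linearIndependent_vsub ℝ t 0] at h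
  have h2 := h.comp (fun k : Fin 2 => (⟨k.succ, Fin.succ_ne_zero k⟩ : {x : Fin 3 // x ≠ 0}))
    (fun a b hab => by simpa using hab)
  have h3 : (![t 1 - t 0, t 2 - t 0] : Fin 2 → Space) =
      (fun i : {x : Fin 3 // x ≠ 0} => t i -ᵥ t 0) ∘
      fun k : Fin 2 => (⟨k.succ, Fin.succ_ne_zero k⟩ : {x : Fin 3 // x ≠ 0}) := by
    ext k
    fin_cases k <;> rfl
  rw [h3]
  exact h2

/-- The normal vector does not depend on which vertex comes first. -/
theorem normal_eq (t : Fin 3 → Space) (k : Fin 3) :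
    (t (k + 1) - t k) ⨯₃ (t (k + 2) - t k) = normal t := by
  fin_cases k
  · rfl
  all_goals
    ext j; fin_cases j <;> simp only [normal, cross_zero, cross_one, cross_two, Pi.sub_apply,
      Fin.isValue, Fin.zero_eta, Fin.mk_one, Fin.reduceFinMk, Fin.reduceAdd, zero_add] <;> ring

theorem normal_dot_sub_vertex (t : Fin 3 → Space) (x : Space) (k l : Fin 3) :
    normal t ⬝ᵥ (x - t k) = normal t ⬝ᵥ (x - t l) := by
  fin_cases k <;> fin_cases l <;>
    simp only [normal, vec3_dotProduct, cross_zero, cross_one, cross_two, Pi.sub_apply,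
      Fin.isValue, Fin.zero_eta, Fin.mk_one, Fin.reduceFinMk, Fin.reduceAdd, zero_add] <;> ring

theorem sum_smul_apply (w : Fin 3 → ℝ) (t : Fin 3 → Space) (j : Fin 3) :
    (∑ k, w k • t k) j = w 0 * t 0 j + w 1 * t 1 j + w 2 * t 2 j := by
  simp [Fin.sum_univ_three]

theorem normal_dot_sum (t : Fin 3 → Space) {w : Fin 3 → ℝ} (h : ∑ k, w k = 1) (l : Fin 3) :
    normal t ⬝ᵥ (∑ k, w k • t k - t l) = 0 := by
  rw [normal_dot_sub_vertex t _ l 0]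
  rw [Fin.sum_univ_three] at h
  have h0 : w 0 = 1 - w 1 - w 2 := by linarith
  simp only [normal, vec3_dotProduct, cross_zero, cross_one, cross_two, Pi.sub_apply,
    sum_smul_apply, h0]
  ring

theorem normal_dot_of_mem {t : Fin 3 → Space} {x : Space} (hx : x ∈ triangle t) (l : Fin 3) :
    normal t ⬝ᵥ (x - t l) = 0 := by
  obtain ⟨w, -, h1, rfl⟩ := mem_triangle_iff.1 hx
  exact normal_dot_sum t h1 l

theorem bary_sum {t : Fin 3 → Space} (ht : normal t ≠ 0) {w : Fin 3 → ℝ} (h : ∑ k, w k = 1)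
    (k : Fin 3) : bary t k (∑ m, w m • t m) = w k := by
  have hp := dotProduct_self_pos ht
  rw [bary, div_eq_iff hp.ne']
  rw [Fin.sum_univ_three] at h
  fin_cases k
  · have h0 : w 1 = 1 - w 0 - w 2 := by linarith
    simp only [normal, vec3_dotProduct, cross_zero, cross_one, cross_two, Pi.sub_apply,
      Fin.isValue, Fin.zero_eta, Fin.mk_one, Fin.reduceFinMk, Fin.reduceAdd, zero_add,
      sum_smul_apply, h0]
    ring
  · have h0 : w 0 = 1 - w 1 - w 2 := by linarith
    simp only [normal, vec3_dotProduct, cross_zero, cross_one, cross_two, Pi.sub_apply,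
      Fin.isValue, Fin.zero_eta, Fin.mk_one, Fin.reduceFinMk, Fin.reduceAdd, zero_add,
      sum_smul_apply, h0]
    ring
  · have h0 : w 0 = 1 - w 1 - w 2 := by linarith
    simp only [normal, vec3_dotProduct, cross_zero, cross_one, cross_two, Pi.sub_apply,
      Fin.isValue, Fin.zero_eta, Fin.mk_one, Fin.reduceFinMk, Fin.reduceAdd, zero_add,
      sum_smul_apply, h0]
    ring

theorem sum_bary {t : Fin 3 → Space} (ht : normal t ≠ 0) (x : Space) : ∑ k, bary t k x = 1 := by
  have hp := dotProduct_self_pos ht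
  simp only [bary]
  rw [← Finset.sum_div, div_eq_iff hp.ne', Fin.sum_univ_three]
  simp only [normal, vec3_dotProduct, cross_zero, cross_one, cross_two, Pi.sub_apply,
    Fin.isValue, Fin.zero_eta, Fin.mk_one, Fin.reduceFinMk, Fin.reduceAdd, zero_add]
  ring

theorem sum_bary_smul {t : Fin 3 → Space} (ht : normal t ≠ 0) {x : Space}
    (hx : normal t ⬝ᵥ (x - t 0) = 0) : ∑ k, bary t k x • t k = x := by
  have hp := dotProduct_self_pos ht
  ext j
  rw [sum_smul_apply]
  simp only [bary]
  rw [div_mul_eq_mul_div, div_mul_eq_mul_div, div_mul_eq_mul_div, ← add_div, ← add_div,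
    div_eq_iff hp.ne']
  have key : ∀ j, ((x - t (0 + 1)) ⬝ᵥ (normal t ⨯₃ (t (0 + 2) - t (0 + 1))) * t 0 j +
      (x - t (1 + 1)) ⬝ᵥ (normal t ⨯₃ (t (1 + 2) - t (1 + 1))) * t 1 j +
      (x - t (2 + 1)) ⬝ᵥ (normal t ⨯₃ (t (2 + 2) - t (2 + 1))) * t 2 j) =
      x j * (normal t ⬝ᵥ normal t) - normal t j * (normal t ⬝ᵥ (x - t 0)) := by
    intro j
    fin_cases j <;> simp only [normal, vec3_dotProduct, cross_zero, cross_one, cross_two,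
      Pi.sub_apply, Fin.isValue, Fin.zero_eta, Fin.mk_one, Fin.reduceFinMk, Fin.reduceAdd,
      zero_add] <;> ring
  rw [key j, hx, mul_zero, sub_zero]

theorem mem_openTriangle_iff {t : Fin 3 → Space} (ht : normal t ≠ 0) {x : Space} :
    x ∈ openTriangle t ↔ normal t ⬝ᵥ (x - t 0) = 0 ∧ ∀ k, 0 < bary t k x := by
  constructor
  · rintro ⟨w, h0, h1, rfl⟩
    exact ⟨normal_dot_sum t h1 0, fun k => by rw [bary_sum ht h1]; exact h0 k⟩
  · rintro ⟨h0, h1⟩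
    exact ⟨fun k => bary t k x, h1, sum_bary ht x, sum_bary_smul ht h0⟩

theorem bary_nonneg_of_mem {t : Fin 3 → Space} (ht : normal t ≠ 0) {x : Space}
    (hx : x ∈ triangle t) (k : Fin 3) : 0 ≤ bary t k x := by
  obtain ⟨w, h0, h1, rfl⟩ := mem_triangle_iff.1 hx
  rw [bary_sum ht h1]; exact h0 k

theorem mem_triangle_iff_bary {t : Fin 3 → Space} (ht : normal t ≠ 0) {x : Space} :
    x ∈ triangle t ↔ normal t ⬝ᵥ (x - t 0) = 0 ∧ ∀ k, 0 ≤ bary t k x := by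
  constructor
  · intro hx
    exact ⟨normal_dot_of_mem hx 0, bary_nonneg_of_mem ht hx⟩
  · rintro ⟨h0, h1⟩
    exact mem_triangle_iff.2 ⟨fun k => bary t k x, h1, sum_bary ht x, sum_bary_smul ht h0⟩

theorem bary_vertex {t : Fin 3 → Space} (ht : normal t ≠ 0) (k m : Fin 3) :
    bary t k (t m) = if k = m then 1 else 0 := by
  have h := bary_sum ht (w := Pi.single m 1) (by simp) k
  rw [Finset.sum_eq_single m] at h
  · simpa [Pi.single_apply] using h
  · intro b _ hb; simp [Pi.single_apply, hb]
  · simp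

theorem continuous_bary (t : Fin 3 → Space) (k : Fin 3) : Continuous (bary t k) := by
  unfold bary
  simp only [vec3_dotProduct]
  fun_prop

theorem bary_add_smul (t : Fin 3 → Space) (k : Fin 3) (x y : Space) (s : ℝ) :
    bary t k (x + s • (y - x)) = (1 - s) * bary t k x + s * bary t k y := by
  unfold bary
  simp only [vec3_dotProduct, Pi.add_apply, Pi.smul_apply, Pi.sub_apply, smul_eq_mul]
  ring

/-- A point with positive `k`-th barycentric coordinate is not in the convex hull of a set of
vertices without the `k`-th one. -/
theorem vertex_mem_of_mem_convexHull {t : Fin 3 → Space} (ht : normal t ≠ 0) {s : Set Space}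
    (hs : s ⊆ Set.range t) {x : Space} (hx : x ∈ convexHull ℝ s) {k : Fin 3}
    (hk : 0 < bary t k x) : t k ∈ s := by
  by_contra hcon
  have hsub : s ⊆ {y | bary t k y ≤ 0} := by
    intro y hy
    obtain ⟨m, rfl⟩ := hs hy
    have : k ≠ m := by rintro rfl; exact hcon hy
    simp [bary_vertex ht, this]
  have hconv : Convex ℝ {y | bary t k y ≤ 0} := by
    intro a ha b hb p q hp hq hpq
    have : p • a + q • b = a + q • (b - a) := by
      rw [← eq_sub_iff_add_eq] at hpq; subst hpq; module
    simp only [Set.mem_ofPred_eq] at *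
    rw [this, bary_add_smul, ← hpq]
    nlinarith
  exact absurd (convexHull_min hsub hconv hx) (not_le.2 hk)

section Polytope

variable {P : Set Space} {n : ℕ} {T : Fin n → Fin 3 → Space}

theorem IsTriangulatedPolytope.normal_ne_zero (hP : IsTriangulatedPolytope P T) (i : Fin n) :
    normal (T i) ≠ 0 := Carving.normal_ne_zero (hP.affineIndependent i)

/-- Vertices of one facial triangle that are needed to write a point of another one are common
vertices. -/
theorem IsTriangulatedPolytope.vertex_mem (hP : IsTriangulatedPolytope P T) {i j : Fin n}
    {x : Space} (hi : x ∈ triangle (T i)) (hj : x ∈ triangle (T j)) {k : Fin 3}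
    (hk : 0 < bary (T i) k x) : T i k ∈ Set.range (T j) := by
  rcases eq_or_ne i j with rfl | hij
  · exact ⟨k, rfl⟩
  have hx : x ∈ convexHull ℝ (Set.range (T i) ∩ Set.range (T j)) := by
    rw [← hP.inter_eq i j hij]; exact ⟨hi, hj⟩
  exact (vertex_mem_of_mem_convexHull (hP.normal_ne_zero i) Set.inter_subset_left hx hk).2

theorem range_eq_of_subset {t s : Fin 3 → Space} (ht : Function.Injective t)
    (h : Set.range t ⊆ Set.range s) : Set.range t = Set.range s := by
  apply Set.eq_of_subset_of_ncard_le h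
  · rw [← Set.image_univ, ← Set.image_univ, Set.ncard_image_of_injective _ ht]
    exact Set.ncard_image_le

theorem IsTriangulatedPolytope.eq_of_mem_openTriangle (hP : IsTriangulatedPolytope P T)
    {i j : Fin n} {x : Space} (hi : x ∈ openTriangle (T i)) (hj : x ∈ triangle (T j)) : i = j := by
  by_contra hij
  refine hP.range_ne i j hij (range_eq_of_subset (hP.affineIndependent i).injective ?_)
  rintro _ ⟨k, rfl⟩
  exact hP.vertex_mem (openTriangle_subset _ hi) hj
    (((mem_openTriangle_iff (hP.normal_ne_zero i)).1 hi).2 k)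

theorem IsTriangulatedPolytope.triangle_subset_frontier (hP : IsTriangulatedPolytope P T)
    (i : Fin n) : triangle (T i) ⊆ frontier P := by
  rw [hP.frontier_eq]; exact Set.subset_iUnion (fun i => triangle (T i)) i

theorem IsTriangulatedPolytope.frontier_subset (hP : IsTriangulatedPolytope P T) :
    frontier P ⊆ P := hP.isCompact.isClosed.frontier_subset

theorem IsTriangulatedPolytope.notMem_interior (hP : IsTriangulatedPolytope P T) {x : Space}
    {i : Fin n} (hx : x ∈ triangle (T i)) : x ∉ interior P :=
  (hP.triangle_subset_frontier i hx).2

/-- A connected set that misses the boundary lies on one side of it. -/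
theorem subset_interior_of_isPreconnected {P S : Set Space} (hS : IsPreconnected S)
    (h : Disjoint S (frontier P)) {x : Space} (hx : x ∈ S) (hxP : x ∈ interior P) :
    S ⊆ interior P := by
  have hU : S ⊆ interior P ∪ (closure P)ᶜ := by
    intro y hy
    by_contra hc
    simp only [Set.mem_union, Set.mem_compl_iff, not_or, not_not] at hc
    exact Set.disjoint_left.1 h hy ⟨hc.2, hc.1⟩
  have hd : S ∩ (interior P ∩ (closure P)ᶜ) = ∅ := by
    ext y
    simp only [Set.mem_inter_iff, Set.mem_compl_iff, Set.mem_empty_iff_false, iff_false, not_and,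
      not_not]
    exact fun _ hy => subset_closure (interior_subset hy)
  rcases isPreconnected_iff_subset_of_disjoint.1 hS _ _ isOpen_interior
    isClosed_closure.isOpen_compl hU hd with h1 | h1
  · exact h1
  · exact absurd (subset_closure (interior_subset hxP)) (h1 hx)

/-- A point has a neighbourhood that meets no other facial triangles than those it lies on. -/
theorem exists_ball_inter_triangle (T : Fin n → Fin 3 → Space) (x : Space) :
    ∃ r > 0, ∀ y ∈ Metric.ball x r, ∀ i, y ∈ triangle (T i) → x ∈ triangle (T i) := by
  have h : ∀ i, ∃ r > 0, ∀ y ∈ Metric.ball x r, y ∈ triangle (T i) → x ∈ triangle (T i) := by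
    intro i
    by_cases hx : x ∈ triangle (T i)
    · exact ⟨1, one_pos, fun _ _ _ => hx⟩
    · obtain ⟨r, hr, h⟩ := Metric.isOpen_iff.1 (isClosed_triangle (T i)).isOpen_compl x hx
      exact ⟨r, hr, fun y hy hy' => absurd hy' (h hy)⟩
  have h2 : ∀ᶠ y in 𝓝 x, ∀ i, y ∈ triangle (T i) → x ∈ triangle (T i) := by
    rw [eventually_all]
    intro i
    obtain ⟨r, hr, h⟩ := h i
    exact Metric.eventually_nhds_iff_ball.2 ⟨r, hr, h⟩
  exact Metric.eventually_nhds_iff_ball.1 h2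

end Polytope

/-! ### The two sides of a facial triangle -/

/-- The vector `ν` is normal to the triangle `t` and points into `P`: near every point in the
relative interior of `t`, the open half-space in direction `ν` belongs to the interior of `P` and
the opposite one is disjoint from `P`. -/
def IsInward (P : Set Space) (t : Fin 3 → Space) (ν : Space) : Prop :=
  ∀ x ∈ openTriangle t, ∃ r > 0, ∀ z ∈ Metric.ball x r,
    (0 < ν ⬝ᵥ (z - x) → z ∈ interior P) ∧ (ν ⬝ᵥ (z - x) < 0 → z ∉ P)

section Polytope

variable {P : Set Space} {n : ℕ} {T : Fin n → Fin 3 → Space}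

theorem convex_openTriangle (t : Fin 3 → Space) : Convex ℝ (openTriangle t) := by
  rintro x ⟨w, h0, h1, rfl⟩ y ⟨v, g0, g1, rfl⟩ a b ha hb hab
  refine ⟨fun k => a * w k + b * v k, fun k => ?_, ?_, ?_⟩
  · rcases ha.eq_or_lt with rfl | ha'
    · have : b = 1 := by linarith
      subst this; simpa using g0 k
    · have := mul_pos ha' (h0 k)
      have := mul_nonneg hb (g0 k).le
      dsimp only; linarith
  · rw [Finset.sum_add_distrib, ← Finset.mul_sum, ← Finset.mul_sum, h1, g1]; linarith
  · simp only [add_smul, Finset.sum_add_distrib, Finset.smul_sum, mul_smul]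

theorem centroid_mem_openTriangle (t : Fin 3 → Space) :
    (3⁻¹ : ℝ) • (t 0 + t 1 + t 2) ∈ openTriangle t := by
  refine ⟨fun _ => 3⁻¹, fun _ => by norm_num, by norm_num [Fin.sum_univ_three], ?_⟩
  simp [Fin.sum_univ_three]

theorem convex_dotProduct_pos (ν x : Space) : Convex ℝ {z : Space | 0 < ν ⬝ᵥ (z - x)} := by
  intro y hy z hz a b ha hb hab
  have : a • y + b • z - x = a • (y - x) + b • (z - x) := by
    have : a = 1 - b := by linarith
    subst this; module
  simp only [Set.mem_ofPred_eq] at *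
  rw [this, dotProduct_add, dotProduct_smul, dotProduct_smul, smul_eq_mul, smul_eq_mul]
  rcases ha.eq_or_lt with rfl | ha'
  · have : b = 1 := by linarith
    subst this; linarith
  · have := mul_pos ha' hy
    have := mul_nonneg hb hz.le
    linarith

theorem dotProduct_sub_of_mem {t : Fin 3 → Space} {x : Space} (hx : x ∈ triangle t) (s : ℝ)
    (z : Space) : (s • normal t) ⬝ᵥ (z - x) = s * (normal t ⬝ᵥ (z - t 0)) := by
  have h := normal_dot_of_mem hx 0
  rw [smul_dotProduct, smul_eq_mul, ← sub_sub_sub_cancel_right z x (t 0), dotProduct_sub, h,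
    sub_zero]

/-- The same side of a facial triangle, near any two points of its relative interior, consists of
interior points or of exterior points. -/
theorem IsTriangulatedPolytope.side_aux (hP : IsTriangulatedPolytope P T) (i : Fin n) (s : ℝ)
    {x x' : Space} (hx : x ∈ openTriangle (T i)) (hx' : x' ∈ openTriangle (T i)) :
    ∃ δ > 0, ∀ z ∈ Metric.ball x δ, ∀ z' ∈ Metric.ball x' δ,
      0 < (s • normal (T i)) ⬝ᵥ (z - x) → 0 < (s • normal (T i)) ⬝ᵥ (z' - x') →
      z ∈ P → z' ∈ interior P := by
  have hseg : segment ℝ x x' ⊆ openTriangle (T i) := (convex_openTriangle _).segment_subset hx hx'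
  have hopen : IsOpen (⋂ j : {j // j ≠ i}, (triangle (T j))ᶜ) :=
    isOpen_iInter_of_finite fun j => (isClosed_triangle _).isOpen_compl
  have hsub : segment ℝ x x' ⊆ ⋂ j : {j // j ≠ i}, (triangle (T j))ᶜ := by
    intro y hy
    simp only [Set.mem_iInter]
    exact fun j hj => j.2 (hP.eq_of_mem_openTriangle (hseg hy) hj).symm
  have hcomp : IsCompact (segment ℝ x x') := by
    rw [← convexHull_pair]
    exact (Set.toFinite _).isCompact_convexHull ℝ
  obtain ⟨δ, hδ, hthick⟩ := hcomp.exists_thickening_subset_open hopen hsub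
  refine ⟨δ, hδ, fun z hz z' hz' hpos hpos' hzP => ?_⟩
  set U := Metric.thickening δ (segment ℝ x x') ∩ {z | 0 < (s • normal (T i)) ⬝ᵥ (z - x)} with hU
  have hUc : IsPreconnected U :=
    (((convex_segment x x').thickening δ).inter (convex_dotProduct_pos _ _)).isPreconnected
  have hdisj : Disjoint U (frontier P) := by
    rw [Set.disjoint_left, hP.frontier_eq]
    rintro y ⟨hy, hy'⟩ hyT
    obtain ⟨j, hj⟩ := Set.mem_iUnion.1 hyT
    rcases eq_or_ne j i with rfl | hji
    · rw [Set.mem_ofPred_eq, dotProduct_sub_of_mem (openTriangle_subset _ hx),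
        normal_dot_of_mem hj, mul_zero] at hy'
      exact lt_irrefl _ hy'
    · exact Set.mem_iInter.1 (hthick hy) ⟨j, hji⟩ hj
  have hzU : z ∈ U := ⟨Metric.mem_thickening_iff.2 ⟨x, left_mem_segment ℝ x x', hz⟩, hpos⟩
  have hz'U : z' ∈ U := by
    refine ⟨Metric.mem_thickening_iff.2 ⟨x', right_mem_segment ℝ x x', hz'⟩, ?_⟩
    rw [Set.mem_ofPred_eq, dotProduct_sub_of_mem (openTriangle_subset _ hx)]
    rwa [dotProduct_sub_of_mem (openTriangle_subset _ hx')] at hpos'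
  have hzi : z ∈ interior P := by
    by_contra hc
    exact Set.disjoint_left.1 hdisj hzU ⟨subset_closure hzP, hc⟩
  exact subset_interior_of_isPreconnected hUc hdisj hzU hzi hz'U

/-- Exactly one of the two unit multiples of the normal vector points inwards. -/
theorem IsTriangulatedPolytope.exists_isInward (hP : IsTriangulatedPolytope P T) (i : Fin n) :
    ∃ σ : ℝ, (σ = 1 ∨ σ = -1) ∧ IsInward P (T i) (σ • normal (T i)) := by
  let B : ℝ → Prop := fun s => ∃ x ∈ openTriangle (T i), ∀ δ > 0, ∃ z ∈ Metric.ball x δ,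
    0 < (s • normal (T i)) ⬝ᵥ (z - x) ∧ z ∈ P
  have hN := hP.normal_ne_zero i
  have hNN := dotProduct_self_pos hN
  have hB : ∀ s, B s → ∀ x' ∈ openTriangle (T i), ∃ δ > 0, ∀ z ∈ Metric.ball x' δ,
      0 < (s • normal (T i)) ⬝ᵥ (z - x') → z ∈ interior P := by
    rintro s ⟨x, hx, h⟩ x' hx'
    obtain ⟨δ, hδ, h'⟩ := hP.side_aux i s hx hx'
    obtain ⟨z, hz, hz1, hz2⟩ := h δ hδ
    exact ⟨δ, hδ, fun z' hz' hpos => h' z hz z' hz' hz1 hpos hz2⟩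
  have hnB : ∀ s, ¬ B s → ∀ x' ∈ openTriangle (T i), ∃ δ > 0, ∀ z ∈ Metric.ball x' δ,
      0 < (s • normal (T i)) ⬝ᵥ (z - x') → z ∉ P := by
    intro s hs x' hx'
    by_contra! hc
    exact hs ⟨x', hx', hc⟩
  have hxc := centroid_mem_openTriangle (T i)
  set x := (3⁻¹ : ℝ) • (T i 0 + T i 1 + T i 2)
  have hxf := hP.triangle_subset_frontier i (openTriangle_subset _ hxc)
  -- every point is a limit of points off the plane of the triangle
  have hpush : ∀ y : Space, ∀ U ∈ 𝓝 y, ∃ ε > 0, y + (ε : ℝ) • normal (T i) ∈ U ∧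
      normal (T i) ⬝ᵥ (y + ε • normal (T i) - x) ≠ 0 := by
    intro y U hU
    have hc : Tendsto (fun ε : ℝ => y + ε • normal (T i)) (𝓝[>] 0) (𝓝 y) := by
      have : Continuous fun ε : ℝ => y + ε • normal (T i) := by fun_prop
      have := this.tendsto 0
      rw [zero_smul, add_zero] at this
      exact this.mono_left nhdsWithin_le_nhds
    have h1 := hc.eventually hU
    have h2 : ∀ᶠ ε : ℝ in 𝓝[>] 0, normal (T i) ⬝ᵥ (y + ε • normal (T i) - x) ≠ 0 := by
      have hs : ∀ ε : ℝ, normal (T i) ⬝ᵥ (y + ε • normal (T i) - x) =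
          normal (T i) ⬝ᵥ (y - x) + ε * (normal (T i) ⬝ᵥ normal (T i)) := by
        intro ε
        rw [add_sub_right_comm, dotProduct_add, dotProduct_smul, smul_eq_mul]
      rcases le_or_gt 0 (normal (T i) ⬝ᵥ (y - x)) with h | h
      · filter_upwards [self_mem_nhdsWithin] with ε hε
        rw [hs]
        have := mul_pos (show (0 : ℝ) < ε from hε) hNN
        linarith
      · have hc2 : Tendsto (fun ε : ℝ => normal (T i) ⬝ᵥ (y - x) +
            ε * (normal (T i) ⬝ᵥ normal (T i))) (𝓝[>] 0) (𝓝 (normal (T i) ⬝ᵥ (y - x))) := by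
          have : Continuous fun ε : ℝ => normal (T i) ⬝ᵥ (y - x) +
            ε * (normal (T i) ⬝ᵥ normal (T i)) := by fun_prop
          have := this.tendsto 0
          rw [zero_mul, add_zero] at this
          exact this.mono_left nhdsWithin_le_nhds
        filter_upwards [hc2.eventually (gt_mem_nhds h)] with ε hε
        rw [hs]; exact hε.ne
    obtain ⟨ε, ⟨h1, h2⟩, h3⟩ := ((h1.and h2).and self_mem_nhdsWithin).exists
    exact ⟨ε, h3, h1, h2⟩
  have hneg : ∀ z y : Space, ((-1 : ℝ) • normal (T i)) ⬝ᵥ (z - y) =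
      -((1 : ℝ) • normal (T i) ⬝ᵥ (z - y)) := by
    intro z y; simp only [neg_smul, one_smul, neg_dotProduct]
  by_cases h1 : B 1 <;> by_cases h2 : B (-1)
  · obtain ⟨δ, hδ, h⟩ := hB 1 h1 x hxc
    obtain ⟨δ', hδ', h'⟩ := hB (-1) h2 x hxc
    refine absurd ?_ hxf.2
    rw [mem_interior_iff_mem_nhds]
    filter_upwards [Metric.ball_mem_nhds x hδ, Metric.ball_mem_nhds x hδ'] with y hy hy'
    have : y ∈ closure P := by
      rw [mem_closure_iff_nhds]
      intro U hU
      obtain ⟨ε, hε, hm, hne⟩ := hpush y (U ∩ (Metric.ball x δ ∩ Metric.ball x δ'))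
        (inter_mem hU (inter_mem (Metric.isOpen_ball.mem_nhds hy)
          (Metric.isOpen_ball.mem_nhds hy')))
      refine ⟨_, hm.1, interior_subset ?_⟩
      rcases hne.lt_or_gt with hlt | hgt
      · exact h' _ hm.2.2 (by rw [hneg, one_smul]; linarith)
      · exact h _ hm.2.1 (by rwa [one_smul])
    rwa [hP.isCompact.isClosed.closure_eq] at this
  · refine ⟨1, Or.inl rfl, fun y hy => ?_⟩
    obtain ⟨δ, hδ, h⟩ := hB 1 h1 y hy
    obtain ⟨δ', hδ', h'⟩ := hnB (-1) h2 y hy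
    refine ⟨min δ δ', lt_min hδ hδ', fun z hz => ⟨h z (Metric.ball_subset_ball (min_le_left _ _) hz),
      fun hlt => h' z (Metric.ball_subset_ball (min_le_right _ _) hz) ?_⟩⟩
    rw [hneg]; linarith
  · refine ⟨-1, Or.inr rfl, fun y hy => ?_⟩
    obtain ⟨δ, hδ, h⟩ := hB (-1) h2 y hy
    obtain ⟨δ', hδ', h'⟩ := hnB 1 h1 y hy
    refine ⟨min δ δ', lt_min hδ hδ', fun z hz => ⟨h z (Metric.ball_subset_ball (min_le_left _ _) hz),
      fun hlt => h' z (Metric.ball_subset_ball (min_le_right _ _) hz) ?_⟩⟩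
    rw [hneg] at hlt; linarith
  · exfalso
    obtain ⟨δ, hδ, h⟩ := hnB 1 h1 x hxc
    obtain ⟨δ', hδ', h'⟩ := hnB (-1) h2 x hxc
    have hxP : x ∈ closure (interior P) := by
      rw [hP.closure_interior]; exact hP.frontier_subset hxf
    obtain ⟨y, ⟨hy1, hy2⟩, hyP⟩ := mem_closure_iff_nhds.1 hxP _
      (inter_mem (Metric.ball_mem_nhds x hδ) (Metric.ball_mem_nhds x hδ'))
    obtain ⟨ε, hε, hm, hne⟩ := hpush y (interior P ∩ (Metric.ball x δ ∩ Metric.ball x δ'))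
        (inter_mem (isOpen_interior.mem_nhds hyP) (inter_mem (Metric.isOpen_ball.mem_nhds hy1)
          (Metric.isOpen_ball.mem_nhds hy2)))
    rcases hne.lt_or_gt with hlt | hgt
    · exact h' _ hm.2.2 (by rw [hneg, one_smul]; linarith) (interior_subset hm.1)
    · exact h _ hm.2.1 (by rwa [one_smul]) (interior_subset hm.1)

/-! ### Counting the crossings of a ray -/

theorem hit_unique {t : Fin 3 → Space} {x d : Space} (hd : normal t ⬝ᵥ d ≠ 0) {a b : ℝ}
    (ha : x + a • d ∈ triangle t) (hb : x + b • d ∈ triangle t) : a = b := by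
  have h1 := normal_dot_of_mem ha 0
  have h2 := normal_dot_of_mem hb 0
  have : (a - b) * (normal t ⬝ᵥ d) = 0 := by
    have h3 : x + a • d - t 0 = (x + b • d - t 0) + (a - b) • d := by module
    rw [h3, dotProduct_add, h2, dotProduct_smul, smul_eq_mul, zero_add] at h1
    exact h1
  rcases mul_eq_zero.1 this with h | h
  · linarith
  · exact absurd h hd

theorem eventually_add_smul_mem_ball (x d : Space) {r : ℝ} (hr : 0 < r) :
    ∀ᶠ ε : ℝ in 𝓝[>] 0, x + ε • d ∈ Metric.ball x r := by
  have : Continuous fun ε : ℝ => x + ε • d := by fun_prop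
  have h := this.tendsto 0
  rw [zero_smul, add_zero] at h
  exact (h.mono_left nhdsWithin_le_nhds).eventually (Metric.ball_mem_nhds x hr)

theorem IsInward.eventually_mem {t : Fin 3 → Space} {ν x d : Space} (h : IsInward P t ν)
    (hx : x ∈ openTriangle t) (hd : 0 < ν ⬝ᵥ d) :
    ∀ᶠ ε : ℝ in 𝓝[>] 0, x + ε • d ∈ interior P := by
  obtain ⟨r, hr, h⟩ := h x hx
  filter_upwards [eventually_add_smul_mem_ball x d hr, self_mem_nhdsWithin] with ε h1 h2
  refine (h _ h1).1 ?_
  rw [add_sub_cancel_left, dotProduct_smul]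
  exact mul_pos h2 hd

theorem IsInward.eventually_notMem {t : Fin 3 → Space} {ν x d : Space} (h : IsInward P t ν)
    (hx : x ∈ openTriangle t) (hd : ν ⬝ᵥ d < 0) :
    ∀ᶠ ε : ℝ in 𝓝[>] 0, x + ε • d ∉ P := by
  obtain ⟨r, hr, h⟩ := h x hx
  filter_upwards [eventually_add_smul_mem_ball x d hr, self_mem_nhdsWithin] with ε h1 h2
  refine (h _ h1).2 ?_
  rw [add_sub_cancel_left, dotProduct_smul]
  exact mul_neg_of_pos_of_neg h2 hd

/-- The ends of a segment that does not meet the boundary are both inside or both outside. -/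
theorem mem_interior_of_segment {x d : Space} {a b : ℝ} (hab : a ≤ b)
    (h : ∀ t ∈ Set.Icc a b, x + t • d ∉ frontier P) :
    x + a • d ∈ interior P ↔ x + b • d ∈ interior P := by
  have hc : IsPreconnected ((fun t : ℝ => x + t • d) '' Set.Icc a b) :=
    isPreconnected_Icc.image _ (by fun_prop)
  have hd : Disjoint ((fun t : ℝ => x + t • d) '' Set.Icc a b) (frontier P) := by
    rw [Set.disjoint_left]
    rintro _ ⟨t, ht, rfl⟩
    exact h t ht
  have ha : x + a • d ∈ (fun t : ℝ => x + t • d) '' Set.Icc a b := ⟨a, ⟨le_rfl, hab⟩, rfl⟩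
  have hb : x + b • d ∈ (fun t : ℝ => x + t • d) '' Set.Icc a b := ⟨b, ⟨hab, le_rfl⟩, rfl⟩
  exact ⟨fun h' => subset_interior_of_isPreconnected hc hd ha h' hb,
    fun h' => subset_interior_of_isPreconnected hc hd hb h' ha⟩

/-- A ray crosses the facial triangles in general position if it meets them only in their
relative interiors and transversally. -/
def GeneralRay (T : Fin n → Fin 3 → Space) (x d : Space) : Prop :=
  ∀ t : ℝ, 0 < t → ∀ k, x + t • d ∈ triangle (T k) →
    x + t • d ∈ openTriangle (T k) ∧ normal (T k) ⬝ᵥ d ≠ 0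

/-- The facial triangles that the ray from `x` in direction `d` meets behind parameter `a`. -/
def hitsAfter (T : Fin n → Fin 3 → Space) (x d : Space) (a : ℝ) : Set (Fin n) :=
  {k | ∃ t, a < t ∧ x + t • d ∈ triangle (T k)}

theorem IsTriangulatedPolytope.exists_frontier_hit (hP : IsTriangulatedPolytope P T) {x d : Space}
    (hd : d ≠ 0) {a : ℝ} (hx : x + a • d ∈ interior P) :
    ∃ b, a < b ∧ x + b • d ∈ frontier P := by
  by_contra! hc
  obtain ⟨R, hR⟩ := hP.isCompact.isBounded.subset_closedBall 0
  have hnorm : 0 < ‖d‖ := norm_pos_iff.2 hd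
  set b := max a ((R + ‖x‖ + 1) / ‖d‖) with hb
  have hmem : x + b • d ∈ interior P := by
    refine (mem_interior_of_segment (le_max_left _ _) ?_).1 hx
    intro t ht
    rcases ht.1.eq_or_lt with rfl | h
    · exact fun h => h.2 hx
    · exact hc t h
  have h1 := hR (interior_subset hmem)
  rw [mem_closedBall_zero_iff] at h1
  have h2 : R + ‖x‖ + 1 ≤ b * ‖d‖ := (div_le_iff₀ hnorm).1 (le_max_right _ _)
  have h3 : ‖b • d‖ ≤ ‖x + b • d‖ + ‖x‖ := by
    have := norm_sub_le (x + b • d) x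
    rwa [add_sub_cancel_left] at this
  rw [norm_smul] at h3
  have h4 : b * ‖d‖ ≤ ‖b‖ * ‖d‖ := mul_le_mul_of_nonneg_right (le_abs_self b) hnorm.le
  linarith

/-- A point on a ray in general position is interior if and only if the number of facial triangles
that the ray meets behind it is odd: the last stretch of the ray is outside of the bounded set
`P`, and every crossing switches between inside and outside. -/
theorem IsTriangulatedPolytope.mem_interior_iff_odd (hP : IsTriangulatedPolytope P T)
    {x d : Space} (hd : d ≠ 0) (hgen : GeneralRay T x d) {a : ℝ} (ha : 0 < a)
    (hx : x + a • d ∉ frontier P) :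
    x + a • d ∈ interior P ↔ Odd (hitsAfter T x d a).ncard := by
  induction hm : (hitsAfter T x d a).ncard generalizing a with
  | zero =>
    simp only [Nat.not_odd_zero, iff_false]
    intro hin
    obtain ⟨b, hb, hbf⟩ := hP.exists_frontier_hit hd hin
    rw [hP.frontier_eq] at hbf
    obtain ⟨k, hk⟩ := Set.mem_iUnion.1 hbf
    have : k ∈ hitsAfter T x d a := ⟨b, hb, hk⟩
    rw [(Set.ncard_eq_zero (Set.toFinite _)).1 hm] at this
    exact this
  | succ m ih =>
    have hne : (hitsAfter T x d a).Nonempty := by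
      rw [← Set.ncard_pos]; omega
    have hpar : ∀ k, ∃ t, k ∈ hitsAfter T x d a → a < t ∧ x + t • d ∈ triangle (T k) := by
      intro k
      by_cases hk : k ∈ hitsAfter T x d a
      · obtain ⟨t, ht⟩ := hk
        exact ⟨t, fun _ => ht⟩
      · exact ⟨0, fun h => absurd h hk⟩
    choose τ hτ using hpar
    obtain ⟨k₀, hk₀, hmin⟩ := Set.exists_min_image _ τ (Set.toFinite _) hne
    have huniq : ∀ k t, a < t → x + t • d ∈ triangle (T k) → t = τ k := by
      intro k t ht hk
      have hk' := hτ k ⟨t, ht, hk⟩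
      exact hit_unique (hgen t (ha.trans ht) k hk).2 hk hk'.2
    obtain ⟨hah, hk₀T⟩ := hτ k₀ hk₀
    obtain ⟨hopen, htr⟩ := hgen _ (ha.trans hah) k₀ hk₀T
    have hother : ∀ k ∈ hitsAfter T x d a, k ≠ k₀ → τ k₀ < τ k := by
      intro k hk hkk
      refine lt_of_le_of_ne (hmin k hk) fun heq => hkk ?_
      have h2 := (hτ k hk).2
      rw [← heq] at h2
      exact (hP.eq_of_mem_openTriangle hopen h2).symm
    have hfree : ∀ t, a ≤ t → t < τ k₀ → x + t • d ∉ frontier P := by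
      intro t ht ht' hf
      rcases ht.eq_or_lt with rfl | ht
      · exact hx hf
      · rw [hP.frontier_eq] at hf
        obtain ⟨k, hk⟩ := Set.mem_iUnion.1 hf
        have h1 := huniq k t ht hk
        have h2 := hmin k ⟨t, ht, hk⟩
        linarith
    obtain ⟨σ, hσ, hin⟩ := hP.exists_isInward k₀
    have hσN : (σ • normal (T k₀)) ⬝ᵥ d ≠ 0 := by
      rw [smul_dotProduct, smul_eq_mul]
      refine mul_ne_zero ?_ htr
      rcases hσ with rfl | rfl <;> norm_num
    -- the crossing switches between inside and outside
    have hswitch : ∀ᶠ ε : ℝ in 𝓝[>] 0, x + (τ k₀ + ε) • d ∉ frontier P ∧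
        (x + (τ k₀ - ε) • d ∈ interior P ↔ x + (τ k₀ + ε) • d ∉ interior P) := by
      have e1 : ∀ ε : ℝ, x + (τ k₀ + ε) • d = x + τ k₀ • d + ε • d := fun ε => by module
      have e2 : ∀ ε : ℝ, x + (τ k₀ - ε) • d = x + τ k₀ • d + ε • (-d) := fun ε => by module
      rcases hσN.lt_or_gt with hlt | hgt
      · filter_upwards [hin.eventually_notMem hopen hlt,
          hin.eventually_mem hopen (d := -d) (by rw [dotProduct_neg]; linarith)] with ε h1 h2
        rw [e1, e2]
        exact ⟨fun h => h1 (hP.frontier_subset h),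
          fun _ h => h1 (interior_subset h), fun _ => h2⟩
      · filter_upwards [hin.eventually_mem hopen hgt,
          hin.eventually_notMem hopen (d := -d) (by rw [dotProduct_neg]; linarith)] with ε h1 h2
        rw [e1, e2]
        exact ⟨fun h => h.2 h1, fun h => absurd (interior_subset h) h2, fun h => absurd h1 h⟩
    have hsmall : ∀ᶠ ε : ℝ in 𝓝[>] 0, ∀ k, k ∈ hitsAfter T x d a → k ≠ k₀ → ε < τ k - τ k₀ := by
      rw [eventually_all]
      intro k
      by_cases hk : k ∈ hitsAfter T x d a ∧ k ≠ k₀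
      · have := hother k hk.1 hk.2
        filter_upwards [Ioo_mem_nhdsGT (show 0 < τ k - τ k₀ by linarith)] with ε hε _ _
        exact hε.2
      · exact Eventually.of_forall fun ε h1 h2 => absurd ⟨h1, h2⟩ hk
    obtain ⟨ε, ⟨⟨hε1, hε2⟩, hε3⟩, hε4⟩ := ((hswitch.and hsmall).and
      (Ioo_mem_nhdsGT (show 0 < τ k₀ - a by linarith))).exists
    have hset : hitsAfter T x d (τ k₀ + ε) = hitsAfter T x d a \ {k₀} := by
      ext k
      constructor
      · rintro ⟨t, ht, hk⟩
        have ht' : a < t := by linarith [hε4.1]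
        refine ⟨⟨t, ht', hk⟩, ?_⟩
        rintro rfl
        have := huniq _ t ht' hk
        linarith [hε4.1]
      · rintro ⟨hk, hkk⟩
        exact ⟨τ k, by linarith [hε3 k hk hkk], (hτ k hk).2⟩
    have hcard : (hitsAfter T x d (τ k₀ + ε)).ncard = m := by
      rw [hset, Set.ncard_sdiff_singleton_of_mem hk₀, hm]; rfl
    have hrec := ih (by linarith [hε4.1] : 0 < τ k₀ + ε) hε1 hcard
    have hleft : x + a • d ∈ interior P ↔ x + (τ k₀ - ε) • d ∈ interior P :=
      mem_interior_of_segment (by linarith [hε4.2])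
        fun t ht => hfree t ht.1 (by linarith [ht.2, hε4.1])
    rw [hleft, hε2, hrec, Nat.odd_add_one]

/-- An inward normal vector is recognized by the parity of the number of facial triangles that a
ray meets. -/
theorem IsTriangulatedPolytope.isInward_pos_iff_odd (hP : IsTriangulatedPolytope P T)
    {x d ν : Space} (hd : d ≠ 0) (hgen : GeneralRay T x d) {i : Fin n}
    (hx : x ∈ openTriangle (T i)) (hν : IsInward P (T i) ν) (hνd : ν ⬝ᵥ d ≠ 0) :
    0 < ν ⬝ᵥ d ↔ Odd (hitsAfter T x d 0).ncard := by
  have hsmall : ∀ᶠ ε : ℝ in 𝓝[>] 0, hitsAfter T x d ε = hitsAfter T x d 0 := by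
    have : ∀ᶠ ε : ℝ in 𝓝[>] 0, ∀ k ∈ hitsAfter T x d 0, k ∈ hitsAfter T x d ε := by
      rw [eventually_all]
      intro k
      by_cases hk : k ∈ hitsAfter T x d 0
      · obtain ⟨t, ht, hk⟩ := hk
        filter_upwards [Ioo_mem_nhdsGT ht] with ε hε _
        exact ⟨t, hε.2, hk⟩
      · exact Eventually.of_forall fun ε h => absurd h hk
    filter_upwards [this, self_mem_nhdsWithin] with ε h1 h2
    refine Set.Subset.antisymm ?_ h1
    rintro k ⟨t, ht, hk⟩
    exact ⟨t, lt_trans h2 ht, hk⟩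
  rcases hνd.lt_or_gt with hlt | hgt
  · obtain ⟨ε, ⟨h1, h2⟩, h3⟩ :=
      ((hsmall.and (hν.eventually_notMem hx hlt)).and self_mem_nhdsWithin).exists
    rw [← h1, ← hP.mem_interior_iff_odd hd hgen h3 fun h => h2 (hP.frontier_subset h)]
    exact ⟨fun h => absurd hlt h.not_gt, fun h => absurd (interior_subset h) h2⟩
  · obtain ⟨ε, ⟨h1, h2⟩, h3⟩ :=
      ((hsmall.and (hν.eventually_mem hx hgt)).and self_mem_nhdsWithin).exists
    rw [← h1, ← hP.mem_interior_iff_odd hd hgen h3 fun h => h.2 h2]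
    exact ⟨fun _ => h2, fun _ => hgt⟩

end Polytope

/-! ### A ray in general position -/

/-- The directions `(1, s, s ^ 2)`. For large `s` they are in general position with respect to
finitely many given vectors. -/
def momentDir (s : ℝ) : Space := ![1, s, s ^ 2]

/-- The vector `w` has a positive product with `(1, s, s ^ 2)` for all large `s`, expressed as a
comparison of the coordinates of `w` with zero. -/
def LexPos (w : Space) : Prop :=
  0 < w 2 ∨ (¬ w 2 < 0 ∧ (0 < w 1 ∨ (¬ w 1 < 0 ∧ 0 < w 0)))

theorem dot_momentDir (w : Space) (s : ℝ) : w ⬝ᵥ momentDir s = w 0 + w 1 * s + w 2 * s ^ 2 := by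
  rw [vec3_dotProduct]; simp [momentDir]

theorem momentDir_ne_zero (s : ℝ) : momentDir s ≠ 0 := fun h => by
  simpa [momentDir] using congrFun h 0

theorem LexPos.eventually_pos {w : Space} (h : LexPos w) :
    ∀ᶠ s in atTop, 0 < w ⬝ᵥ momentDir s := by
  simp only [dot_momentDir]
  rcases h with h | ⟨h2, h | ⟨h1, h⟩⟩
  · filter_upwards [eventually_ge_atTop (1 : ℝ),
      eventually_ge_atTop ((|w 0| + |w 1| + 1) / w 2)] with s hs1 hs2
    rw [div_le_iff₀ h] at hs2
    have h3 := neg_abs_le (w 0)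
    have h4 := neg_abs_le (w 1)
    nlinarith [abs_nonneg (w 0), abs_nonneg (w 1), mul_le_mul_of_nonneg_right hs2 (by linarith : 0 ≤ s),
      mul_le_mul_of_nonneg_right h4 (by linarith : 0 ≤ s)]
  · filter_upwards [eventually_ge_atTop (1 : ℝ),
      eventually_ge_atTop ((|w 0| + 1) / w 1)] with s hs1 hs2
    rw [div_le_iff₀ h] at hs2
    have h3 := neg_abs_le (w 0)
    nlinarith [mul_nonneg (not_lt.1 h2) (sq_nonneg s)]
  · filter_upwards [eventually_ge_atTop (0 : ℝ)] with s hs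
    have := mul_nonneg (not_lt.1 h2) (sq_nonneg s)
    have := mul_nonneg (not_lt.1 h1) hs
    linarith

theorem not_lexPos_zero : ¬ LexPos 0 := by simp [LexPos]

theorem lexPos_neg_of_not {w : Space} (h : ¬ LexPos w) (hw : w ≠ 0) : LexPos (-w) := by
  unfold LexPos at *
  simp only [Pi.neg_apply, Left.neg_pos_iff, Left.neg_neg_iff]
  push Not at h
  rcases lt_trichotomy (w 2) 0 with h2 | h2 | h2
  · exact Or.inl h2
  · refine Or.inr ⟨h2.le.not_gt, ?_⟩
    obtain ⟨h3, h4⟩ := h.2 h2.ge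
    rcases h3.lt_or_eq with h3 | h3
    · exact Or.inl h3
    · refine Or.inr ⟨h3.le.not_gt, lt_of_le_of_ne (h4 h3.ge) fun h5 => hw ?_⟩
      ext j; fin_cases j <;> simpa
  · linarith [h.1]

theorem eventually_lexPos_iff (w : Space) :
    ∀ᶠ s in atTop, (LexPos w ↔ 0 < w ⬝ᵥ momentDir s) ∧ (w ≠ 0 → w ⬝ᵥ momentDir s ≠ 0) := by
  by_cases hw : w = 0
  · subst hw
    exact Eventually.of_forall fun s => by simp [not_lexPos_zero]
  · by_cases h : LexPos w
    · filter_upwards [h.eventually_pos] with s hs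
      exact ⟨⟨fun _ => hs, fun _ => h⟩, fun _ => hs.ne'⟩
    · filter_upwards [(lexPos_neg_of_not h hw).eventually_pos] with s hs
      rw [neg_dotProduct] at hs
      exact ⟨⟨fun h' => absurd h' h, fun h' => by linarith⟩, fun _ h' => by linarith⟩

/-- Whether the ray from `x` in direction `(1, s, s ^ 2)` meets the triangle `t` for all
large `s`. By Cramer's rule, the signs of four determinants tell. -/
def RayHits (x : Space) (t : Fin 3 → Space) : Prop :=
  ∀ k : Fin 3, LexPos (((t 0 - x) ⬝ᵥ ((t 1 - x) ⨯₃ (t 2 - x))) •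
    ((t (k + 1) - x) ⨯₃ (t (k + 2) - x)))

theorem triple_shift (x : Space) (t : Fin 3 → Space) :
    (t 0 - x) ⬝ᵥ ((t 1 - x) ⨯₃ (t 2 - x)) = normal t ⬝ᵥ (t 0 - x) := by
  simp only [normal, vec3_dotProduct, cross_zero, cross_one, cross_two, Pi.sub_apply]
  ring

theorem cramer_dot (x d : Space) (t : Fin 3 → Space) {w : Fin 3 → ℝ} (h1 : ∑ k, w k = 1) {τ : ℝ}
    (h : ∑ k, w k • t k = x + τ • d) (k : Fin 3) :
    τ * (((t (k + 1) - x) ⨯₃ (t (k + 2) - x)) ⬝ᵥ d) =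
      w k * ((t 0 - x) ⬝ᵥ ((t 1 - x) ⨯₃ (t 2 - x))) := by
  have hd : τ • d = ∑ k, w k • (t k - x) := by
    simp only [smul_sub, Finset.sum_sub_distrib, ← Finset.sum_smul, h1, h, one_smul]
    module
  rw [← smul_eq_mul, ← dotProduct_smul, hd]
  fin_cases k <;>
  · simp only [vec3_dotProduct, cross_zero, cross_one, cross_two, Pi.sub_apply, sum_smul_apply,
      Fin.isValue, Fin.zero_eta, Fin.mk_one, Fin.reduceFinMk, Fin.reduceAdd, zero_add]
    ring

section Polytope

variable {P : Set Space} {n : ℕ} {T : Fin n → Fin 3 → Space}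

/-- In a direction in general position, the ray from `x` is a ray in general position, and the
sign conditions decide which facial triangles it meets. -/
theorem IsTriangulatedPolytope.exists_generalRay (hP : IsTriangulatedPolytope P T) (x : Space) :
    ∃ d : Space, d ≠ 0 ∧ GeneralRay T x d ∧ (∀ k, k ∈ hitsAfter T x d 0 ↔ RayHits x (T k)) ∧
      ∀ k, (LexPos (normal (T k)) ↔ 0 < normal (T k) ⬝ᵥ d) ∧ normal (T k) ⬝ᵥ d ≠ 0 := by
  let D : Fin n → ℝ := fun k => (T k 0 - x) ⬝ᵥ ((T k 1 - x) ⨯₃ (T k 2 - x))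
  let w : Fin n → Fin 3 → Space := fun k m => (T k (m + 1) - x) ⨯₃ (T k (m + 2) - x)
  have hev : ∀ᶠ s in atTop, ∀ k : Fin n,
      ((LexPos (normal (T k)) ↔ 0 < normal (T k) ⬝ᵥ momentDir s) ∧
        (normal (T k) ≠ 0 → normal (T k) ⬝ᵥ momentDir s ≠ 0)) ∧
      ∀ m : Fin 3, (LexPos (D k • w k m) ↔ 0 < (D k • w k m) ⬝ᵥ momentDir s) ∧
        (w k m ≠ 0 → w k m ⬝ᵥ momentDir s ≠ 0) := by
    rw [eventually_all]
    intro k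
    refine (eventually_lexPos_iff _).and ?_
    rw [eventually_all]
    intro m
    exact ((eventually_lexPos_iff (D k • w k m)).and (eventually_lexPos_iff (w k m))).mono
      fun s h => ⟨h.1.1, h.2.2⟩
  obtain ⟨s, hs⟩ := hev.exists
  set d := momentDir s
  have hnd : ∀ k, normal (T k) ⬝ᵥ d ≠ 0 := fun k => (hs k).1.2 (hP.normal_ne_zero k)
  have hD : ∀ k, D k = normal (T k) ⬝ᵥ (T k 0 - x) := fun k => triple_shift x (T k)
  -- a triangle that is met has a nonzero determinant and positive coordinates
  have hmeet : ∀ k (τ : ℝ), 0 < τ → x + τ • d ∈ triangle (T k) →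
      x + τ • d ∈ openTriangle (T k) ∧ RayHits x (T k) := by
    intro k τ hτ hk
    have hDk : D k ≠ 0 := by
      intro h0
      have h1 := normal_dot_of_mem hk 0
      rw [show x + τ • d - T k 0 = τ • d - (T k 0 - x) by module, dotProduct_sub, ← hD, h0,
        dotProduct_smul, sub_zero, smul_eq_mul] at h1
      exact (mul_ne_zero hτ.ne' (hnd k)) h1
    obtain ⟨v, hv0, hv1, hv⟩ := mem_triangle_iff.1 hk
    have hcr : ∀ m, τ * (w k m ⬝ᵥ d) = v m * D k := fun m => cramer_dot x d (T k) hv1 hv m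
    have hw : ∀ m, w k m ≠ 0 := by
      intro m hm
      apply hDk
      show (T k 0 - x) ⬝ᵥ ((T k 1 - x) ⨯₃ (T k 2 - x)) = 0
      have hm' : (T k (m + 1) - x) ⨯₃ (T k (m + 2) - x) = 0 := hm
      fin_cases m
      · have : (T k 1 - x) ⨯₃ (T k 2 - x) = 0 := hm'
        rw [this, dotProduct_zero]
      · have : (T k 2 - x) ⨯₃ (T k 0 - x) = 0 := hm'
        rw [triple_product_permutation, this, dotProduct_zero]
      · have : (T k 0 - x) ⨯₃ (T k 1 - x) = 0 := hm'
        rw [triple_product_permutation, triple_product_permutation, this, dotProduct_zero]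
    have hvpos : ∀ m, 0 < v m := by
      intro m
      refine lt_of_le_of_ne (hv0 m) fun h0 => ?_
      have := hcr m
      rw [← h0, zero_mul] at this
      exact mul_ne_zero hτ.ne' (((hs k).2 m).2 (hw m)) this
    refine ⟨⟨v, hvpos, hv1, hv⟩, fun m => ?_⟩
    rw [((hs k).2 m).1, smul_dotProduct, smul_eq_mul]
    have h1 : τ * (D k * (w k m ⬝ᵥ d)) = v m * D k ^ 2 := by
      rw [mul_left_comm, hcr m]; ring
    have h2 : 0 < v m * D k ^ 2 := mul_pos (hvpos m) (by positivity)
    rw [← h1] at h2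
    exact pos_of_mul_pos_right h2 hτ.le
  refine ⟨d, momentDir_ne_zero s, fun τ hτ k hk => ⟨(hmeet k τ hτ hk).1, hnd k⟩, fun k => ⟨?_, ?_⟩,
    fun k => ⟨(hs k).1.1, hnd k⟩⟩
  · rintro ⟨τ, hτ, hk⟩
    exact (hmeet k τ hτ hk).2
  · intro hk
    have hpos : ∀ m, 0 < D k * (w k m ⬝ᵥ d) := by
      intro m
      have := (((hs k).2 m).1).1 (hk m)
      rwa [smul_dotProduct, smul_eq_mul] at this
    set S := w k 0 ⬝ᵥ d + w k 1 ⬝ᵥ d + w k 2 ⬝ᵥ d with hS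
    have hDS : 0 < D k * S := by rw [hS, mul_add, mul_add]; linarith [hpos 0, hpos 1, hpos 2]
    have hS0 : S ≠ 0 := fun h => by rw [h, mul_zero] at hDS; exact lt_irrefl _ hDS
    have hdiv : ∀ r : ℝ, 0 < D k * r → 0 < r / S := by
      intro r hr
      have h1 : 0 < (D k * r) / (D k * S) := div_pos hr hDS
      have hDk : D k ≠ 0 := fun h => by rw [h, zero_mul] at hDS; exact lt_irrefl _ hDS
      rwa [mul_div_mul_left _ _ hDk] at h1
    have hDk : 0 < D k * D k := by
      refine lt_of_le_of_ne (mul_self_nonneg _) fun h => ?_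
      rw [mul_self_eq_zero.1 h.symm, zero_mul] at hDS
      exact lt_irrefl _ hDS
    refine ⟨D k / S, hdiv _ hDk, mem_triangle_iff.2 ⟨fun m => (w k m ⬝ᵥ d) / S,
      fun m => (hdiv _ (hpos m)).le, ?_, ?_⟩⟩
    · rw [← Finset.sum_div, Fin.sum_univ_three, ← hS, div_self hS0]
    · have hc : ∑ m, (w k m ⬝ᵥ d) • (T k m - x) = D k • d := by
        ext j
        fin_cases j <;>
        · simp only [sum_smul_apply, w, D, vec3_dotProduct, cross_zero,
            cross_one, cross_two, Pi.sub_apply, Pi.smul_apply, smul_eq_mul,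
            Fin.isValue, Fin.zero_eta, Fin.mk_one, Fin.reduceFinMk, Fin.reduceAdd, zero_add]
          ring
      have hc2 : ∑ m, (w k m ⬝ᵥ d) • T k m = S • x + D k • d := by
        rw [← hc]
        simp only [smul_sub, Finset.sum_sub_distrib, ← Finset.sum_smul]
        rw [Fin.sum_univ_three (f := fun m => w k m ⬝ᵥ d), ← hS]
        module
      calc ∑ m, ((w k m ⬝ᵥ d) / S) • T k m = S⁻¹ • ∑ m, (w k m ⬝ᵥ d) • T k m := by
            rw [Finset.smul_sum]
            exact Finset.sum_congr rfl fun m _ => by rw [smul_smul]; congr 1; ring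
        _ = x + (D k / S) • d := by
            rw [hc2, smul_add, smul_smul, smul_smul, inv_mul_cancel₀ hS0, one_smul]
            congr 2; ring

/-- The orientation of the `i`-th facial triangle: `1` or `-1`, such that this multiple of the
normal vector points inwards. -/
noncomputable def orientation (T : Fin n → Fin 3 → Space) (i : Fin n) : ℝ :=
  open Classical in
  if (LexPos (normal (T i)) ↔
    Odd {k | RayHits ((3⁻¹ : ℝ) • (T i 0 + T i 1 + T i 2)) (T k)}.ncard) then 1 else -1

theorem orientation_eq (T : Fin n → Fin 3 → Space) (i : Fin n) :
    orientation T i = 1 ∨ orientation T i = -1 := by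
  unfold orientation; split_ifs <;> simp

theorem IsTriangulatedPolytope.isInward_orientation (hP : IsTriangulatedPolytope P T)
    (i : Fin n) : IsInward P (T i) (orientation T i • normal (T i)) := by
  obtain ⟨d, hd, hgen, hhit, hN⟩ :=
    hP.exists_generalRay ((3⁻¹ : ℝ) • (T i 0 + T i 1 + T i 2))
  obtain ⟨σ, hσ, hin⟩ := hP.exists_isInward i
  have hset : hitsAfter T ((3⁻¹ : ℝ) • (T i 0 + T i 1 + T i 2)) d 0 =
      {k | RayHits ((3⁻¹ : ℝ) • (T i 0 + T i 1 + T i 2)) (T k)} := Set.ext hhit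
  have hne : (σ • normal (T i)) ⬝ᵥ d ≠ 0 := by
    rw [smul_dotProduct, smul_eq_mul]
    refine mul_ne_zero ?_ (hN i).2
    rcases hσ with rfl | rfl <;> norm_num
  have hodd := hP.isInward_pos_iff_odd hd hgen (centroid_mem_openTriangle (T i)) hin hne
  rw [hset, smul_dotProduct, smul_eq_mul] at hodd
  have hσe : orientation T i = σ := by
    unfold orientation
    rcases hσ with rfl | rfl
    · rw [if_pos]
      rw [← hodd, (hN i).1, one_mul]
    · rw [if_neg]
      rw [← hodd, (hN i).1]
      rcases (hN i).2.lt_or_gt with h | h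
      · intro h'
        have := h'.2 (by linarith)
        linarith
      · intro h'
        have := h'.1 h
        linarith
  rw [hσe]
  exact hin

end Polytope

/-! ### A rational substitute for the angle -/

/-- A substitute for the angle of the vector `(X, Y)` which needs no transcendental function: the
length, starting from `(1, 0)` and measured in the first coordinate, of the path along the
diamond `|x| + |y| = 1` to the multiple of `(X, Y)` on it. A full turn has length `4`. -/
noncomputable def diamondAngle (X Y : ℝ) : ℝ :=
  if Y < 0 then if X < 0 then 3 + X / (-X - Y) else 3 + X / (X - Y)
  else if X < 0 then 1 - X / (Y - X) else 1 - X / (X + Y)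

/-- First coordinate of the point at angle `τ` on the diamond, for `0 ≤ τ ≤ 4`. -/
def diamondX (τ : ℝ) : ℝ := |τ - 2| - 1

/-- Second coordinate of the point at angle `τ` on the diamond, for `0 ≤ τ ≤ 4`. -/
def diamondY (τ : ℝ) : ℝ := |τ - 3| - |τ - 1| + τ - 2

theorem diamond_of_le_two {τ : ℝ} (h : τ ≤ 2) : diamondX τ = 1 - τ := by
  rw [diamondX, abs_of_nonpos (by linarith)]; ring

theorem diamond_of_two_le {τ : ℝ} (h : 2 ≤ τ) : diamondX τ = τ - 3 := by
  rw [diamondX, abs_of_nonneg (by linarith)]; ring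

theorem diamondY_of_le_one {τ : ℝ} (h : τ ≤ 1) : diamondY τ = τ := by
  rw [diamondY, abs_of_nonpos (by linarith), abs_of_nonpos (by linarith)]; ring

theorem diamondY_of_mem {τ : ℝ} (h : 1 ≤ τ) (h' : τ ≤ 3) : diamondY τ = 2 - τ := by
  rw [diamondY, abs_of_nonpos (by linarith), abs_of_nonneg (by linarith)]; ring

theorem diamondY_of_three_le {τ : ℝ} (h : 3 ≤ τ) : diamondY τ = τ - 4 := by
  rw [diamondY, abs_of_nonneg (by linarith), abs_of_nonneg (by linarith)]; ring

theorem diamondAngle_spec {X Y : ℝ} (h : X ≠ 0 ∨ Y ≠ 0) :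
    0 ≤ diamondAngle X Y ∧ diamondAngle X Y < 4 ∧ 0 < |X| + |Y| ∧
      X = (|X| + |Y|) * diamondX (diamondAngle X Y) ∧
      Y = (|X| + |Y|) * diamondY (diamondAngle X Y) := by
  unfold diamondAngle
  split_ifs with hY hX hX
  · have hL : 0 < -X - Y := by linarith
    have h0 : X / (-X - Y) < 0 := div_neg_of_neg_of_pos hX hL
    have h1 : -1 < X / (-X - Y) := by rw [lt_div_iff₀ hL]; linarith
    rw [diamond_of_two_le (by linarith), diamondY_of_mem (by linarith) (by linarith),
      abs_of_neg hX, abs_of_neg hY]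
    refine ⟨by linarith, by linarith, by linarith, ?_, ?_⟩ <;> field_simp <;> ring
  · have hL : 0 < X - Y := by linarith
    have h0 : 0 ≤ X / (X - Y) := div_nonneg (by linarith) hL.le
    have h1 : X / (X - Y) < 1 := by rw [div_lt_iff₀ hL]; linarith
    rw [diamond_of_two_le (by linarith), diamondY_of_three_le (by linarith),
      abs_of_nonneg (not_lt.1 hX), abs_of_neg hY]
    refine ⟨by linarith, by linarith, by linarith, ?_, ?_⟩ <;> field_simp <;> ring
  · have hL : 0 < Y - X := by linarith
    have h0 : X / (Y - X) < 0 := div_neg_of_neg_of_pos hX hL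
    have h1 : -1 ≤ X / (Y - X) := by rw [le_div_iff₀ hL]; linarith
    rw [diamond_of_le_two (by linarith), diamondY_of_mem (by linarith) (by linarith),
      abs_of_neg hX, abs_of_nonneg (not_lt.1 hY)]
    refine ⟨by linarith, by linarith, by linarith, ?_, ?_⟩ <;> field_simp <;> ring
  · have hL : 0 < X + Y := by
      rcases h with h | h
      · have := lt_of_le_of_ne (not_lt.1 hX) h.symm; linarith
      · have := lt_of_le_of_ne (not_lt.1 hY) h.symm; linarith
    have h0 : 0 ≤ X / (X + Y) := div_nonneg (by linarith) hL.le
    have h1 : X / (X + Y) ≤ 1 := by rw [div_le_iff₀ hL]; linarith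
    rw [diamond_of_le_two (by linarith), diamondY_of_le_one (by linarith),
      abs_of_nonneg (not_lt.1 hX), abs_of_nonneg (not_lt.1 hY)]
    refine ⟨by linarith, by linarith, by linarith, ?_, ?_⟩ <;> field_simp <;> ring

/-- The determinant of the points at angles `τ` and `τ'` on the diamond. -/
def diamondDet (τ τ' : ℝ) : ℝ := diamondX τ * diamondY τ' - diamondX τ' * diamondY τ

theorem diamond_sub_two {τ : ℝ} (h : 2 ≤ τ) (h' : τ ≤ 4) :
    diamondX τ = -diamondX (τ - 2) ∧ diamondY τ = -diamondY (τ - 2) := by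
  rw [diamond_of_two_le h, diamond_of_le_two (by linarith)]
  refine ⟨by ring, ?_⟩
  rcases le_total τ 3 with h3 | h3
  · rw [diamondY_of_mem (by linarith) h3, diamondY_of_le_one (by linarith)]; ring
  · rw [diamondY_of_three_le h3, diamondY_of_mem (by linarith) (by linarith)]; ring

theorem diamondDet_pos_aux {τ τ' : ℝ} (h0 : 0 ≤ τ) (h : τ < τ') (h2 : τ' < τ + 2) (h3 : τ' ≤ 2) :
    0 < diamondDet τ τ' := by
  unfold diamondDet
  rw [diamond_of_le_two (by linarith), diamond_of_le_two h3]
  rcases le_total τ' 1 with h' | h'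
  · rw [diamondY_of_le_one h', diamondY_of_le_one (by linarith)]; nlinarith
  · rw [diamondY_of_mem h' (by linarith)]
    rcases le_total τ 1 with h1 | h1
    · rw [diamondY_of_le_one h1]
      rcases eq_or_lt_of_le h0 with rfl | h0
      · nlinarith
      · rcases eq_or_lt_of_le h' with rfl | h'
        · nlinarith
        · nlinarith [mul_pos h0 (sub_pos.2 h'), mul_nonneg (sub_nonneg.2 h1) (sub_nonneg.2 h3)]
    · rw [diamondY_of_mem h1 (by linarith)]; nlinarith

theorem diamondDet_swap (τ τ' : ℝ) : diamondDet τ' τ = -diamondDet τ τ' := by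
  unfold diamondDet; ring

theorem diamondDet_pos {τ τ' : ℝ} (h0 : 0 ≤ τ) (h : τ < τ') (h2 : τ' < τ + 2) (h4 : τ' ≤ 4) :
    0 < diamondDet τ τ' := by
  rcases le_total τ' 2 with h' | h'
  · exact diamondDet_pos_aux h0 h h2 h'
  · obtain ⟨e1, e2⟩ := diamond_sub_two h' h4
    rcases lt_or_ge τ 2 with h1 | h1
    · have : diamondDet τ τ' = diamondDet (τ' - 2) τ := by
        unfold diamondDet; rw [e1, e2]; ring
      rw [this]
      exact diamondDet_pos_aux (by linarith) (by linarith) (by linarith) h1.le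
    · obtain ⟨e3, e4⟩ := diamond_sub_two h1 (by linarith)
      have : diamondDet τ τ' = diamondDet (τ - 2) (τ' - 2) := by
        unfold diamondDet; rw [e1, e2, e3, e4]; ring
      rw [this]
      exact diamondDet_pos_aux (by linarith) (by linarith) (by linarith) (by linarith)

theorem diamondDet_nonpos {τ τ' : ℝ} (h0 : 0 ≤ τ) (h : τ + 2 ≤ τ') (h4 : τ' ≤ 4) :
    diamondDet τ τ' ≤ 0 := by
  obtain ⟨e1, e2⟩ := diamond_sub_two (by linarith : 2 ≤ τ') h4
  have : diamondDet τ τ' = -diamondDet τ (τ' - 2) := by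
    unfold diamondDet; rw [e1, e2]; ring
  rw [this]
  rcases eq_or_lt_of_le h with h | h
  · rw [← h, add_sub_cancel_right, diamondDet]; linarith
  · rcases eq_or_lt_of_le (show τ' - 2 ≤ τ + 2 by linarith) with h5 | h5
    · have h6 : τ = 0 := by linarith
      have h7 : τ' = 4 := by linarith
      subst h6 h7
      norm_num [diamondDet, diamondX, diamondY]
    · linarith [diamondDet_pos h0 (by linarith : τ < τ' - 2) h5 (by linarith)]

theorem diamondY_pos_iff {τ : ℝ} (h4 : τ < 4) : 0 < diamondY τ ↔ 0 < τ ∧ τ < 2 := by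
  rcases le_total τ 1 with h | h
  · rw [diamondY_of_le_one h]; constructor
    · intro h'; exact ⟨h', by linarith⟩
    · exact fun h' => h'.1
  · rcases le_total τ 3 with h' | h'
    · rw [diamondY_of_mem h h']; constructor
      · intro _; constructor <;> linarith
      · intro _; linarith
    · rw [diamondY_of_three_le h']; constructor
      · intro _; constructor <;> linarith
      · intro _; linarith

theorem diamondY_neg_iff {τ : ℝ} (h0 : 0 ≤ τ) (h4 : τ < 4) : diamondY τ < 0 ↔ 2 < τ := by
  rcases le_total τ 1 with h | h
  · rw [diamondY_of_le_one h]; constructor <;> intro _ <;> linarith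
  · rcases le_total τ 3 with h' | h'
    · rw [diamondY_of_mem h h']; constructor <;> intro _ <;> linarith
    · rw [diamondY_of_three_le h']; constructor <;> intro _ <;> linarith

/-- Of three numbers, at least two are positive. -/
def TwoPos (a b c : ℝ) : Prop := (0 < a ∧ 0 < b) ∨ (0 < b ∧ 0 < c) ∨ (0 < c ∧ 0 < a)

/-- On the unit diamond, angles are compared by signs of determinants. -/
theorem diamond_lt_iff {τ τ' : ℝ} (h0 : 0 ≤ τ) (h4 : τ < 4) (h0' : 0 ≤ τ') (h4' : τ' < 4) :
    (0 < τ ∧ τ < τ') ↔ TwoPos (diamondY τ) (diamondDet τ τ') (-diamondY τ') := by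
  have hdet : 0 < diamondDet τ τ' → (τ < τ' ∧ τ' < τ + 2) ∨ τ' < τ := by
    intro h
    rcases lt_trichotomy τ τ' with h1 | rfl | h1
    · refine Or.inl ⟨h1, ?_⟩
      by_contra hc
      exact absurd h (diamondDet_nonpos h0 (not_lt.1 hc) h4'.le).not_gt
    · simp [diamondDet] at h
    · exact Or.inr h1
  have hdet2 : 0 < diamondDet τ τ' → τ' < τ → τ' + 2 ≤ τ := by
    intro h h1
    by_contra hc
    have := diamondDet_pos h0' h1 (not_le.1 hc) h4.le
    rw [diamondDet_swap] at this
    linarith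
  unfold TwoPos
  rw [diamondY_pos_iff h4, Left.neg_pos_iff, diamondY_neg_iff h0' h4']
  constructor
  · rintro ⟨h1, h2⟩
    rcases lt_or_ge τ 2 with h3 | h3
    · rcases lt_or_ge 2 τ' with h5 | h5
      · exact Or.inr (Or.inr ⟨h5, h1, h3⟩)
      · exact Or.inl ⟨⟨h1, h3⟩, diamondDet_pos h0 h2 (by linarith) h4'.le⟩
    · exact Or.inr (Or.inl ⟨diamondDet_pos h0 h2 (by linarith) h4'.le, by linarith⟩)
  · rintro (⟨h1, h2⟩ | ⟨h1, h2⟩ | ⟨h1, h2⟩)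
    · refine ⟨h1.1, ?_⟩
      rcases hdet h2 with h | h
      · exact h.1
      · have := hdet2 h2 h; linarith [h1.2]
    · rcases hdet h1 with h | h
      · exact ⟨by linarith [h.2], h.1⟩
      · have := hdet2 h1 h; linarith
    · exact ⟨h2.1, by linarith [h2.2]⟩

theorem twoPos_mul_iff {a b c p q r : ℝ} (hp : 0 < p) (hq : 0 < q) (hr : 0 < r) :
    TwoPos (p * a) (q * b) (r * c) ↔ TwoPos a b c := by
  unfold TwoPos
  rw [mul_pos_iff_of_pos_left hp, mul_pos_iff_of_pos_left hq, mul_pos_iff_of_pos_left hr]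

/-- Angles are compared by signs of determinants. -/
theorem diamondAngle_lt_iff {X Y X' Y' : ℝ} (h : X ≠ 0 ∨ Y ≠ 0) (h' : X' ≠ 0 ∨ Y' ≠ 0) :
    (0 < diamondAngle X Y ∧ diamondAngle X Y < diamondAngle X' Y') ↔
      TwoPos Y (X * Y' - X' * Y) (-Y') := by
  obtain ⟨h0, h4, hL, hX, hY⟩ := diamondAngle_spec h
  obtain ⟨h0', h4', hL', hX', hY'⟩ := diamondAngle_spec h'
  rw [diamond_lt_iff h0 h4 h0' h4']
  set τ := diamondAngle X Y
  set τ' := diamondAngle X' Y'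
  set L := |X| + |Y|
  set L' := |X'| + |Y'|
  rw [hX, hY, hX', hY', ← twoPos_mul_iff hL (mul_pos hL hL') hL']
  have e1 : L * diamondX τ * (L' * diamondY τ') - L' * diamondX τ' * (L * diamondY τ) =
      L * L' * diamondDet τ τ' := by unfold diamondDet; ring
  rw [e1, mul_neg]

theorem diamondAngle_self {X : ℝ} (h : 0 < X) : diamondAngle X 0 = 0 := by
  rw [diamondAngle, if_neg (lt_irrefl _), if_neg h.not_gt, add_zero, div_self h.ne', sub_self]

theorem diamondAngle_mul {L τ : ℝ} (hL : 0 < L) (h0 : 0 ≤ τ) (h4 : τ < 4) :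
    diamondAngle (L * diamondX τ) (L * diamondY τ) = τ := by
  unfold diamondAngle
  rcases le_total τ 1 with h | h
  · rw [diamondY_of_le_one h, diamond_of_le_two (by linarith),
      if_neg (by nlinarith [mul_nonneg hL.le h0]),
      if_neg (by nlinarith [mul_nonneg hL.le (sub_nonneg.2 h)])]
    field_simp; ring
  rcases le_total τ 2 with h2 | h2
  · rw [diamondY_of_mem h (by linarith), diamond_of_le_two (by linarith),
      if_neg (by nlinarith [mul_nonneg hL.le (sub_nonneg.2 h2)])]
    rcases eq_or_lt_of_le h with rfl | h
    · norm_num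
    · rw [if_pos (by nlinarith [mul_pos hL (sub_pos.2 h)])]
      field_simp; ring
  rcases eq_or_lt_of_le h2 with rfl | h2
  · rw [diamondY_of_mem h (by linarith), diamond_of_le_two (by linarith), if_neg (by simp),
      if_pos (by linarith)]
    field_simp; ring
  rcases lt_or_ge τ 3 with h3 | h3
  · rw [diamondY_of_mem h h3.le, diamond_of_two_le h2.le,
      if_pos (by nlinarith [mul_pos hL (sub_pos.2 h2)]),
      if_pos (by nlinarith [mul_pos hL (sub_pos.2 h3)])]
    field_simp; ring
  · rw [diamondY_of_three_le h3, diamond_of_two_le h2.le,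
      if_pos (by nlinarith [mul_pos hL (sub_pos.2 h4)]),
      if_neg (by nlinarith [mul_nonneg hL.le (sub_nonneg.2 h3)])]
    field_simp; ring

theorem abs_diamondX_le {τ : ℝ} (h0 : 0 ≤ τ) (h4 : τ ≤ 4) : |diamondX τ| ≤ 1 := by
  rw [abs_le]
  rcases le_total τ 2 with h | h
  · rw [diamond_of_le_two h]; constructor <;> linarith
  · rw [diamond_of_two_le h]; constructor <;> linarith

theorem abs_diamondY_le {τ : ℝ} (h0 : 0 ≤ τ) (h4 : τ ≤ 4) : |diamondY τ| ≤ 1 := by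
  rw [abs_le]
  rcases le_total τ 1 with h | h
  · rw [diamondY_of_le_one h]; constructor <;> linarith
  · rcases le_total τ 3 with h' | h'
    · rw [diamondY_of_mem h h']; constructor <;> linarith
    · rw [diamondY_of_three_le h']; constructor <;> linarith

theorem diamond_ne_zero (τ : ℝ) : diamondX τ ≠ 0 ∨ diamondY τ ≠ 0 := by
  by_contra! h
  rcases le_total τ 2 with h2 | h2
  · rw [diamond_of_le_two h2] at h
    rw [diamondY_of_le_one (by linarith)] at h
    linarith
  · rw [diamond_of_two_le h2] at h
    rw [diamondY_of_three_le (by linarith)] at h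
    linarith

@[fun_prop]
theorem continuous_diamondX : Continuous diamondX := by unfold diamondX; fun_prop

@[fun_prop]
theorem continuous_diamondY : Continuous diamondY := by unfold diamondY; fun_prop

/-! ### Directions around an axis -/

/-- The angle of the direction `w` around the axis `e`, starting from the direction `r`. -/
noncomputable def axisAngle (e r w : Space) : ℝ :=
  diamondAngle (((e ⨯₃ r) ⨯₃ e) ⬝ᵥ w) ((e ⨯₃ r) ⬝ᵥ w)

/-- The direction at angle `τ` around the axis `e`, starting from the direction `r`. -/
def axisDir (e r : Space) (τ : ℝ) : Space := diamondX τ • r + diamondY τ • (e ⨯₃ r)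

/-- Two vectors and their cross product span space. -/
theorem cross_decomposition (e r w : Space) :
    ((e ⨯₃ r) ⬝ᵥ (e ⨯₃ r)) • w = ((r ⨯₃ (e ⨯₃ r)) ⬝ᵥ w) • e + (((e ⨯₃ r) ⨯₃ e) ⬝ᵥ w) • r +
      ((e ⨯₃ r) ⬝ᵥ w) • (e ⨯₃ r) := by
  ext j
  fin_cases j <;>
  · simp only [vec3_dotProduct, cross_zero, cross_one, cross_two, Pi.add_apply, Pi.smul_apply,
      smul_eq_mul, Fin.isValue, Fin.zero_eta, Fin.mk_one, Fin.reduceFinMk]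
    ring

theorem axisX_ne_zero_or {e r w : Space} (hr : e ⨯₃ r ≠ 0) (hw : e ⨯₃ w ≠ 0) :
    ((e ⨯₃ r) ⨯₃ e) ⬝ᵥ w ≠ 0 ∨ (e ⨯₃ r) ⬝ᵥ w ≠ 0 := by
  by_contra! h
  have h1 := cross_decomposition e r w
  rw [h.1, h.2, zero_smul, zero_smul, add_zero, add_zero] at h1
  have h2 := congrArg (fun v => e ⨯₃ v) h1
  simp only [map_smul, cross_self, smul_zero] at h2
  exact (smul_ne_zero (dotProduct_self_pos hr).ne' hw) h2

/-- Up to a multiple of the axis, a vector is a positive multiple of the direction that belongs to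
its angle. -/
theorem exists_eq_axisDir {e r w : Space} (hr : e ⨯₃ r ≠ 0) (hw : e ⨯₃ w ≠ 0) :
    0 ≤ axisAngle e r w ∧ axisAngle e r w < 4 ∧
      ∃ α L : ℝ, 0 < L ∧ w = α • e + L • axisDir e r (axisAngle e r w) := by
  obtain ⟨h0, h4, hL, hX, hY⟩ := diamondAngle_spec (axisX_ne_zero_or hr hw)
  refine ⟨h0, h4, ?_⟩
  have hM := dotProduct_self_pos hr
  set M := (e ⨯₃ r) ⬝ᵥ (e ⨯₃ r)
  set L := |((e ⨯₃ r) ⨯₃ e) ⬝ᵥ w| + |(e ⨯₃ r) ⬝ᵥ w|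
  refine ⟨M⁻¹ * ((r ⨯₃ (e ⨯₃ r)) ⬝ᵥ w), M⁻¹ * L, mul_pos (inv_pos.2 hM) hL, ?_⟩
  have h1 : M • w = ((r ⨯₃ (e ⨯₃ r)) ⬝ᵥ w) • e + L • axisDir e r (axisAngle e r w) := by
    rw [cross_decomposition e r w]
    unfold axisDir axisAngle
    rw [smul_add, smul_smul, smul_smul, ← hX, ← hY, add_assoc]
  calc w = M⁻¹ • M • w := by rw [smul_smul, inv_mul_cancel₀ hM.ne', one_smul]
    _ = _ := by rw [h1, smul_add, smul_smul, smul_smul]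

theorem axisX_self (e r : Space) : ((e ⨯₃ r) ⨯₃ e) ⬝ᵥ r = (e ⨯₃ r) ⬝ᵥ (e ⨯₃ r) := by
  simp only [vec3_dotProduct, cross_zero, cross_one, cross_two]; ring

theorem axisX_smul_add (e r w : Space) (α t : ℝ) :
    ((e ⨯₃ r) ⨯₃ e) ⬝ᵥ (α • e + t • w) = t * (((e ⨯₃ r) ⨯₃ e) ⬝ᵥ w) := by
  simp only [vec3_dotProduct, cross_zero, cross_one, cross_two, Pi.add_apply, Pi.smul_apply,
    smul_eq_mul]; ring

theorem axisY_smul_add (e r w : Space) (α t : ℝ) :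
    (e ⨯₃ r) ⬝ᵥ (α • e + t • w) = t * ((e ⨯₃ r) ⬝ᵥ w) := by
  simp only [vec3_dotProduct, cross_zero, cross_one, cross_two, Pi.add_apply, Pi.smul_apply,
    smul_eq_mul]; ring

theorem axisX_axisDir (e r : Space) (τ : ℝ) :
    ((e ⨯₃ r) ⨯₃ e) ⬝ᵥ axisDir e r τ = ((e ⨯₃ r) ⬝ᵥ (e ⨯₃ r)) * diamondX τ := by
  simp only [axisDir, vec3_dotProduct, cross_zero, cross_one, cross_two, Pi.add_apply,
    Pi.smul_apply, smul_eq_mul]; ring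

theorem axisY_axisDir (e r : Space) (τ : ℝ) :
    (e ⨯₃ r) ⬝ᵥ axisDir e r τ = ((e ⨯₃ r) ⬝ᵥ (e ⨯₃ r)) * diamondY τ := by
  simp only [axisDir, vec3_dotProduct, cross_zero, cross_one, cross_two, Pi.add_apply,
    Pi.smul_apply, smul_eq_mul]; ring

theorem axisAngle_self {e r : Space} (hr : e ⨯₃ r ≠ 0) : axisAngle e r r = 0 := by
  rw [axisAngle, axisX_self, dotProduct_comm (e ⨯₃ r) r, dot_cross_self]
  exact diamondAngle_self (dotProduct_self_pos hr)

theorem axisAngle_eq_of_smul_add {e r w : Space} (hr : e ⨯₃ r ≠ 0) {α β t τ : ℝ}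
    (ht : 0 < t) (h0 : 0 ≤ τ) (h4 : τ < 4) {ε : ℝ} (hε : 0 < ε)
    (h : β • e + ε • axisDir e r τ = α • e + t • w) : axisAngle e r w = τ := by
  have hX := congrArg (fun v => ((e ⨯₃ r) ⨯₃ e) ⬝ᵥ v) h
  have hY := congrArg (fun v => (e ⨯₃ r) ⬝ᵥ v) h
  simp only [axisX_smul_add, axisY_smul_add, axisX_axisDir, axisY_axisDir] at hX hY
  have hM := dotProduct_self_pos hr
  set M := (e ⨯₃ r) ⬝ᵥ (e ⨯₃ r)
  have e1 : ((e ⨯₃ r) ⨯₃ e) ⬝ᵥ w = (ε * M / t) * diamondX τ := by field_simp; linarith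
  have e2 : (e ⨯₃ r) ⬝ᵥ w = (ε * M / t) * diamondY τ := by field_simp; linarith
  rw [axisAngle, e1, e2]
  exact diamondAngle_mul (by positivity) h0 h4

/-- Vectors with the same angle agree, up to scaling and multiples of the axis. -/
theorem exists_eq_of_axisAngle_eq {e r u v : Space} (hr : e ⨯₃ r ≠ 0) (hu : e ⨯₃ u ≠ 0)
    (hv : e ⨯₃ v ≠ 0) (h : axisAngle e r u = axisAngle e r v) :
    ∃ α t : ℝ, 0 < t ∧ u = α • e + t • v := by
  obtain ⟨-, -, α, L, hL, hu'⟩ := exists_eq_axisDir hr hu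
  obtain ⟨-, -, β, K, hK, hv'⟩ := exists_eq_axisDir hr hv
  refine ⟨α - L / K * β, L / K, div_pos hL hK, ?_⟩
  rw [h] at hu'
  have hv2 : axisDir e r (axisAngle e r v) = K⁻¹ • (v - β • e) := by
    nth_rw 2 [hv']
    rw [add_sub_cancel_left, smul_smul, inv_mul_cancel₀ hK.ne', one_smul]
  rw [hu', hv2]
  module

/-- Comparison of angles as a relation between three directions which is invariant under cyclic
permutations. -/
theorem axisAngle_lt_iff {e r u v : Space} (hr : e ⨯₃ r ≠ 0) (hu : e ⨯₃ u ≠ 0)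
    (hv : e ⨯₃ v ≠ 0) : (0 < axisAngle e r u ∧ axisAngle e r u < axisAngle e r v) ↔
      TwoPos (e ⬝ᵥ (r ⨯₃ u)) (e ⬝ᵥ (u ⨯₃ v)) (e ⬝ᵥ (v ⨯₃ r)) := by
  unfold axisAngle
  rw [diamondAngle_lt_iff (axisX_ne_zero_or hr hu) (axisX_ne_zero_or hr hv),
    ← twoPos_mul_iff (a := e ⬝ᵥ (r ⨯₃ u)) one_pos (dotProduct_self_pos hr) one_pos, one_mul,
    one_mul]
  have e1 : (e ⨯₃ r) ⬝ᵥ u = e ⬝ᵥ (r ⨯₃ u) := by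
    simp only [vec3_dotProduct, cross_zero, cross_one, cross_two]; ring
  have e2 : -((e ⨯₃ r) ⬝ᵥ v) = e ⬝ᵥ (v ⨯₃ r) := by
    simp only [vec3_dotProduct, cross_zero, cross_one, cross_two]; ring
  have e3 : ((e ⨯₃ r) ⨯₃ e) ⬝ᵥ u * (e ⨯₃ r) ⬝ᵥ v - ((e ⨯₃ r) ⨯₃ e) ⬝ᵥ v * (e ⨯₃ r) ⬝ᵥ u =
      (e ⨯₃ r) ⬝ᵥ (e ⨯₃ r) * e ⬝ᵥ (u ⨯₃ v) := by
    simp only [vec3_dotProduct, cross_zero, cross_one, cross_two]; ring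
  rw [e3, e1, e2]

theorem axisAngle_lt_rotate {e r u v : Space} (hr : e ⨯₃ r ≠ 0) (hu : e ⨯₃ u ≠ 0)
    (hv : e ⨯₃ v ≠ 0) (h0 : 0 < axisAngle e r u) (h : axisAngle e r u < axisAngle e r v) :
    0 < axisAngle e v r ∧ axisAngle e v r < axisAngle e v u := by
  rw [axisAngle_lt_iff hv hr hu]
  have := (axisAngle_lt_iff hr hu hv).1 ⟨h0, h⟩
  unfold TwoPos at *
  tauto

theorem axisAngle_congr {e r r' w w' : Space} (α β : ℝ) (hr : r' = r + α • e)
    (hw : w' = w + β • e) : axisAngle e r' w' = axisAngle e r w := by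
  have h1 : e ⨯₃ r' = e ⨯₃ r := by rw [hr, map_add, map_smul, cross_self, smul_zero, add_zero]
  have h2 : w' = β • e + (1 : ℝ) • w := by rw [hw]; module
  unfold axisAngle
  rw [h1, h2, axisX_smul_add, axisY_smul_add, one_mul, one_mul]

/-! ### Triangles around an edge -/

/-- The edge of the triangle `t` between the vertices `k` and `k + 1` joins `a` and `b`. -/
def HasEdge (a b : Space) (t : Fin 3 → Space) (k : Fin 3) : Prop :=
  (t k = a ∧ t (k + 1) = b) ∨ (t k = b ∧ t (k + 1) = a)

theorem exists_weights {t : Fin 3 → Space} {x : Space} (hx : x ∈ triangle t) (k : Fin 3) :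
    ∃ p q r : ℝ, 0 ≤ p ∧ 0 ≤ q ∧ 0 ≤ r ∧ p + q + r = 1 ∧
      x = p • t k + q • t (k + 1) + r • t (k + 2) := by
  obtain ⟨w, h0, h1, rfl⟩ := mem_triangle_iff.1 hx
  rw [Fin.sum_univ_three] at h1 ⊢
  refine ⟨w k, w (k + 1), w (k + 2), h0 _, h0 _, h0 _, ?_, ?_⟩
  · fin_cases k
    · exact h1
    · show w 1 + w 2 + w 0 = 1; linarith
    · show w 2 + w 0 + w 1 = 1; linarith
  · fin_cases k
    · rfl
    · show _ = w 1 • t 1 + w 2 • t 2 + w 0 • t 0; abel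
    · show _ = w 2 • t 2 + w 0 • t 0 + w 1 • t 1; abel

theorem mem_openTriangle_of_weights {t : Fin 3 → Space} (k : Fin 3) {p q r : ℝ} (hp : 0 < p)
    (hq : 0 < q) (hr : 0 < r) (h1 : p + q + r = 1) :
    p • t k + q • t (k + 1) + r • t (k + 2) ∈ openTriangle t := by
  fin_cases k
  · refine ⟨![p, q, r], fun m => by fin_cases m <;> simpa, by simpa [Fin.sum_univ_three], ?_⟩
    simp [Fin.sum_univ_three]
  · refine ⟨![r, p, q], fun m => by fin_cases m <;> simpa, ?_, ?_⟩
    · simp [Fin.sum_univ_three]; linarith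
    · simp [Fin.sum_univ_three]; abel
  · refine ⟨![q, r, p], fun m => by fin_cases m <;> simpa, ?_, ?_⟩
    · simp [Fin.sum_univ_three]; linarith
    · simp [Fin.sum_univ_three]; abel

theorem HasEdge.exists_of_mem {a b x w : Space} {t : Fin 3 → Space} {k : Fin 3}
    (h : HasEdge a b t k) {s : ℝ} (hx : x = a + s • (b - a)) (hw : x + w ∈ triangle t) :
    ∃ α u : ℝ, 0 ≤ u ∧ w = α • (b - a) + u • (t (k + 2) - a) := by
  obtain ⟨p, q, r, -, -, hr, h1, h2⟩ := exists_weights hw k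
  have hp : p = 1 - q - r := by linarith
  rcases h with ⟨ha, hb⟩ | ⟨hb, ha⟩
  · refine ⟨q - s, r, hr, ?_⟩
    rw [ha, hb, hx] at h2
    rw [eq_sub_of_add_eq' h2, hp]; module
  · refine ⟨p - s, r, hr, ?_⟩
    rw [ha, hb, hx] at h2
    rw [eq_sub_of_add_eq' h2, hp]; module

theorem HasEdge.eventually_mem {a b x : Space} {t : Fin 3 → Space} {k : Fin 3}
    (h : HasEdge a b t k) {s : ℝ} (hx : x = a + s • (b - a)) (hs0 : 0 < s) (hs1 : s < 1)
    (α : ℝ) {u : ℝ} (hu : 0 < u) :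
    ∀ᶠ ε : ℝ in 𝓝[>] 0, x + ε • (α • (b - a) + u • (t (k + 2) - a)) ∈ openTriangle t := by
  have hc : ∀ (p c : ℝ), 0 < p → ∀ᶠ ε : ℝ in 𝓝[>] 0, 0 < p + ε * c := by
    intro p c hp
    have : Continuous fun ε : ℝ => p + ε * c := by fun_prop
    have h' := this.tendsto 0
    rw [zero_mul, add_zero] at h'
    exact (h'.mono_left nhdsWithin_le_nhds).eventually (lt_mem_nhds hp)
  filter_upwards [hc s α hs0, hc (1 - s) (-α - u) (by linarith), self_mem_nhdsWithin]
    with ε h1 h2 h3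
  have hεu : 0 < ε * u := mul_pos h3 hu
  rcases h with ⟨ha, hb⟩ | ⟨hb, ha⟩
  · have := mem_openTriangle_of_weights (t := t) k h2 h1 hεu (by ring)
    rw [ha, hb] at this
    convert this using 1
    rw [hx]; module
  · have := mem_openTriangle_of_weights (t := t) k h1 h2 hεu (by ring)
    rw [ha, hb] at this
    convert this using 1
    rw [hx]; module

theorem HasEdge.cross_ne_zero {a b : Space} {t : Fin 3 → Space} {k : Fin 3}
    (h : HasEdge a b t k) (ht : normal t ≠ 0) : (b - a) ⨯₃ (t (k + 2) - a) ≠ 0 := by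
  rcases h with ⟨ha, hb⟩ | ⟨hb, ha⟩
  · rw [← ha, ← hb, normal_eq]; exact ht
  · have h1 := normal_eq t k
    rw [ha, hb] at h1
    have : (b - a) ⨯₃ (t (k + 2) - a) = -((a - b) ⨯₃ (t (k + 2) - b)) := by
      ext j
      fin_cases j <;>
      · simp only [cross_zero, cross_one, cross_two, Pi.sub_apply, Pi.neg_apply, Fin.isValue,
          Fin.zero_eta, Fin.mk_one, Fin.reduceFinMk]
        ring
    rw [this, h1]
    exact neg_ne_zero.2 ht

section Polytope

variable {P : Set Space} {n : ℕ} {T : Fin n → Fin 3 → Space}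

theorem eq_add_one_or {k m : Fin 3} (h : k ≠ m) : m = k + 1 ∨ k = m + 1 := by decide +revert

theorem ne_add_one (k : Fin 3) : k ≠ k + 1 := by decide +revert

theorem hasEdge_of_mem_range {a b : Space} {t : Fin 3 → Space} (hab : a ≠ b)
    (ha : a ∈ Set.range t) (hb : b ∈ Set.range t) : ∃ k, HasEdge a b t k := by
  obtain ⟨k, rfl⟩ := ha
  obtain ⟨m, rfl⟩ := hb
  have h : k ≠ m := fun h => hab (h ▸ rfl)
  rcases eq_add_one_or h with rfl | rfl
  · exact ⟨k, Or.inl ⟨rfl, rfl⟩⟩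
  · exact ⟨m, Or.inr ⟨rfl, rfl⟩⟩

theorem HasEdge.ne {a b : Space} {t : Fin 3 → Space} {k : Fin 3} (h : HasEdge a b t k)
    (ht : normal t ≠ 0) : a ≠ b := by
  rintro rfl
  have := h.cross_ne_zero ht
  simp at this

/-- Near a point in the relative interior of an edge, the only facial triangles are those with
this edge. -/
theorem IsTriangulatedPolytope.exists_ball_hasEdge (hP : IsTriangulatedPolytope P T)
    {a b x : Space} {j : Fin n} {k : Fin 3} (hj : HasEdge a b (T j) k) {s : ℝ}
    (hx : x = a + s • (b - a)) (hs0 : 0 < s) (hs1 : s < 1) :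
    ∃ r > 0, ∀ z ∈ Metric.ball x r, ∀ l, z ∈ triangle (T l) → ∃ m, HasEdge a b (T l) m := by
  obtain ⟨r, hr, h⟩ := exists_ball_inter_triangle T x
  refine ⟨r, hr, fun z hz l hl => ?_⟩
  have hxl := h z hz l hl
  have hN := hP.normal_ne_zero j
  have hseg : ∀ c d : Fin 3, c ≠ d → ∀ s : ℝ, 0 < s → s < 1 → x = T j c + s • (T j d - T j c) →
      T j c ∈ Set.range (T l) ∧ T j d ∈ Set.range (T l) := by
    intro c d hcd s h0 h1 hx
    have hbary : ∀ m, bary (T j) m x = (1 - s) * (if m = c then 1 else 0) +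
        s * (if m = d then 1 else 0) := by
      intro m
      rw [hx, bary_add_smul, bary_vertex hN, bary_vertex hN]
    have hxj : x ∈ triangle (T j) := by
      rw [hx]
      exact (convex_convexHull ℝ _).add_smul_sub_mem (vertex_mem_triangle _ _)
        (vertex_mem_triangle _ _) ⟨h0.le, h1.le⟩
    refine ⟨hP.vertex_mem hxj hxl ?_, hP.vertex_mem hxj hxl ?_⟩
    · rw [hbary, if_pos rfl, if_neg hcd]; linarith
    · rw [hbary, if_pos rfl, if_neg hcd.symm]; linarith
  have hk := ne_add_one k
  have hab : a ∈ Set.range (T l) ∧ b ∈ Set.range (T l) := by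
    rcases hj with ⟨rfl, rfl⟩ | ⟨rfl, rfl⟩
    · exact hseg k (k + 1) hk s hs0 hs1 hx
    · exact hseg (k + 1) k hk.symm s hs0 hs1 hx
  exact hasEdge_of_mem_range (hj.ne hN) hab.1 hab.2

theorem cross_axisDir_dot (e r : Space) (w : Space) (τ : ℝ) :
    ((e ⨯₃ r) ⬝ᵥ (e ⨯₃ r)) * ((e ⨯₃ w) ⬝ᵥ axisDir e r τ) =
      ((e ⨯₃ r) ⬝ᵥ (e ⨯₃ r)) * ((((e ⨯₃ r) ⨯₃ e) ⬝ᵥ w) * diamondY τ -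
        diamondX τ * ((e ⨯₃ r) ⬝ᵥ w)) := by
  simp only [axisDir, vec3_dotProduct, cross_zero, cross_one, cross_two, Pi.add_apply,
    Pi.smul_apply, smul_eq_mul]
  ring

/-- A sector of directions around an edge that contains no direction of a facial triangle is
locally inside or outside. -/
theorem IsTriangulatedPolytope.exists_sector (hP : IsTriangulatedPolytope P T) {a b x : Space}
    {j : Fin n} {k : Fin 3} (hj : HasEdge a b (T j) k) {s : ℝ} (hx : x = a + s • (b - a))
    (hs0 : 0 < s) (hs1 : s < 1) {e r : Space} {ρ : ℝ} (he : e = ρ • (b - a)) (hρ : ρ ≠ 0)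
    (hr : e ⨯₃ r ≠ 0) {τ₁ τ₂ : ℝ} (hτ₁ : 0 ≤ τ₁) (hτ₂ : τ₂ ≤ 4)
    (hfree : ∀ l m, HasEdge a b (T l) m →
      ¬ (τ₁ < axisAngle e r (T l (m + 2) - a) ∧ axisAngle e r (T l (m + 2) - a) < τ₂)) :
    ∃ δ > 0, ∀ β ε τ β' ε' τ' : ℝ, |β| < δ → 0 < ε → ε < δ → τ₁ < τ → τ < τ₂ →
      |β'| < δ → 0 < ε' → ε' < δ → τ₁ < τ' → τ' < τ₂ →
      x + β • e + ε • axisDir e r τ ∈ P → x + β' • e + ε' • axisDir e r τ' ∈ interior P := by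
  obtain ⟨R, hR, hball⟩ := hP.exists_ball_hasEdge hj hx hs0 hs1
  set B := ‖e‖ + ‖r‖ + ‖e ⨯₃ r‖ with hB
  have hBpos : 0 ≤ B := by positivity
  set δ := R / (B + 1) with hδ
  have hδpos : 0 < δ := by positivity
  set S : Set Space := (fun p : ℝ × ℝ × ℝ => x + p.1 • e + p.2.1 • axisDir e r p.2.2) ''
    (Set.Ioo (-δ) δ ×ˢ Set.Ioo 0 δ ×ˢ Set.Ioo τ₁ τ₂) with hS
  have hcont : Continuous fun p : ℝ × ℝ × ℝ => x + p.1 • e + p.2.1 • axisDir e r p.2.2 := by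
    unfold axisDir; fun_prop
  have hSc : IsPreconnected S :=
    (((convex_Ioo _ _).prod ((convex_Ioo _ _).prod (convex_Ioo _ _))).isPreconnected).image _
      hcont.continuousOn
  have hdisj : Disjoint S (frontier P) := by
    rw [Set.disjoint_left]
    rintro _ ⟨⟨β, ε, τ⟩, ⟨hβ, hε, hτ⟩, rfl⟩ hf
    simp only [Set.mem_Ioo] at hβ hε hτ hf
    rw [hP.frontier_eq] at hf
    obtain ⟨l, hl⟩ := Set.mem_iUnion.1 hf
    have hsmall : ‖β • e + ε • axisDir e r τ‖ < R := by
      have h1 : ‖axisDir e r τ‖ ≤ ‖r‖ + ‖e ⨯₃ r‖ := by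
        unfold axisDir
        refine (norm_add_le _ _).trans ?_
        rw [norm_smul, norm_smul, Real.norm_eq_abs, Real.norm_eq_abs]
        have h2 := abs_diamondX_le (by linarith : 0 ≤ τ) (by linarith)
        have h3 := abs_diamondY_le (by linarith : 0 ≤ τ) (by linarith)
        exact add_le_add (mul_le_of_le_one_left (norm_nonneg _) h2)
          (mul_le_of_le_one_left (norm_nonneg _) h3)
      have h2 : |β| ≤ δ := (abs_lt.2 hβ).le
      have h3 : |ε| ≤ δ := by rw [abs_of_pos hε.1]; exact hε.2.le
      calc ‖β • e + ε • axisDir e r τ‖ ≤ |β| * ‖e‖ + |ε| * ‖axisDir e r τ‖ := by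
            refine (norm_add_le _ _).trans ?_
            rw [norm_smul, norm_smul, Real.norm_eq_abs, Real.norm_eq_abs]
        _ ≤ δ * ‖e‖ + δ * (‖r‖ + ‖e ⨯₃ r‖) := by gcongr
        _ = δ * B := by rw [hB]; ring
        _ < δ * (B + 1) := by nlinarith
        _ = R := by rw [hδ]; field_simp
    have hmem : x + β • e + ε • axisDir e r τ ∈ Metric.ball x R := by
      rw [mem_ball_iff_norm, add_assoc, add_sub_cancel_left]; exact hsmall
    obtain ⟨m, hm⟩ := hball _ hmem l hl
    rw [add_assoc] at hl
    obtain ⟨α, u, hu, hw⟩ := hm.exists_of_mem hx hl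
    have hw' : β • e + ε • axisDir e r τ = (α / ρ) • e + u • (T l (m + 2) - a) := by
      rw [hw, he, smul_smul, div_mul_cancel₀ _ hρ]
    have hτ0 : 0 ≤ τ := by linarith
    have hτ4 : τ < 4 := by linarith
    have hu' : 0 < u := by
      refine lt_of_le_of_ne hu fun h0 => ?_
      have hX := congrArg (fun v => ((e ⨯₃ r) ⨯₃ e) ⬝ᵥ v) hw'
      have hY := congrArg (fun v => (e ⨯₃ r) ⬝ᵥ v) hw'
      simp only [axisX_smul_add, axisY_smul_add, axisX_axisDir, axisY_axisDir, ← h0,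
        zero_mul, mul_eq_zero, hε.1.ne', (dotProduct_self_pos hr).ne', false_or] at hX hY
      rcases diamond_ne_zero τ with h | h
      · exact h hX
      · exact h hY
    have hang := axisAngle_eq_of_smul_add hr hu' hτ0 hτ4 hε.1 hw'
    exact hfree l m hm (by rw [hang]; exact hτ)
  refine ⟨δ, hδpos, ?_⟩
  intro β ε τ β' ε' τ' hβ hε hε2 hτ hτ2 hβ' hε' hε2' hτ' hτ2' hin
  have h1 : x + β • e + ε • axisDir e r τ ∈ S :=
    ⟨(β, ε, τ), ⟨abs_lt.1 hβ, ⟨hε, hε2⟩, hτ, hτ2⟩, rfl⟩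
  have h2 : x + β' • e + ε' • axisDir e r τ' ∈ S :=
    ⟨(β', ε', τ'), ⟨abs_lt.1 hβ', ⟨hε', hε2'⟩, hτ', hτ2'⟩, rfl⟩
  have h3 : x + β • e + ε • axisDir e r τ ∈ interior P := by
    by_contra hc
    exact Set.disjoint_left.1 hdisj h1 ⟨subset_closure hin, hc⟩
  exact subset_interior_of_isPreconnected hSc hdisj h1 h3 h2

/-- A sector that starts at a facial triangle and contains no direction of a facial triangle is
inside or outside according to the side of that triangle on which it lies. -/
theorem IsTriangulatedPolytope.exists_sector_side (hP : IsTriangulatedPolytope P T)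
    {a b x : Space} {j : Fin n} {k : Fin 3} (hj : HasEdge a b (T j) k) {s : ℝ}
    (hx : x = a + s • (b - a)) (hs0 : 0 < s) (hs1 : s < 1) {e r : Space} {ρ : ℝ}
    (he : e = ρ • (b - a)) (hρ : ρ ≠ 0) (hr : e ⨯₃ r ≠ 0) {τ₁ τ₂ : ℝ} (hτ : τ₁ < τ₂)
    (hτ₂ : τ₂ ≤ 4) (hang : axisAngle e r (T j (k + 2) - a) = τ₁)
    (hfree : ∀ l m, HasEdge a b (T l) m →
      ¬ (τ₁ < axisAngle e r (T l (m + 2) - a) ∧ axisAngle e r (T l (m + 2) - a) < τ₂))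
    {ν : Space} (hν : IsInward P (T j) ν) {c : ℝ} (hνc : ν = c • (e ⨯₃ (T j (k + 2) - a))) :
    ∃ δ > 0, ∀ β ε τ : ℝ, |β| < δ → 0 < ε → ε < δ → τ₁ < τ → τ < τ₂ →
      (0 < c → x + β • e + ε • axisDir e r τ ∈ interior P) ∧
      (c < 0 → x + β • e + ε • axisDir e r τ ∉ P) := by
  set w := T j (k + 2) - a with hw
  have hew : e ⨯₃ w ≠ 0 := by
    rw [he, LinearMap.map_smul₂]
    exact smul_ne_zero hρ (hj.cross_ne_zero (hP.normal_ne_zero j))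
  obtain ⟨h0, h4, α, L, hL, hwL⟩ := exists_eq_axisDir hr hew
  rw [hang] at h0 h4 hwL
  obtain ⟨δ, hδ, hsec⟩ := hP.exists_sector hj hx hs0 hs1 he hρ hr h0 hτ₂ hfree
  have hdir : axisDir e r τ₁ = (-(α / L) * ρ) • (b - a) + L⁻¹ • w := by
    rw [hwL, he, smul_add, smul_smul, smul_smul, smul_smul, inv_mul_cancel₀ hL.ne', one_smul,
      ← add_assoc, ← add_smul]
    rw [show -(α / L) * ρ + L⁻¹ * α * ρ = 0 by field_simp; ring, zero_smul, zero_add]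
  -- a point of the triangle close to `x`, and close to it a point of the sector
  obtain ⟨ε₀, hε₀, hε₀δ⟩ := ((hj.eventually_mem hx hs0 hs1 (-(α / L) * ρ) (inv_pos.2 hL)).and
    (Ioo_mem_nhdsGT hδ)).exists
  rw [← hw, ← hdir] at hε₀
  obtain ⟨R, hR, hside⟩ := hν _ hε₀
  have hcont : Continuous fun τ : ℝ => x + ε₀ • axisDir e r τ := by unfold axisDir; fun_prop
  have hnear : ∀ᶠ τ in 𝓝[>] τ₁, x + ε₀ • axisDir e r τ ∈ Metric.ball (x + ε₀ • axisDir e r τ₁) R :=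
    ((hcont.tendsto τ₁).mono_left nhdsWithin_le_nhds).eventually (Metric.ball_mem_nhds _ hR)
  obtain ⟨τ, hball, hτm⟩ := (hnear.and (Ioo_mem_nhdsGT
    (lt_min hτ (by linarith : τ₁ < τ₁ + 2)))).exists
  have hτlt := lt_of_lt_of_le hτm.2 (min_le_left _ _)
  have hτlt2 := lt_of_lt_of_le hτm.2 (min_le_right _ _)
  have hM := dotProduct_self_pos hr
  have hpos : 0 < (e ⨯₃ w) ⬝ᵥ (axisDir e r τ - axisDir e r τ₁) := by
    have h1 := cross_axisDir_dot e r w τ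
    have h2 := cross_axisDir_dot e r w τ₁
    have hX := congrArg (fun v => ((e ⨯₃ r) ⨯₃ e) ⬝ᵥ v) hwL
    have hY := congrArg (fun v => (e ⨯₃ r) ⬝ᵥ v) hwL
    simp only [axisX_smul_add, axisY_smul_add, axisX_axisDir, axisY_axisDir] at hX hY
    have h1' := mul_left_cancel₀ hM.ne' h1
    have h2' := mul_left_cancel₀ hM.ne' h2
    rw [hX, hY] at h1' h2'
    have hdet := diamondDet_pos h0 hτm.1 hτlt2 (by linarith)
    have := mul_pos (mul_pos hL hM) hdet
    rw [dotProduct_sub, h1', h2']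
    unfold diamondDet at this
    linarith
  have hνs : ν ⬝ᵥ (x + ε₀ • axisDir e r τ - (x + ε₀ • axisDir e r τ₁)) =
      c * (ε₀ * ((e ⨯₃ w) ⬝ᵥ (axisDir e r τ - axisDir e r τ₁))) := by
    rw [hνc, add_sub_add_left_eq_sub, ← smul_sub, smul_dotProduct, dotProduct_smul, smul_eq_mul,
      smul_eq_mul]
  have hε₀pos := mul_pos hε₀δ.1 hpos
  have hzero : |(0 : ℝ)| < δ := by rwa [abs_zero]
  have hz : x + (0 : ℝ) • e + ε₀ • axisDir e r τ = x + ε₀ • axisDir e r τ := by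
    rw [zero_smul, add_zero]
  refine ⟨δ, hδ, fun β ε τ' hβ hε hε2 hτ' hτ2' => ⟨fun hc => ?_, fun hc hin => ?_⟩⟩
  · refine hsec 0 ε₀ τ β ε τ' hzero hε₀δ.1 hε₀δ.2 hτm.1 hτlt hβ hε hε2 hτ' hτ2' ?_
    rw [hz]
    refine interior_subset ((hside _ hball).1 ?_)
    rw [hνs]
    exact mul_pos hc hε₀pos
  · have := hsec β ε τ' 0 ε₀ τ hβ hε hε2 hτ' hτ2' hzero hε₀δ.1 hε₀δ.2 hτm.1 hτlt hin
    rw [hz] at this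
    refine (hside _ hball).2 ?_ (interior_subset this)
    rw [hνs]
    exact mul_neg_of_neg_of_pos hc hε₀pos

/-! ### The inner wedge that starts at a facial triangle -/

/-- The edge from vertex `k` to vertex `k + 1` of the triangle `T j`, directed such that the
rotation around it turns the triangle `T j` inwards. -/
noncomputable def edgeAxis (T : Fin n → Fin 3 → Space) (j : Fin n) (k : Fin 3) : Space :=
  orientation T j • (T j (k + 1) - T j k)

/-- The angle by which the facial triangle `T j` has to be rotated inwards around its `k`-th edge
to have the direction `w`. -/
noncomputable def edgeAngle (T : Fin n → Fin 3 → Space) (j : Fin n) (k : Fin 3) (w : Space) : ℝ :=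
  axisAngle (edgeAxis T j k) (T j (k + 2) - T j k) w

/-- `θ` is the angle between the facial triangle `T j` and the next one in inward direction around
its `k`-th edge, or a full turn if there is no other one. -/
def IsNextAngle (T : Fin n → Fin 3 → Space) (j : Fin n) (k : Fin 3) (θ : ℝ) : Prop :=
  θ ≤ 4 ∧
  (∀ l m, HasEdge (T j k) (T j (k + 1)) (T l) m →
    0 < edgeAngle T j k (T l (m + 2) - T j k) → θ ≤ edgeAngle T j k (T l (m + 2) - T j k)) ∧
  (θ = 4 ∨ ∃ l m, HasEdge (T j k) (T j (k + 1)) (T l) m ∧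
    0 < edgeAngle T j k (T l (m + 2) - T j k) ∧ edgeAngle T j k (T l (m + 2) - T j k) = θ)

theorem orientation_ne_zero (T : Fin n → Fin 3 → Space) (i : Fin n) : orientation T i ≠ 0 := by
  rcases orientation_eq T i with h | h <;> rw [h] <;> norm_num

theorem edgeAxis_cross (T : Fin n → Fin 3 → Space) (j : Fin n) (k : Fin 3) :
    edgeAxis T j k ⨯₃ (T j (k + 2) - T j k) = orientation T j • normal (T j) := by
  rw [edgeAxis, LinearMap.map_smul₂, normal_eq]

/-- Directions in the inner wedge at an edge point into the interior. -/
theorem IsTriangulatedPolytope.eventually_mem_of_lt_next (hP : IsTriangulatedPolytope P T)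
    {j : Fin n} {k : Fin 3} {θ : ℝ} (hθ : IsNextAngle T j k θ) {s : ℝ} (hs0 : 0 < s) (hs1 : s < 1)
    {d : Space} (hd : (T j (k + 1) - T j k) ⨯₃ d ≠ 0) (hd0 : 0 < edgeAngle T j k d)
    (hdθ : edgeAngle T j k d < θ) :
    ∀ᶠ ε : ℝ in 𝓝[>] 0, T j k + s • (T j (k + 1) - T j k) + ε • d ∈ interior P := by
  have hedge : HasEdge (T j k) (T j (k + 1)) (T j) k := Or.inl ⟨rfl, rfl⟩
  have hσ := orientation_ne_zero T j
  have hr : edgeAxis T j k ⨯₃ (T j (k + 2) - T j k) ≠ 0 := by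
    rw [edgeAxis_cross]; exact smul_ne_zero hσ (hP.normal_ne_zero j)
  have hed : edgeAxis T j k ⨯₃ d ≠ 0 := by
    rw [edgeAxis, LinearMap.map_smul₂]; exact smul_ne_zero hσ hd
  obtain ⟨-, -, α, L, hL, hdL⟩ := exists_eq_axisDir hr hed
  obtain ⟨δ, hδ, hsec⟩ := hP.exists_sector_side hedge rfl hs0 hs1 (e := edgeAxis T j k) rfl hσ hr
    (hd0.trans hdθ) hθ.1 (axisAngle_self hr)
    (fun l m hm h => absurd (hθ.2.1 l m hm h.1) (not_le.2 h.2)) (hP.isInward_orientation j)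
    (c := 1) (by rw [edgeAxis_cross, one_smul])
  have h1 : ∀ᶠ ε : ℝ in 𝓝[>] 0, |ε * α| < δ := by
    have : Continuous fun ε : ℝ => |ε * α| := by fun_prop
    have h := this.tendsto 0
    simp only [zero_mul, abs_zero] at h
    exact (h.mono_left nhdsWithin_le_nhds).eventually (gt_mem_nhds hδ)
  have h2 : ∀ᶠ ε : ℝ in 𝓝[>] 0, ε * L < δ := by
    have : Continuous fun ε : ℝ => ε * L := by fun_prop
    have h := this.tendsto 0
    simp only [zero_mul] at h
    exact (h.mono_left nhdsWithin_le_nhds).eventually (gt_mem_nhds hδ)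
  filter_upwards [h1, h2, self_mem_nhdsWithin] with ε h1 h2 h3
  have := (hsec (ε * α) (ε * L) _ h1 (mul_pos h3 hL) h2 hd0 hdθ).1 one_pos
  convert this using 1
  nth_rw 1 [hdL]
  unfold edgeAngle
  module

theorem HasEdge.eventually_notMem (hP : IsTriangulatedPolytope P T) {a b x d : Space} {l : Fin n}
    {m : Fin 3} (h : HasEdge a b (T l) m) {s : ℝ} (hx : x = a + s • (b - a)) (hs0 : 0 < s)
    (hs1 : s < 1) {α u : ℝ} (hu : 0 < u) (hd : d = α • (b - a) + u • (T l (m + 2) - a)) :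
    ¬ ∀ᶠ ε : ℝ in 𝓝[>] 0, x + ε • d ∈ interior P := by
  intro hin
  obtain ⟨ε, h1, h2⟩ := (hin.and (h.eventually_mem hx hs0 hs1 α hu)).exists
  rw [← hd] at h2
  exact hP.notMem_interior (openTriangle_subset _ h2) h1

/-- A direction at an edge that points into the interior lies in the inner wedge of one of the
facial triangles with this edge: of the last one that is passed before a rotation arrives at the
direction. -/
theorem IsTriangulatedPolytope.exists_lt_next (hP : IsTriangulatedPolytope P T) {a b x d : Space}
    {j : Fin n} {k : Fin 3} (hj : HasEdge a b (T j) k) {s : ℝ} (hx : x = a + s • (b - a))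
    (hs0 : 0 < s) (hs1 : s < 1) (hd : (b - a) ⨯₃ d ≠ 0)
    (hin : ∀ᶠ ε : ℝ in 𝓝[>] 0, x + ε • d ∈ interior P) :
    ∃ l m, HasEdge a b (T l) m ∧ 0 < edgeAngle T l m d ∧
      ∀ θ, IsNextAngle T l m θ → edgeAngle T l m d < θ := by
  set e := b - a with he
  obtain ⟨⟨l, m⟩, hlm, hmax⟩ := Set.exists_max_image
    {p : Fin n × Fin 3 | HasEdge a b (T p.1) p.2} (fun p => axisAngle e d (T p.1 (p.2 + 2) - a))
    (Set.toFinite _) ⟨(j, k), hj⟩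
  have hlm : HasEdge a b (T l) m := hlm
  replace hmax : ∀ l' m', HasEdge a b (T l') m' →
      axisAngle e d (T l' (m' + 2) - a) ≤ axisAngle e d (T l (m + 2) - a) :=
    fun l' m' h => hmax (l', m') h
  set w := T l (m + 2) - a with hw
  have hcross : ∀ l' m', HasEdge a b (T l') m' → e ⨯₃ (T l' (m' + 2) - a) ≠ 0 :=
    fun l' m' h => h.cross_ne_zero (hP.normal_ne_zero l')
  have hew : e ⨯₃ w ≠ 0 := hcross l m hlm
  -- no direction of a facial triangle equals the given direction
  have hdiff : ∀ l' m', HasEdge a b (T l') m' → ∀ α u : ℝ, 0 < u →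
      d ≠ α • e + u • (T l' (m' + 2) - a) :=
    fun l' m' h α u hu hd => h.eventually_notMem hP hx hs0 hs1 hu hd hin
  obtain ⟨c, hc1, hcν⟩ : ∃ c : ℝ, orientation T l • normal (T l) = c • (e ⨯₃ w) ∧
      (0 < c → edgeAxis T l m = e ∧ ∃ α : ℝ, T l (m + 2) - T l m = w + α • e) ∧ c ≠ 0 := by
    rcases hlm with ⟨h1, h2⟩ | ⟨h1, h2⟩
    · refine ⟨orientation T l, ?_, fun hc => ?_, orientation_ne_zero T l⟩
      · rw [← normal_eq _ m, h1, h2]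
      · rcases orientation_eq T l with h | h
        · refine ⟨by rw [edgeAxis, h, h1, h2, one_smul], 0, by rw [h1, zero_smul, add_zero]⟩
        · rw [h] at hc; norm_num at hc
    · refine ⟨-orientation T l, ?_, fun hc => ?_, neg_ne_zero.2 (orientation_ne_zero T l)⟩
      · rw [← normal_eq _ m, h1, h2, hw, he]
        ext q
        fin_cases q <;>
        · simp only [cross_zero, cross_one, cross_two, Pi.sub_apply, Pi.smul_apply, smul_eq_mul,
            Fin.isValue, Fin.zero_eta, Fin.mk_one, Fin.reduceFinMk]
          ring
      · rcases orientation_eq T l with h | h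
        · rw [h] at hc; norm_num at hc
        · refine ⟨by rw [edgeAxis, h, h1, h2, he]; module, -1, by rw [h1, hw, he]; module⟩
  obtain ⟨hw0, hw4, -⟩ := exists_eq_axisDir hd hew
  -- the sector from the last triangle to the direction `d` contains interior points
  obtain ⟨δ, hδ, hsec⟩ := hP.exists_sector_side hlm hx hs0 hs1 (e := e) (ρ := 1)
    (by rw [one_smul]) one_ne_zero hd hw4 le_rfl rfl
    (fun l' m' h h' => absurd h'.1 (not_lt.2 (hmax l' m' h))) (hP.isInward_orientation l) hc1
  have hcpos : 0 < c := by
    by_contra hcon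
    have hcneg : c < 0 := lt_of_le_of_ne (not_lt.1 hcon) hcν.2
    obtain ⟨ε, hε, hεδ⟩ := (hin.and (Ioo_mem_nhdsGT hδ)).exists
    have hcont : Continuous fun τ : ℝ => x + ε • axisDir e d τ := by unfold axisDir; fun_prop
    have h4 : axisDir e d 4 = d := by
      rw [axisDir, diamond_of_two_le (by norm_num), diamondY_of_three_le (by norm_num)]
      module
    have hnear : ∀ᶠ τ in 𝓝[<] (4 : ℝ), x + ε • axisDir e d τ ∈ interior P := by
      refine ((hcont.tendsto 4).mono_left nhdsWithin_le_nhds).eventually ?_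
      rw [h4]
      exact isOpen_interior.mem_nhds hε
    obtain ⟨τ, h1, h2⟩ := (hnear.and (Ioo_mem_nhdsLT hw4)).exists
    have := (hsec 0 ε τ (by rwa [abs_zero]) hεδ.1 hεδ.2 h2.1 h2.2).2 hcneg
    rw [zero_smul, add_zero] at this
    exact this (interior_subset h1)
  obtain ⟨haxis, α₀, hr⟩ := hcν.1 hcpos
  have hangle : ∀ v : Space, edgeAngle T l m v = axisAngle e w v := by
    intro v
    rw [edgeAngle, haxis]
    exact axisAngle_congr α₀ 0 hr (by rw [zero_smul, add_zero])
  have hdpos : 0 < axisAngle e w d := by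
    obtain ⟨h0, -, -⟩ := exists_eq_axisDir hew hd
    refine lt_of_le_of_ne h0 fun h => ?_
    obtain ⟨α, u, hu, hdu⟩ := exists_eq_of_axisAngle_eq hew hd hew (by rw [← h, axisAngle_self hew])
    exact hdiff l m hlm α u hu hdu
  refine ⟨l, m, hlm, by rw [hangle]; exact hdpos, fun θ hθ => ?_⟩
  rw [hangle]
  rcases hθ.2.2 with rfl | ⟨l', m', hm', hpos, hθ'⟩
  · exact (exists_eq_axisDir hew hd).2.1
  have hm2 : HasEdge a b (T l') m' := by
    rcases hlm with ⟨h1, h2⟩ | ⟨h1, h2⟩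
    · rwa [h1, h2] at hm'
    · rw [h1, h2] at hm'
      exact hm'.symm
  have hang2 : edgeAngle T l m (T l' (m' + 2) - T l m) = axisAngle e w (T l' (m' + 2) - a) := by
    rw [hangle]
    refine axisAngle_congr 0 α₀ (by rw [zero_smul, add_zero]) ?_
    rw [hw] at hr
    rw [sub_add_eq_add_sub, eq_sub_iff_add_eq] at hr ⊢
    have : T l m = a - α₀ • e := by
      have h3 : T l (m + 2) - T l m + a = T l (m + 2) + α₀ • e := hr
      have h5 : T l m = T l (m + 2) + a - (T l (m + 2) - T l m + a) := by module
      rw [h5, h3]; module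
    rw [this]; module
  rw [hang2] at hpos hθ'
  rw [← hθ']
  by_contra hcon
  rcases (not_lt.1 hcon).eq_or_lt with heq | hlt
  · obtain ⟨α, u, hu, hdu⟩ := exists_eq_of_axisAngle_eq hew hd (hcross l' m' hm2) heq.symm
    exact hdiff l' m' hm2 α u hu hdu
  · have := axisAngle_lt_rotate hew (hcross l' m' hm2) hd hpos hlt
    exact absurd this.2 (not_lt.2 (hmax l' m' hm2))

end Polytope

section Polytope

variable {P : Set Space} {n : ℕ} {T : Fin n → Fin 3 → Space}

/-! ### Points that span the section of the polytope by the plane of a facial triangle -/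

/-- The height of the vertex `k` of the triangle `T j` above the plane of the triangle `T i`, up to
a positive factor. -/
def height (T : Fin n → Fin 3 → Space) (i j : Fin n) (k : Fin 3) : ℝ :=
  normal (T i) ⬝ᵥ (T j k - T i 0)

/-- The direction `d` points from the `k`-th edge of the triangle `T j` into the inner wedge, if
the table `θ` contains the angles of the inner wedges. -/
def InWedge (T : Fin n → Fin 3 → Space) (θ : Fin n → Fin 3 → ℝ) (j : Fin n) (k : Fin 3)
    (d : Space) : Prop :=
  0 < edgeAngle T j k d ∧ edgeAngle T j k d < θ j k

/-- The vector that the `k`-th edge of the triangle `T j` contributes if it crosses the plane of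
`T i` from below: a positive multiple of the vector from the point `A` to the crossing point. -/
def crossingVector (T : Fin n → Fin 3 → Space) (i : Fin n) (A : Space) (j : Fin n)
    (k l : Fin 3) : Space :=
  height T i j l • (T j k - A) - height T i j k • (T j l - A)

/-- The convex hull of the section of the polytope by the plane of `T i` is spanned by the
points `A + z`, up to positive factors of `z`: crossing points of edges, vertices in the plane
whose opposite edge crosses it, and ends of edges in the plane next to which the section has
interior points. The predicate lists the vectors `z` that the edge `k` of `T j` contributes. -/
def IsCut (T : Fin n → Fin 3 → Space) (θ : Fin n → Fin 3 → ℝ) (i : Fin n) (A : Space) (j : Fin n)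
    (k : Fin 3) (z : Space) : Prop :=
  ((height T i j k < 0 ∧ 0 < height T i j (k + 1)) ∧ z = crossingVector T i A j k (k + 1)) ∨
  ((height T i j (k + 1) < 0 ∧ 0 < height T i j k) ∧ z = crossingVector T i A j (k + 1) k) ∨
  (((height T i j k < 0 ∧ 0 < height T i j (k + 1)) ∨
      (height T i j (k + 1) < 0 ∧ 0 < height T i j k)) ∧ height T i j (k + 2) = 0 ∧
    z = T j (k + 2) - A) ∨
  ((height T i j k = 0 ∧ height T i j (k + 1) = 0 ∧
      (InWedge T θ j k (normal (T i) ⨯₃ (T j (k + 1) - T j k)) ∨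
        InWedge T θ j k (-(normal (T i) ⨯₃ (T j (k + 1) - T j k))))) ∧
    (z = T j k - A ∨ z = T j (k + 1) - A))

theorem add_two_add_one (k : Fin 3) : k + 2 + 1 = k := by decide +revert

theorem add_one_add_two (k : Fin 3) : k + 1 + 2 = k := by decide +revert

/-- In a plane with normal vector `N`, there is a line through `x` that misses a given finite set
of other points. -/
theorem exists_direction {N p q x : Space} (hN : p ⨯₃ q = N) (hN0 : N ≠ 0) (S : Set Space)
    (hS : S.Finite) (hx : x ∉ S) :
    ∃ d : Space, d ≠ 0 ∧ N ⬝ᵥ d = 0 ∧ ∀ t : ℝ, x + t • d ∉ S := by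
  have hM := dotProduct_self_pos hN0
  have hbad : {s : ℝ | ∃ v ∈ S, ∃ t : ℝ, x + t • (p + s • q) = v}.Finite := by
    refine (hS.image fun v => (N ⨯₃ p) ⬝ᵥ (v - x) / (q ⨯₃ N) ⬝ᵥ (v - x)).subset ?_
    rintro s ⟨v, hv, t, ht⟩
    refine ⟨v, hv, ?_⟩
    have h1 : v - x = t • (p + s • q) := by rw [← ht, add_sub_cancel_left]
    have h2 : (N ⨯₃ p) ⬝ᵥ (v - x) = t * s * (N ⬝ᵥ N) := by
      rw [h1, ← hN]
      simp only [vec3_dotProduct, cross_zero, cross_one, cross_two, Pi.add_apply, Pi.smul_apply,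
        smul_eq_mul]
      ring
    have h3 : (q ⨯₃ N) ⬝ᵥ (v - x) = t * (N ⬝ᵥ N) := by
      rw [h1, ← hN]
      simp only [vec3_dotProduct, cross_zero, cross_one, cross_two, Pi.add_apply, Pi.smul_apply,
        smul_eq_mul]
      ring
    have ht0 : t ≠ 0 := by
      rintro rfl
      rw [zero_smul, add_zero] at ht
      exact hx (ht ▸ hv)
    dsimp only
    rw [h2, h3]
    field_simp
  obtain ⟨s, hs⟩ := hbad.infinite_compl.nonempty
  refine ⟨p + s • q, ?_, ?_, fun t ht => hs ⟨_, ht, t, rfl⟩⟩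
  · intro h0
    have h1 : (q ⨯₃ N) ⬝ᵥ (p + s • q) = N ⬝ᵥ N := by
      rw [← hN]
      simp only [vec3_dotProduct, cross_zero, cross_one, cross_two, Pi.add_apply, Pi.smul_apply,
        smul_eq_mul]
      ring
    rw [h0, dotProduct_zero] at h1
    exact hM.ne h1
  · rw [← hN]
    simp only [vec3_dotProduct, cross_zero, cross_one, cross_two, Pi.add_apply, Pi.smul_apply,
      smul_eq_mul]
    ring

/-- A ray from an interior point has a first boundary point. -/
theorem IsTriangulatedPolytope.exists_exit (hP : IsTriangulatedPolytope P T) {x d : Space}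
    (hd : d ≠ 0) (hx : x ∈ interior P) :
    ∃ b : ℝ, 0 < b ∧ x + b • d ∈ frontier P ∧ ∀ t : ℝ, 0 ≤ t → t < b → x + t • d ∈ interior P := by
  have hx0 : x + (0 : ℝ) • d ∈ interior P := by rwa [zero_smul, add_zero]
  obtain ⟨b₀, hb₀, hb₀f⟩ := hP.exists_frontier_hit hd hx0
  set S : Set ℝ := {t | 0 ≤ t ∧ x + t • d ∈ frontier P}
  have hcont : Continuous fun t : ℝ => x + t • d := by fun_prop
  have hS : IsClosed S := isClosed_Ici.inter (isClosed_frontier.preimage hcont)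
  have hbdd : BddBelow S := ⟨0, fun t ht => ht.1⟩
  have hmem := hS.csInf_mem ⟨b₀, hb₀.le, hb₀f⟩ hbdd
  have hpos : 0 < sInf S := by
    refine lt_of_le_of_ne hmem.1 fun h => ?_
    have := hmem.2
    rw [← h] at this
    exact this.2 hx0
  refine ⟨sInf S, hpos, hmem.2, fun t ht htb => ?_⟩
  refine (mem_interior_of_segment ht fun u hu hf => ?_).1 hx0
  have := csInf_le hbdd (show u ∈ S from ⟨hu.1, hf⟩)
  linarith [hu.2]

theorem edgeAngle_smul_add (T : Fin n → Fin 3 → Space) (j : Fin n) (k : Fin 3) (α : ℝ) {u : ℝ}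
    (hu : 0 < u) (w : Space) (hr : edgeAxis T j k ⨯₃ (T j (k + 2) - T j k) ≠ 0)
    (hw : edgeAxis T j k ⨯₃ w ≠ 0) :
    edgeAngle T j k (α • (T j (k + 1) - T j k) + u • w) = edgeAngle T j k w := by
  have h : ∃ β : ℝ, α • (T j (k + 1) - T j k) = β • edgeAxis T j k := by
    refine ⟨α / orientation T j, ?_⟩
    rw [edgeAxis, smul_smul, div_mul_cancel₀ _ (orientation_ne_zero T j)]
  obtain ⟨β, hβ⟩ := h
  obtain ⟨h0, h4, γ, L, hL, hwL⟩ := exists_eq_axisDir hr hw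
  rw [hβ]
  refine (axisAngle_eq_of_smul_add (α := -β / u) (β := γ) (t := u⁻¹) (ε := L) hr
    (inv_pos.2 hu) h0 h4 hL ?_)
  rw [edgeAngle, ← hwL, smul_add, smul_smul, smul_smul, ← add_assoc, ← add_smul, inv_mul_cancel₀ hu.ne',
    one_smul, show -β / u + u⁻¹ * β = 0 by field_simp; ring, zero_smul, zero_add]

theorem IsTriangulatedPolytope.edgeAxis_cross_ne_zero (hP : IsTriangulatedPolytope P T)
    (j : Fin n) (k : Fin 3) : edgeAxis T j k ⨯₃ (T j (k + 2) - T j k) ≠ 0 := by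
  rw [edgeAxis_cross]; exact smul_ne_zero (orientation_ne_zero T j) (hP.normal_ne_zero j)

/-- If two points on different sides of a plane and a third point satisfy the inequalities for
the crossing points, then every point of the plane in the triangle of the three points satisfies
the inequality. -/
theorem sum_nonpos_of_crossing {ha hb hc fa fb fc p q r : ℝ} (hp : 0 ≤ p) (hq : 0 ≤ q)
    (hr : 0 ≤ r) (hsum : p * ha + q * hb + r * hc = 0) (hneg : ha < 0) (hpos : 0 < hb)
    (hab : hb * fa - ha * fb ≤ 0) (hcb : hc < 0 → hb * fc - hc * fb ≤ 0)
    (hac : 0 < hc → hc * fa - ha * fc ≤ 0) (h0 : hc = 0 → fc ≤ 0) :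
    p * fa + q * fb + r * fc ≤ 0 := by
  rcases lt_trichotomy hc 0 with h | h | h
  · have h1 := hcb h
    have : hb * (p * fa + q * fb + r * fc) ≤ 0 := by
      have e : hb * (p * fa + q * fb + r * fc) = p * (hb * fa - ha * fb) +
          r * (hb * fc - hc * fb) + (p * ha + q * hb + r * hc) * fb := by ring
      rw [e, hsum]
      nlinarith [mul_nonneg hp (sub_nonneg.2 hab), mul_nonneg hr (sub_nonneg.2 h1)]
    exact nonpos_of_mul_nonpos_right this hpos
  · have h1 := h0 h
    subst h
    have : hb * (p * fa + q * fb + r * fc) ≤ 0 := by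
      have e : hb * (p * fa + q * fb + r * fc) = p * (hb * fa - ha * fb) +
          hb * (r * fc) + (p * ha + q * hb + r * 0) * fb := by ring
      rw [e, hsum]
      nlinarith [mul_nonneg hp (sub_nonneg.2 hab), mul_nonneg hr (sub_nonneg.2 h1),
        mul_nonneg hpos.le (mul_nonneg hr (sub_nonneg.2 h1))]
    exact nonpos_of_mul_nonpos_right this hpos
  · have h1 := hac h
    have : (-ha) * (p * fa + q * fb + r * fc) ≤ 0 := by
      have e : (-ha) * (p * fa + q * fb + r * fc) = q * (hb * fa - ha * fb) +
          r * (hc * fa - ha * fc) - (p * ha + q * hb + r * hc) * fa := by ring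
      rw [e, hsum]
      nlinarith [mul_nonneg hq (sub_nonneg.2 hab), mul_nonneg hr (sub_nonneg.2 h1)]
    exact nonpos_of_mul_nonpos_right this (by linarith)

theorem dot_crossingVector (T : Fin n → Fin 3 → Space) (i : Fin n) (A F : Space) (j : Fin n)
    (k l : Fin 3) : F ⬝ᵥ crossingVector T i A j k l =
      height T i j l * (F ⬝ᵥ (T j k - A)) - height T i j k * (F ⬝ᵥ (T j l - A)) := by
  rw [crossingVector, dotProduct_sub, dotProduct_smul, dotProduct_smul, smul_eq_mul, smul_eq_mul]

theorem height_dot_sum {x : Space} (i j : Fin n) {k : Fin 3} {p q r : ℝ} (h1 : p + q + r = 1)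
    (hx : x = p • T j k + q • T j (k + 1) + r • T j (k + 2)) :
    normal (T i) ⬝ᵥ (x - T i 0) =
      p * height T i j k + q * height T i j (k + 1) + r * height T i j (k + 2) := by
  have hp : p = 1 - q - r := by linarith
  rw [hx, hp]
  simp only [height, vec3_dotProduct, Pi.sub_apply, Pi.add_apply, Pi.smul_apply, smul_eq_mul]
  ring

theorem dot_sum {x A F : Space} {j : Fin n} {k : Fin 3} {p q r : ℝ} (h1 : p + q + r = 1)
    (hx : x = p • T j k + q • T j (k + 1) + r • T j (k + 2)) :
    F ⬝ᵥ (x - A) = p * (F ⬝ᵥ (T j k - A)) + q * (F ⬝ᵥ (T j (k + 1) - A)) +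
      r * (F ⬝ᵥ (T j (k + 2) - A)) := by
  have hp : p = 1 - q - r := by linarith
  rw [hx, hp]
  simp only [vec3_dotProduct, Pi.sub_apply, Pi.add_apply, Pi.smul_apply, smul_eq_mul]
  ring

/-- A boundary point in the plane of `T i` satisfies the inequality if it lies in a facial triangle
with vertices on both sides of this plane. -/
theorem dot_nonpos_of_crossing {θ : Fin n → Fin 3 → ℝ} {i j : Fin n} {A F x : Space}
    (hF : ∀ k z, IsCut T θ i A j k z → F ⬝ᵥ z ≤ 0) (hx : normal (T i) ⬝ᵥ (x - T i 0) = 0)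
    {k : Fin 3} {p q r : ℝ} (hp : 0 ≤ p) (hq : 0 ≤ q) (hr : 0 ≤ r) (h1 : p + q + r = 1)
    (hxw : x = p • T j k + q • T j (k + 1) + r • T j (k + 2))
    (hopp : (height T i j k < 0 ∧ 0 < height T i j (k + 1)) ∨
      (height T i j (k + 1) < 0 ∧ 0 < height T i j k)) : F ⬝ᵥ (x - A) ≤ 0 := by
  rw [height_dot_sum i j h1 hxw] at hx
  rw [dot_sum h1 hxw]
  have hpair : ∀ l m : Fin 3, height T i j l < 0 → 0 < height T i j m →
      height T i j m * (F ⬝ᵥ (T j l - A)) - height T i j l * (F ⬝ᵥ (T j m - A)) ≤ 0 := by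
    intro l m hl hm
    rw [← dot_crossingVector]
    have hlm : l ≠ m := by rintro rfl; linarith
    rcases eq_add_one_or hlm with rfl | rfl
    · exact hF l _ (Or.inl ⟨⟨hl, hm⟩, rfl⟩)
    · exact hF m _ (Or.inr (Or.inl ⟨⟨hl, hm⟩, rfl⟩))
  have h0 : height T i j (k + 2) = 0 → F ⬝ᵥ (T j (k + 2) - A) ≤ 0 :=
    fun h => hF k _ (Or.inr (Or.inr (Or.inl ⟨hopp, h, rfl⟩)))
  rcases hopp with ⟨ha, hb⟩ | ⟨hb, ha⟩
  · exact sum_nonpos_of_crossing hp hq hr hx ha hb (hpair _ _ ha hb) (fun h => hpair _ _ h hb)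
      (fun h => hpair _ _ ha h) h0
  · rw [add_comm (p * _) (q * _)] at hx ⊢
    exact sum_nonpos_of_crossing hq hp hr hx hb ha (hpair _ _ hb ha) (fun h => hpair _ _ h ha)
      (fun h => hpair _ _ hb h) h0

theorem exists_smul_of_cross_eq_zero {u d : Space} (hd : d ≠ 0) (h : u ⨯₃ d = 0) :
    ∃ c : ℝ, u = c • d := by
  have hM := dotProduct_self_pos hd
  refine ⟨(u ⬝ᵥ d) / (d ⬝ᵥ d), ?_⟩
  have h1 : (d ⬝ᵥ d) • u = (u ⬝ᵥ d) • d + d ⨯₃ (u ⨯₃ d) := by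
    ext j
    fin_cases j <;>
    · simp only [vec3_dotProduct, cross_zero, cross_one, cross_two, Pi.add_apply, Pi.smul_apply,
        smul_eq_mul, Fin.isValue, Fin.zero_eta, Fin.mk_one, Fin.reduceFinMk]
      ring
  rw [h, map_zero, add_zero] at h1
  rw [div_eq_inv_mul, ← smul_smul, ← h1, smul_smul, inv_mul_cancel₀ hM.ne', one_smul]

/-- A vector of a plane is a combination of a given vector in the plane and its rotation. -/
theorem exists_eq_smul_add_smul_cross {N e d : Space} (hN : N ≠ 0) (he : e ≠ 0)
    (hNe : N ⬝ᵥ e = 0) (hNd : N ⬝ᵥ d = 0) : ∃ α β : ℝ, d = α • e + β • (N ⨯₃ e) := by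
  have hM := dotProduct_self_pos hN
  have hE := dotProduct_self_pos he
  have h1 : ((N ⬝ᵥ N) * (e ⬝ᵥ e)) • d =
      ((N ⬝ᵥ N) * (e ⬝ᵥ d)) • e + ((N ⨯₃ e) ⬝ᵥ d) • (N ⨯₃ e) := by
    have h2 : ((N ⬝ᵥ N) * (e ⬝ᵥ e)) • d = ((N ⬝ᵥ N) * (e ⬝ᵥ d)) • e +
        ((N ⨯₃ e) ⬝ᵥ d) • (N ⨯₃ e) + ((N ⬝ᵥ e) • ((N ⬝ᵥ e) • d - (e ⬝ᵥ d) • N - (N ⬝ᵥ d) • e) +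
        ((N ⬝ᵥ d) * (e ⬝ᵥ e)) • N) := by
      ext j
      fin_cases j <;>
      · simp only [vec3_dotProduct, cross_zero, cross_one, cross_two, Pi.add_apply, Pi.smul_apply,
          Pi.sub_apply, smul_eq_mul, Fin.isValue, Fin.zero_eta, Fin.mk_one, Fin.reduceFinMk]
        ring
    rw [h2, hNe, hNd]; simp
  refine ⟨((N ⬝ᵥ N) * (e ⬝ᵥ e))⁻¹ * ((N ⬝ᵥ N) * (e ⬝ᵥ d)),
    ((N ⬝ᵥ N) * (e ⬝ᵥ e))⁻¹ * ((N ⨯₃ e) ⬝ᵥ d), ?_⟩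
  have h2 := congrArg (fun v => ((N ⬝ᵥ N) * (e ⬝ᵥ e))⁻¹ • v) h1
  simp only [smul_add, smul_smul, inv_mul_cancel₀ (mul_pos hM hE).ne', one_smul] at h2
  exact h2

/-- A boundary point in the plane of `T i` satisfies the inequality if it lies on an edge in this
plane and the section by this plane has interior points next to it. -/
theorem IsTriangulatedPolytope.dot_nonpos_of_edge (hP : IsTriangulatedPolytope P T)
    {θ : Fin n → Fin 3 → ℝ} (hθ : ∀ j k, IsNextAngle T j k (θ j k)) {i j : Fin n} {A F x d : Space}
    (hF : ∀ j k z, IsCut T θ i A j k z → F ⬝ᵥ z ≤ 0) {k : Fin 3} {s : ℝ}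
    (hx : x = T j k + s • (T j (k + 1) - T j k)) (hs0 : 0 < s) (hs1 : s < 1)
    (hk : height T i j k = 0) (hk1 : height T i j (k + 1) = 0)
    (hd : (T j (k + 1) - T j k) ⨯₃ d ≠ 0) (hNd : normal (T i) ⬝ᵥ d = 0)
    (hin : ∀ᶠ ε : ℝ in 𝓝[>] 0, x + ε • d ∈ interior P) : F ⬝ᵥ (x - A) ≤ 0 := by
  obtain ⟨l, m, hlm, hpos, hlt⟩ := hP.exists_lt_next (Or.inl ⟨rfl, rfl⟩) hx hs0 hs1 hd hin
  replace hlt := hlt _ (hθ l m)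
  have hh : height T i l m = 0 ∧ height T i l (m + 1) = 0 := by
    rcases hlm with ⟨h1, h2⟩ | ⟨h1, h2⟩
    · rw [height, height, h1, h2]; exact ⟨hk, hk1⟩
    · rw [height, height, h1, h2]; exact ⟨hk1, hk⟩
  have hed : (T l (m + 1) - T l m) ⨯₃ d ≠ 0 := by
    rcases hlm with ⟨h1, h2⟩ | ⟨h1, h2⟩
    · rwa [h1, h2]
    · rw [h1, h2, ← neg_sub, LinearMap.map_neg₂]; exact neg_ne_zero.2 hd
  have he : T l (m + 1) - T l m ≠ 0 := by
    intro h; rw [h] at hed; simp at hed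
  have hNe : normal (T i) ⬝ᵥ (T l (m + 1) - T l m) = 0 := by
    have : T l (m + 1) - T l m = (T l (m + 1) - T i 0) - (T l m - T i 0) := by module
    rw [this, dotProduct_sub]
    have h1 := hh.1
    have h2 := hh.2
    unfold height at h1 h2
    rw [h1, h2, sub_zero]
  obtain ⟨α, β, hαβ⟩ := exists_eq_smul_add_smul_cross (hP.normal_ne_zero i) he hNe hNd
  have hr := hP.edgeAxis_cross_ne_zero l m
  have hperp : ∀ c : ℝ, c ≠ 0 →
      edgeAxis T l m ⨯₃ (c • (normal (T i) ⨯₃ (T l (m + 1) - T l m))) ≠ 0 := by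
    intro c hc h0
    have h1 : edgeAxis T l m ⨯₃ d = 0 := by
      rw [hαβ, map_add, map_smul, map_smul]
      have h2 : edgeAxis T l m ⨯₃ (T l (m + 1) - T l m) = 0 := by
        rw [edgeAxis, LinearMap.map_smul₂, cross_self, smul_zero]
      rw [map_smul] at h0
      rw [h2, (smul_eq_zero.1 h0).resolve_left hc, smul_zero, smul_zero, add_zero]
    rw [edgeAxis, LinearMap.map_smul₂] at h1
    exact smul_ne_zero (orientation_ne_zero T l) hed h1
  have hβ : β ≠ 0 := by
    rintro rfl
    rw [zero_smul, add_zero] at hαβ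
    rw [hαβ, map_smul, cross_self, smul_zero] at hed
    exact hed rfl
  have hwedge : InWedge T θ l m (normal (T i) ⨯₃ (T l (m + 1) - T l m)) ∨
      InWedge T θ l m (-(normal (T i) ⨯₃ (T l (m + 1) - T l m))) := by
    rcases hβ.lt_or_gt with h | h
    · right
      have h1 : d = α • (T l (m + 1) - T l m) +
          (-β) • -(normal (T i) ⨯₃ (T l (m + 1) - T l m)) := by rw [hαβ]; module
      have h2 := hperp (-1) (by norm_num)
      rw [neg_one_smul] at h2
      rw [h1, edgeAngle_smul_add T l m α (by linarith) _ hr h2] at hpos hlt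
      exact ⟨hpos, hlt⟩
    · left
      have h2 := hperp 1 one_ne_zero
      rw [one_smul] at h2
      rw [hαβ, edgeAngle_smul_add T l m α h _ hr h2] at hpos hlt
      exact ⟨hpos, hlt⟩
  have hcut := fun z hz => hF l m z (Or.inr (Or.inr (Or.inr ⟨⟨hh.1, hh.2, hwedge⟩, hz⟩)))
  have hab : F ⬝ᵥ (T j k - A) ≤ 0 ∧ F ⬝ᵥ (T j (k + 1) - A) ≤ 0 := by
    rcases hlm with ⟨h1, h2⟩ | ⟨h1, h2⟩
    · exact ⟨by rw [← h1]; exact hcut _ (Or.inl rfl), by rw [← h2]; exact hcut _ (Or.inr rfl)⟩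
    · exact ⟨by rw [← h2]; exact hcut _ (Or.inr rfl), by rw [← h1]; exact hcut _ (Or.inl rfl)⟩
  have h3 : F ⬝ᵥ (x - A) = (1 - s) * (F ⬝ᵥ (T j k - A)) + s * (F ⬝ᵥ (T j (k + 1) - A)) := by
    rw [hx]
    simp only [vec3_dotProduct, Pi.sub_apply, Pi.add_apply, Pi.smul_apply, smul_eq_mul]
    ring
  rw [h3]
  nlinarith [mul_nonneg hs0.le (sub_nonneg.2 hab.2),
    mul_nonneg (sub_nonneg.2 hs1.le) (sub_nonneg.2 hab.1)]

/-- The first boundary point on a ray inside the plane of `T i` satisfies the inequality, if the ray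
misses the vertices. -/
theorem IsTriangulatedPolytope.dot_nonpos_of_exit (hP : IsTriangulatedPolytope P T)
    {θ : Fin n → Fin 3 → ℝ} (hθ : ∀ j k, IsNextAngle T j k (θ j k)) {i : Fin n} {A F x d : Space}
    (hF : ∀ j k z, IsCut T θ i A j k z → F ⬝ᵥ z ≤ 0) (hd0 : d ≠ 0)
    (hNx : normal (T i) ⬝ᵥ (x - T i 0) = 0) (hNd : normal (T i) ⬝ᵥ d = 0)
    (hvert : ∀ j k, ∀ t : ℝ, x + t • d ≠ T j k)
    (hin : ∀ᶠ ε : ℝ in 𝓝[>] 0, x + ε • d ∈ interior P) (hxf : x ∈ frontier P) :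
    F ⬝ᵥ (x - A) ≤ 0 := by
  rw [hP.frontier_eq] at hxf
  obtain ⟨j, hj⟩ := Set.mem_iUnion.1 hxf
  by_cases hopp : ∃ k, (height T i j k < 0 ∧ 0 < height T i j (k + 1)) ∨
      (height T i j (k + 1) < 0 ∧ 0 < height T i j k)
  · obtain ⟨k, hk⟩ := hopp
    obtain ⟨p, q, r, hp, hq, hr, h1, hxw⟩ := exists_weights hj k
    exact dot_nonpos_of_crossing (hF j) hNx hp hq hr h1 hxw hk
  push Not at hopp
  -- all vertices with positive weight lie in the plane
  have hzero : ∀ k : Fin 3, ∀ p q r : ℝ, 0 ≤ p → 0 ≤ q → 0 ≤ r → p + q + r = 1 →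
      x = p • T j k + q • T j (k + 1) + r • T j (k + 2) → 0 < p → height T i j k = 0 := by
    intro k p q r hp hq hr h1 hxw hppos
    have hsum := hNx
    rw [height_dot_sum i j h1 hxw] at hsum
    have h01 := hopp k
    have h20 := hopp (k + 2)
    rw [add_two_add_one] at h20
    by_contra hne
    rcases (Ne.lt_or_gt hne) with h | h
    · have a1 := h01.1 h
      have a2 : height T i j (k + 2) ≤ 0 := not_lt.1 fun h' => by
        have := h20.2 h; linarith
      nlinarith [mul_neg_of_pos_of_neg hppos h, mul_nonneg hq (neg_nonneg.2 a1),
        mul_nonneg hr (neg_nonneg.2 a2)]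
    · have a1 : 0 ≤ height T i j (k + 1) := not_lt.1 fun h' => by
        have := h01.2 h'; linarith
      have a2 : 0 ≤ height T i j (k + 2) := not_lt.1 fun h' => by
        have := h20.1 h'; linarith
      nlinarith [mul_pos hppos h, mul_nonneg hq a1, mul_nonneg hr a2]
  have hedge : ∀ k : Fin 3, ∀ p q : ℝ, 0 ≤ p → 0 ≤ q → p + q = 1 →
      x = p • T j k + q • T j (k + 1) → F ⬝ᵥ (x - A) ≤ 0 := by
    intro k p q hp hq h1 hxw
    have hp0 : 0 < p := by
      refine lt_of_le_of_ne hp fun h => hvert j (k + 1) 0 ?_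
      have : q = 1 := by linarith
      rw [hxw, ← h, this]; module
    have hq0 : 0 < q := by
      refine lt_of_le_of_ne hq fun h => hvert j k 0 ?_
      have : p = 1 := by linarith
      rw [hxw, ← h, this]; module
    have hk := hzero k p q 0 hp hq le_rfl (by linarith) (by rw [hxw]; module) hp0
    have hk1 := hzero (k + 1) q 0 p hq le_rfl hp (by linarith)
      (by rw [hxw, add_one_add_two]; module) hq0
    have hp' : p = 1 - q := by linarith
    have hx : x = T j k + q • (T j (k + 1) - T j k) := by rw [hxw, hp']; module
    refine hP.dot_nonpos_of_edge hθ hF hx hq0 (by linarith) hk hk1 ?_ hNd hin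
    intro h0
    obtain ⟨c, hc⟩ := exists_smul_of_cross_eq_zero hd0 h0
    refine hvert j k (-(q * c)) ?_
    rw [hx, hc]; module
  obtain ⟨p, q, r, hp, hq, hr, h1, hxw⟩ := exists_weights hj 0
  have hxw' : x = p • T j 0 + q • T j 1 + r • T j 2 := hxw
  rcases hp.eq_or_lt with rfl | hp0
  · exact hedge 1 q r hq hr (by linarith) (by rw [hxw']; show _ = q • T j 1 + r • T j 2; module)
  rcases hq.eq_or_lt with rfl | hq0
  · exact hedge 2 r p hr hp (by linarith) (by rw [hxw']; show _ = r • T j 2 + p • T j 0; module)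
  rcases hr.eq_or_lt with rfl | hr0
  · exact hedge 0 p q hp hq (by linarith) (by rw [hxw']; show _ = p • T j 0 + q • T j 1; module)
  -- a triangle in the plane contains the points of the ray close to `x`
  exfalso
  have h00 : height T i j 0 = 0 := hzero 0 p q r hp hq hr h1 hxw hp0
  have h01 : height T i j 1 = 0 := hzero 1 q r p hq hr hp (by linarith)
    (by rw [hxw']; show _ = q • T j 1 + r • T j 2 + p • T j 0; module) hq0
  have h02 : height T i j 2 = 0 := hzero 2 r p q hr hp hq (by linarith)
    (by rw [hxw']; show _ = r • T j 2 + p • T j 0 + q • T j 1; module) hr0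
  have hxo : x ∈ openTriangle (T j) := by
    rw [hxw]; exact mem_openTriangle_of_weights 0 hp0 hq0 hr0 h1
  have hNj := hP.normal_ne_zero j
  have hpar : normal (T j) ⬝ᵥ d = 0 := by
    have hM := dotProduct_self_pos (hP.normal_ne_zero i)
    have e1 : normal (T i) ⬝ᵥ (T j 1 - T j 0) = 0 := by
      rw [show T j 1 - T j 0 = (T j 1 - T i 0) - (T j 0 - T i 0) by module, dotProduct_sub]
      unfold height at h00 h01
      rw [h00, h01, sub_zero]
    have e2 : normal (T i) ⬝ᵥ (T j 2 - T j 0) = 0 := by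
      rw [show T j 2 - T j 0 = (T j 2 - T i 0) - (T j 0 - T i 0) by module, dotProduct_sub]
      unfold height at h00 h02
      rw [h00, h02, sub_zero]
    have e3 : ∀ N u v w : Space, (N ⬝ᵥ N) * ((u ⨯₃ v) ⬝ᵥ w) = (N ⬝ᵥ u) * (N ⬝ᵥ (v ⨯₃ w)) +
        (N ⬝ᵥ v) * (N ⬝ᵥ (w ⨯₃ u)) + (N ⬝ᵥ w) * (N ⬝ᵥ (u ⨯₃ v)) := by
      intro N u v w
      simp only [vec3_dotProduct, cross_zero, cross_one, cross_two]
      ring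
    have e4 := e3 (normal (T i)) (T j 1 - T j 0) (T j 2 - T j 0) d
    rw [e1, e2, hNd, zero_mul, zero_mul, zero_mul, add_zero, add_zero] at e4
    exact (mul_eq_zero.1 e4).resolve_left hM.ne'
  have hnear : ∀ᶠ ε : ℝ in 𝓝[>] 0, x + ε • d ∈ openTriangle (T j) := by
    have hb : ∀ᶠ ε : ℝ in 𝓝[>] 0, ∀ k, 0 < bary (T j) k (x + ε • d) := by
      rw [eventually_all]
      intro k
      have hc : Continuous fun ε : ℝ => bary (T j) k (x + ε • d) :=
        (continuous_bary _ _).comp (by fun_prop)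
      have h := hc.tendsto 0
      rw [zero_smul, add_zero] at h
      exact (h.mono_left nhdsWithin_le_nhds).eventually
        (lt_mem_nhds (((mem_openTriangle_iff hNj).1 hxo).2 k))
    filter_upwards [hb] with ε hε
    refine (mem_openTriangle_iff hNj).2 ⟨?_, hε⟩
    rw [add_sub_right_comm, dotProduct_add, ((mem_openTriangle_iff hNj).1 hxo).1, dotProduct_smul,
      hpar, smul_zero, add_zero]
  obtain ⟨ε, h2, h3⟩ := (hin.and hnear).exists
  exact hP.notMem_interior (openTriangle_subset _ h3) h2

/-- The inequalities for the spanning points imply the inequality for the section by the plane of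
a facial triangle. -/
theorem IsTriangulatedPolytope.dot_neg_of_cuts (hP : IsTriangulatedPolytope P T)
    {θ : Fin n → Fin 3 → ℝ} (hθ : ∀ j k, IsNextAngle T j k (θ j k)) {i : Fin n} {A F x : Space}
    (hF : ∀ j k z, IsCut T θ i A j k z → F ⬝ᵥ z ≤ 0) (hF0 : F ≠ 0) (hNF : normal (T i) ⬝ᵥ F = 0)
    (hx : x ∈ interior P) (hNx : normal (T i) ⬝ᵥ (x - T i 0) = 0) : F ⬝ᵥ (x - A) < 0 := by
  have hle : ∀ x ∈ interior P, normal (T i) ⬝ᵥ (x - T i 0) = 0 → F ⬝ᵥ (x - A) ≤ 0 := by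
    intro x hx hNx
    obtain ⟨d, hd0, hNd, hd⟩ := exists_direction (normal_eq (T i) 0) (hP.normal_ne_zero i)
      (⋃ j, Set.range (T j)) (Set.finite_iUnion fun j => Set.finite_range _) (x := x)
      (fun h => by
        obtain ⟨j, k, rfl⟩ := Set.mem_iUnion.1 h
        exact hP.notMem_interior (vertex_mem_triangle _ _) hx)
    -- both ends of the chord through `x`
    have hend : ∀ c : ℝ, c ≠ 0 → ∃ b : ℝ, 0 < b ∧ F ⬝ᵥ (x + b • (c • d) - A) ≤ 0 := by
      intro c hc
      have hcd : c • d ≠ 0 := smul_ne_zero hc hd0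
      obtain ⟨b, hb, hbf, hbin⟩ := hP.exists_exit hcd hx
      refine ⟨b, hb, hP.dot_nonpos_of_exit hθ hF (d := -(c • d)) (neg_ne_zero.2 hcd) ?_ ?_ ?_ ?_
        hbf⟩
      · rw [add_sub_right_comm, dotProduct_add, hNx, dotProduct_smul, dotProduct_smul, hNd]; simp
      · rw [dotProduct_neg, dotProduct_smul, hNd]; simp
      · intro j k t h
        refine hd ((b - t) * c) (Set.mem_iUnion.2 ⟨j, k, ?_⟩)
        rw [← h]; module
      · filter_upwards [Ioo_mem_nhdsGT hb] with ε hε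
        have := hbin (b - ε) (by linarith [hε.2]) (by linarith [hε.1])
        convert this using 1
        module
    obtain ⟨b, hb, h1⟩ := hend 1 one_ne_zero
    obtain ⟨b', hb', h2⟩ := hend (-1) (by norm_num)
    have e1 : F ⬝ᵥ (x + b • ((1 : ℝ) • d) - A) = F ⬝ᵥ (x - A) + b * (F ⬝ᵥ d) := by
      rw [one_smul, add_sub_right_comm, dotProduct_add, dotProduct_smul, smul_eq_mul]
    have e2 : F ⬝ᵥ (x + b' • ((-1 : ℝ) • d) - A) = F ⬝ᵥ (x - A) - b' * (F ⬝ᵥ d) := by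
      rw [neg_one_smul, add_sub_right_comm, dotProduct_add, dotProduct_smul, smul_eq_mul,
        dotProduct_neg]
      ring
    rw [e1] at h1
    rw [e2] at h2
    rcases le_total 0 (F ⬝ᵥ d) with h | h
    · nlinarith [mul_nonneg hb.le h]
    · nlinarith [mul_nonneg hb'.le (neg_nonneg.2 h)]
  -- the section is open in the plane
  have hFF := dotProduct_self_pos hF0
  obtain ⟨R, hR, hball⟩ := Metric.isOpen_iff.1 isOpen_interior x hx
  obtain ⟨ε, hε, hε0⟩ := ((eventually_add_smul_mem_ball x F hR).and self_mem_nhdsWithin).exists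
  have := hle _ (hball hε) (by
    rw [add_sub_right_comm, dotProduct_add, hNx, dotProduct_smul, hNF]; simp)
  rw [add_sub_right_comm, dotProduct_add, dotProduct_smul, smul_eq_mul] at this
  have hp := mul_pos (show (0 : ℝ) < ε from hε0) hFF
  linarith

end Polytope

section Polytope

variable {P : Set Space} {n : ℕ} {T : Fin n → Fin 3 → Space}

/-! ### Half-planes that avoid the section satisfy the inequalities -/

theorem le_zero_of_eventually {c d : ℝ} (h : ∀ᶠ ε : ℝ in 𝓝[>] 0, c + ε * d ≤ 0) : c ≤ 0 := by
  have hc : Continuous fun ε : ℝ => c + ε * d := by fun_prop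
  have ht := hc.tendsto 0
  rw [zero_mul, add_zero] at ht
  exact le_of_tendsto (ht.mono_left nhdsWithin_le_nhds) h

/-- The section of `P` by the plane of the triangle `t` lies on the side `F · (x - A) ≤ 0` of a line
through `A`. -/
def SectionNonpos (P : Set Space) (t : Fin 3 → Space) (A F : Space) : Prop :=
  ∀ x ∈ interior P, normal t ⬝ᵥ (x - t 0) = 0 → F ⬝ᵥ (x - A) ≤ 0

theorem SectionNonpos.of_eventually {t : Fin 3 → Space} {A F : Space} (h : SectionNonpos P t A F)
    {x v : Space} (hx : normal t ⬝ᵥ (x - t 0) = 0) (hv : normal t ⬝ᵥ v = 0)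
    (hin : ∀ᶠ ε : ℝ in 𝓝[>] 0, x + ε • v ∈ interior P) : F ⬝ᵥ (x - A) ≤ 0 := by
  refine le_zero_of_eventually (d := F ⬝ᵥ v) ?_
  filter_upwards [hin] with ε hε
  have := h _ hε (by rw [add_sub_right_comm, dotProduct_add, hx, dotProduct_smul, hv]; simp)
  rwa [add_sub_right_comm, dotProduct_add, dotProduct_smul, smul_eq_mul] at this

/-- All points of a triangle that crosses the plane are limits of points of the section. -/
theorem SectionNonpos.of_crossing (hP : IsTriangulatedPolytope P T) {i j : Fin n} {A F : Space}
    (h : SectionNonpos P (T i) A F) (hN : normal (T i) ⨯₃ normal (T j) ≠ 0) {x y : Space}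
    (hx : x ∈ triangle (T j)) (hxN : normal (T i) ⬝ᵥ (x - T i 0) = 0)
    (hy : y ∈ openTriangle (T j)) (hyN : normal (T i) ⬝ᵥ (y - T i 0) = 0) :
    F ⬝ᵥ (x - A) ≤ 0 := by
  have hopen : ∀ y ∈ openTriangle (T j), normal (T i) ⬝ᵥ (y - T i 0) = 0 → F ⬝ᵥ (y - A) ≤ 0 := by
    intro y hy hyN
    have hM := dotProduct_self_pos hN
    set v := orientation T j • ((normal (T i) ⨯₃ normal (T j)) ⨯₃ normal (T i)) with hv
    refine h.of_eventually (v := v) hyN ?_ ((hP.isInward_orientation j).eventually_mem hy ?_)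
    · rw [hv, dotProduct_smul, dot_cross_self, smul_zero]
    · have h1 : normal (T j) ⬝ᵥ ((normal (T i) ⨯₃ normal (T j)) ⨯₃ normal (T i)) =
          (normal (T i) ⨯₃ normal (T j)) ⬝ᵥ (normal (T i) ⨯₃ normal (T j)) := by
        simp only [vec3_dotProduct, cross_zero, cross_one, cross_two]; ring
      rw [hv, smul_dotProduct, dotProduct_smul, h1, smul_smul, smul_eq_mul]
      rcases orientation_eq T j with h | h <;> rw [h] <;> linarith
  have hNj := hP.normal_ne_zero j
  refine le_zero_of_eventually (d := F ⬝ᵥ (y - x)) ?_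
  filter_upwards [Ioo_mem_nhdsGT (zero_lt_one' ℝ)] with ε hε
  have hxj := (mem_triangle_iff_bary hNj).1 hx
  have hyj := (mem_openTriangle_iff hNj).1 hy
  have e : ∀ G B : Space, G ⬝ᵥ (x + ε • (y - x) - B) =
      (1 - ε) * (G ⬝ᵥ (x - B)) + ε * (G ⬝ᵥ (y - B)) := by
    intro G B
    simp only [vec3_dotProduct, Pi.add_apply, Pi.sub_apply, Pi.smul_apply, smul_eq_mul]; ring
  have h2 := hopen (x + ε • (y - x)) ((mem_openTriangle_iff hNj).2 ⟨?_, fun k => ?_⟩) ?_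
  · rwa [add_sub_right_comm, dotProduct_add, dotProduct_smul, smul_eq_mul] at h2
  · rw [e, hxj.1, hyj.1]; simp
  · rw [bary_add_smul]
    have h3 := mul_nonneg (sub_nonneg.2 hε.2.le) (hxj.2 k)
    have h4 := mul_pos hε.1 (hyj.2 k)
    linarith
  · rw [e, hxN, hyN]; simp

/-- A triangle with vertices on both sides of a plane has a point with positive barycentric
coordinates in this plane. -/
theorem exists_mem_openTriangle {i j : Fin n} {k : Fin 3}
    (hopp : (height T i j k < 0 ∧ 0 < height T i j (k + 1)) ∨
      (height T i j (k + 1) < 0 ∧ 0 < height T i j k)) :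
    ∃ y ∈ openTriangle (T j), normal (T i) ⬝ᵥ (y - T i 0) = 0 := by
  have key : ∀ a b c : ℝ, a < 0 → 0 < b →
      ∃ p q r : ℝ, 0 < p ∧ 0 < q ∧ 0 < r ∧ p * a + q * b + r * c = 0 := by
    intro a b c ha hb
    rcases le_or_gt 0 c with hc | hc
    · exact ⟨b + c, -a, -a, by linarith, by linarith, by linarith, by ring⟩
    · exact ⟨b, -a - c, b, hb, by linarith, hb, by ring⟩
  obtain ⟨p, q, r, hp, hq, hr, h0⟩ : ∃ p q r : ℝ, 0 < p ∧ 0 < q ∧ 0 < r ∧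
      p * height T i j k + q * height T i j (k + 1) + r * height T i j (k + 2) = 0 := by
    rcases hopp with ⟨ha, hb⟩ | ⟨hb, ha⟩
    · exact key _ _ _ ha hb
    · obtain ⟨p, q, r, hp, hq, hr, h⟩ := key _ _ (height T i j (k + 2)) hb ha
      exact ⟨q, p, r, hq, hp, hr, by linarith⟩
  set S := p + q + r with hS
  have hSpos : 0 < S := by positivity
  have h1 : p / S + q / S + r / S = 1 := by rw [← add_div, ← add_div, ← hS, div_self hSpos.ne']
  refine ⟨_, mem_openTriangle_of_weights k (div_pos hp hSpos) (div_pos hq hSpos)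
    (div_pos hr hSpos) h1, ?_⟩
  rw [height_dot_sum i j h1 rfl]
  field_simp
  linarith

theorem cross_normal_ne_zero (hP : IsTriangulatedPolytope P T) {i j : Fin n} {k l : Fin 3}
    (h : height T i j k ≠ height T i j l) : normal (T i) ⨯₃ normal (T j) ≠ 0 := by
  intro h0
  obtain ⟨c, hc⟩ := exists_smul_of_cross_eq_zero (hP.normal_ne_zero j) h0
  apply h
  have h1 : normal (T j) ⬝ᵥ (T j k - T i 0) = normal (T j) ⬝ᵥ (T j l - T i 0) := by
    have h2 := normal_dot_of_mem (vertex_mem_triangle (T j) k) l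
    have h3 : T j k - T i 0 = (T j k - T j l) + (T j l - T i 0) := by module
    rw [h3, dotProduct_add, h2, zero_add]
  unfold height
  rw [hc, smul_dotProduct, smul_dotProduct, h1]

/-- If the section lies on one side of a line, so do the points that span it. -/
theorem SectionNonpos.cuts (hP : IsTriangulatedPolytope P T) {θ : Fin n → Fin 3 → ℝ}
    (hθ : ∀ j k, IsNextAngle T j k (θ j k)) {i : Fin n} {A F : Space}
    (h : SectionNonpos P (T i) A F) {j : Fin n} {k : Fin 3} {z : Space}
    (hz : IsCut T θ i A j k z) : F ⬝ᵥ z ≤ 0 := by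
  have hcross : ∀ k l : Fin 3, height T i j k < 0 → 0 < height T i j l →
      (∃ y ∈ openTriangle (T j), normal (T i) ⬝ᵥ (y - T i 0) = 0) →
      F ⬝ᵥ crossingVector T i A j k l ≤ 0 := by
    rintro k l hk hl ⟨y, hy, hyN⟩
    have hpos : 0 < height T i j l - height T i j k := by linarith
    set s := -height T i j k / (height T i j l - height T i j k) with hs
    have hs0 : 0 ≤ s := div_nonneg (by linarith) hpos.le
    have hs1 : s ≤ 1 := by rw [hs, div_le_one hpos]; linarith
    have hsm : s * (height T i j l - height T i j k) = -height T i j k :=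
      div_mul_cancel₀ _ hpos.ne'
    have hmem : T j k + s • (T j l - T j k) ∈ triangle (T j) :=
      (convex_convexHull ℝ _).add_smul_sub_mem (vertex_mem_triangle _ _)
        (vertex_mem_triangle _ _) ⟨hs0, hs1⟩
    have e : ∀ G B : Space, G ⬝ᵥ (T j k + s • (T j l - T j k) - B) =
        G ⬝ᵥ (T j k - B) + s * (G ⬝ᵥ (T j l - B) - G ⬝ᵥ (T j k - B)) := by
      intro G B
      simp only [vec3_dotProduct, Pi.add_apply, Pi.sub_apply, Pi.smul_apply, smul_eq_mul]; ring
    have hle := h.of_crossing hP (cross_normal_ne_zero hP (by linarith : height T i j k ≠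
      height T i j l)) hmem (by
        rw [e]
        have : height T i j k + s * (height T i j l - height T i j k) = 0 := by
          rw [hsm]; ring
        exact this) hy hyN
    rw [dot_crossingVector]
    rw [e] at hle
    have h2 := mul_nonpos_of_nonneg_of_nonpos hpos.le hle
    have h3 : (height T i j l - height T i j k) * (F ⬝ᵥ (T j k - A) +
        s * (F ⬝ᵥ (T j l - A) - F ⬝ᵥ (T j k - A))) =
        (height T i j l - height T i j k) * (F ⬝ᵥ (T j k - A)) +
        (s * (height T i j l - height T i j k)) * (F ⬝ᵥ (T j l - A) - F ⬝ᵥ (T j k - A)) := by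
      ring
    rw [h3, hsm] at h2
    linarith
  rcases hz with ⟨hh, rfl⟩ | ⟨hh, rfl⟩ | ⟨hopp, hh, rfl⟩ | ⟨⟨hk, hk1, hw⟩, hz⟩
  · exact hcross _ _ hh.1 hh.2 (exists_mem_openTriangle (Or.inl hh))
  · exact hcross _ _ hh.1 hh.2 (exists_mem_openTriangle (Or.inr hh))
  · obtain ⟨y, hy, hyN⟩ := exists_mem_openTriangle hopp
    refine h.of_crossing hP (cross_normal_ne_zero hP (k := k) (l := k + 1) ?_)
      (vertex_mem_triangle _ _) hh hy hyN
    rcases hopp with h | h <;> [skip; symm] <;> linarith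
  · set a := T j k
    set b := T j (k + 1)
    have hNe : normal (T i) ⬝ᵥ (b - a) = 0 := by
      rw [show b - a = (b - T i 0) - (a - T i 0) by module, dotProduct_sub]
      unfold height at hk hk1
      rw [hk, hk1, sub_zero]
    have hba : b - a ≠ 0 := by
      rw [sub_ne_zero]
      exact ((show HasEdge a b (T j) k from Or.inl ⟨rfl, rfl⟩).ne (hP.normal_ne_zero j)).symm
    have hne : (b - a) ⨯₃ (normal (T i) ⨯₃ (b - a)) ≠ 0 := by
      intro h0
      have h1 : normal (T i) ⬝ᵥ ((b - a) ⨯₃ (normal (T i) ⨯₃ (b - a))) =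
          (normal (T i) ⬝ᵥ normal (T i)) * ((b - a) ⬝ᵥ (b - a)) - (normal (T i) ⬝ᵥ (b - a)) ^ 2 := by
        simp only [vec3_dotProduct, cross_zero, cross_one, cross_two, Pi.sub_apply]; ring
      rw [h0, dotProduct_zero, hNe] at h1
      have := mul_pos (dotProduct_self_pos (hP.normal_ne_zero i)) (dotProduct_self_pos hba)
      linarith
    -- all points in the relative interior of the edge are limits of points of the section
    have hedge : ∀ s : ℝ, 0 < s → s < 1 → F ⬝ᵥ (a + s • (b - a) - A) ≤ 0 := by
      intro s hs0 hs1
      have hsN : normal (T i) ⬝ᵥ (a + s • (b - a) - T i 0) = 0 := by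
        rw [add_sub_right_comm, dotProduct_add, dotProduct_smul, hNe, smul_zero, add_zero]
        exact hk
      rcases hw with hw | hw
      · refine h.of_eventually hsN ?_ (hP.eventually_mem_of_lt_next (hθ j k) hs0 hs1 hne hw.1 hw.2)
        exact dot_self_cross _ _
      · refine h.of_eventually hsN ?_ (hP.eventually_mem_of_lt_next (hθ j k) hs0 hs1 ?_ hw.1 hw.2)
        · rw [dotProduct_neg, dot_self_cross, neg_zero]
        · rw [map_neg]; exact neg_ne_zero.2 hne
    have ha : F ⬝ᵥ (a - A) ≤ 0 := by
      refine le_zero_of_eventually (d := F ⬝ᵥ (b - a)) ?_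
      filter_upwards [Ioo_mem_nhdsGT (zero_lt_one' ℝ)] with ε hε
      have := hedge ε hε.1 hε.2
      rwa [add_sub_right_comm, dotProduct_add, dotProduct_smul, smul_eq_mul] at this
    have hb : F ⬝ᵥ (b - A) ≤ 0 := by
      refine le_zero_of_eventually (d := F ⬝ᵥ (a - b)) ?_
      filter_upwards [Ioo_mem_nhdsGT (zero_lt_one' ℝ)] with ε hε
      have := hedge (1 - ε) (by linarith [hε.2]) (by linarith [hε.1])
      rw [show a + (1 - ε) • (b - a) - A = (b - A) + ε • (a - b) by module] at this
      rwa [dotProduct_add, dotProduct_smul, smul_eq_mul] at this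
    rcases hz with rfl | rfl
    · exact ha
    · exact hb

/-! ### Carving in terms of the boundary -/

/-- Cuts carve `P` if they cover its boundary and avoid its interior. -/
theorem IsTriangulatedPolytope.carves (hP : IsTriangulatedPolytope P T) {W : Set (Set Space)}
    (h1 : frontier P ⊆ ⋃₀ W) (h2 : Disjoint (⋃₀ W) (interior P)) : Carves W P := by
  intro C hC
  obtain ⟨x, hx⟩ := hP.isConnected_interior.nonempty
  have hsub : interior P ⊆ C \ ⋃₀ W :=
    fun y hy => ⟨hC (interior_subset hy), fun h => Set.disjoint_left.1 h2 h hy⟩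
  refine ⟨x, hsub hx, Set.Subset.antisymm ?_
    (hP.isConnected_interior.isPreconnected.subset_connectedComponentIn hx hsub)⟩
  refine subset_interior_of_isPreconnected isPreconnected_connectedComponentIn ?_
    (mem_connectedComponentIn (hsub hx)) hx
  rw [Set.disjoint_left]
  exact fun y hy hyf => (connectedComponentIn_subset _ _ hy).2 (h1 hyf)

/-- Cuts that carve `P` cover its boundary and avoid its interior. -/
theorem IsTriangulatedPolytope.of_carves (hP : IsTriangulatedPolytope P T) {W : Set (Set Space)}
    (h : Carves W P) : frontier P ⊆ ⋃₀ W ∧ Disjoint (⋃₀ W) (interior P) := by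
  obtain ⟨x, hx, hcomp⟩ := h P subset_rfl
  have hsub : interior P ⊆ P \ ⋃₀ W := hcomp ▸ connectedComponentIn_subset _ _
  refine ⟨fun y hy => ?_, Set.disjoint_left.2 fun y hy hyP => (hsub hyP).2 hy⟩
  by_contra hyW
  have hyP := hP.frontier_subset hy
  have hS : IsPreconnected (insert y (interior P)) := by
    refine hP.isConnected_interior.isPreconnected.subset_closure (Set.subset_insert _ _) ?_
    rw [hP.closure_interior]
    exact Set.insert_subset hyP interior_subset
  have hxi : x ∈ interior P := hcomp ▸ mem_connectedComponentIn hx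
  have hyC : y ∈ P \ ⋃₀ W := ⟨hyP, hyW⟩
  have := hS.subset_connectedComponentIn (Set.mem_insert_of_mem _ hxi)
    (Set.insert_subset hyC hsub) (Set.mem_insert _ _)
  rw [hcomp] at this
  exact hy.2 this

/-! ### Half-planes that contain a facial triangle -/

/-- In the plane of `t`, a normal vector of the edge from `t k` to `t (k + 2)` which points to the
side of the triangle. -/
def coneLeft (t : Fin 3 → Space) (k : Fin 3) : Space := (t (k + 2) - t k) ⨯₃ normal t

/-- In the plane of `t`, a normal vector of the edge from `t k` to `t (k + 1)` which points to the
side of the triangle. -/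
def coneRight (t : Fin 3 → Space) (k : Fin 3) : Space := normal t ⨯₃ (t (k + 1) - t k)

/-- The nonzero vectors `F` parallel to the plane of the triangle `t` such that the half-plane
`0 ≤ F · (x - t k)` of this plane contains `t`. They form a cone without its apex. -/
def InCone (t : Fin 3 → Space) (k : Fin 3) (F : Space) : Prop :=
  ∃ a b : ℝ, 0 ≤ a ∧ 0 ≤ b ∧ 0 < a + b ∧ F = a • coneLeft t k + b • coneRight t k

theorem coneLeft_dot (t : Fin 3 → Space) (k : Fin 3) :
    coneLeft t k ⬝ᵥ (t (k + 1) - t k) = normal t ⬝ᵥ normal t ∧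
      coneLeft t k ⬝ᵥ (t (k + 2) - t k) = 0 := by
  have h := normal_eq t k
  rw [coneLeft, ← h]
  constructor <;>
  · simp only [vec3_dotProduct, cross_zero, cross_one, cross_two, Pi.sub_apply]; ring

theorem coneRight_dot (t : Fin 3 → Space) (k : Fin 3) :
    coneRight t k ⬝ᵥ (t (k + 1) - t k) = 0 ∧
      coneRight t k ⬝ᵥ (t (k + 2) - t k) = normal t ⬝ᵥ normal t := by
  have h := normal_eq t k
  rw [coneRight, ← h]
  constructor <;>
  · simp only [vec3_dotProduct, cross_zero, cross_one, cross_two, Pi.sub_apply]; ring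

theorem InCone.normal_dot {t : Fin 3 → Space} {k : Fin 3} {F : Space} (h : InCone t k F) :
    normal t ⬝ᵥ F = 0 := by
  obtain ⟨a, b, -, -, -, rfl⟩ := h
  rw [coneLeft, coneRight, dotProduct_add, dotProduct_smul, dotProduct_smul, dot_cross_self,
    dot_self_cross, smul_zero, smul_zero, add_zero]

theorem InCone.ne_zero {t : Fin 3 → Space} (ht : normal t ≠ 0) {k : Fin 3} {F : Space}
    (h : InCone t k F) : F ≠ 0 := by
  obtain ⟨a, b, ha, hb, hab, rfl⟩ := h
  intro h0
  have hM := dotProduct_self_pos ht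
  have h1 := congrArg (fun v => v ⬝ᵥ (t (k + 1) - t k)) h0
  have h2 := congrArg (fun v => v ⬝ᵥ (t (k + 2) - t k)) h0
  simp only [add_dotProduct, smul_dotProduct, (coneLeft_dot t k).1, (coneLeft_dot t k).2,
    (coneRight_dot t k).1, (coneRight_dot t k).2, smul_eq_mul, zero_dotProduct, mul_zero,
    add_zero, zero_add, mul_eq_zero, hM.ne', or_false] at h1 h2
  linarith

theorem InCone.dot_nonneg {t : Fin 3 → Space} (ht : normal t ≠ 0) {k : Fin 3} {F : Space}
    (h : InCone t k F) {x : Space} (hx : x ∈ triangle t) : 0 ≤ F ⬝ᵥ (x - t k) := by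
  obtain ⟨a, b, ha, hb, hab, rfl⟩ := h
  obtain ⟨p, q, r, hp, hq, hr, h1, rfl⟩ := exists_weights hx k
  have hM := dotProduct_self_pos ht
  have hp' : p = 1 - q - r := by linarith
  have e : p • t k + q • t (k + 1) + r • t (k + 2) - t k =
      q • (t (k + 1) - t k) + r • (t (k + 2) - t k) := by rw [hp']; module
  rw [e]
  simp only [add_dotProduct, smul_dotProduct, dotProduct_add, dotProduct_smul,
    (coneLeft_dot t k).1, (coneLeft_dot t k).2, (coneRight_dot t k).1, (coneRight_dot t k).2,
    smul_eq_mul, mul_zero, add_zero, zero_add]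
  positivity

theorem linearIndependent_of_orthogonal {N F : Space} (hN : N ≠ 0) (hF : F ≠ 0)
    (h : N ⬝ᵥ F = 0) : LinearIndependent ℝ ![N ⨯₃ F, F] := by
  rw [← crossProduct_ne_zero_iff_linearIndependent]
  intro h0
  have h1 : N ⬝ᵥ ((N ⨯₃ F) ⨯₃ F) = (N ⬝ᵥ F) ^ 2 - (N ⬝ᵥ N) * (F ⬝ᵥ F) := by
    simp only [vec3_dotProduct, cross_zero, cross_one, cross_two]; ring
  rw [h0, dotProduct_zero, h] at h1
  have := mul_pos (dotProduct_self_pos hN) (dotProduct_self_pos hF)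
  linarith

theorem mem_halfPlane_of_dot_nonneg {N F A x : Space} (hN : N ≠ 0) (hF : F ≠ 0) (h : N ⬝ᵥ F = 0)
    (hx : N ⬝ᵥ (x - A) = 0) (h0 : 0 ≤ F ⬝ᵥ (x - A)) : x ∈ halfPlane A (N ⨯₃ F) F := by
  obtain ⟨α, β, hαβ⟩ := exists_eq_smul_add_smul_cross hN hF h hx
  have hFF := dotProduct_self_pos hF
  have h1 : F ⬝ᵥ (x - A) = α * (F ⬝ᵥ F) := by
    rw [hαβ, dotProduct_add, dotProduct_smul, dotProduct_smul, dot_cross_self, smul_zero,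
      add_zero, smul_eq_mul]
  refine ⟨β, α, ?_, ?_⟩
  · rw [h1] at h0
    exact nonneg_of_mul_nonneg_left h0 hFF
  · rw [sub_eq_iff_eq_add.1 hαβ]; module

theorem dot_of_mem_halfPlane {N F A x : Space} (h : N ⬝ᵥ F = 0) (hx : x ∈ halfPlane A (N ⨯₃ F) F) :
    N ⬝ᵥ (x - A) = 0 ∧ 0 ≤ F ⬝ᵥ (x - A) := by
  obtain ⟨s, t, ht, rfl⟩ := hx
  have e : A + s • (N ⨯₃ F) + t • F - A = s • (N ⨯₃ F) + t • F := by module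
  rw [e]
  constructor
  · rw [dotProduct_add, dotProduct_smul, dotProduct_smul, h, dot_self_cross]; simp
  · rw [dotProduct_add, dotProduct_smul, dotProduct_smul, dot_cross_self, smul_zero, zero_add,
      smul_eq_mul]
    refine mul_nonneg ht ?_
    rw [vec3_dotProduct]
    nlinarith [sq_nonneg (F 0), sq_nonneg (F 1), sq_nonneg (F 2)]

/-- One half-plane for each facial triangle, whose normal vector satisfies the inequalities,
carves the polytope. -/
theorem IsTriangulatedPolytope.carves_of_cuts (hP : IsTriangulatedPolytope P T)
    {θ : Fin n → Fin 3 → ℝ} (hθ : ∀ j k, IsNextAngle T j k (θ j k)) {κ : Fin n → Fin 3}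
    {F : Fin n → Space} (hF : ∀ i, InCone (T i) (κ i) (F i))
    (hcut : ∀ i j k z, IsCut T θ i (T i (κ i)) j k z → F i ⬝ᵥ z ≤ 0) :
    (∀ i, LinearIndependent ℝ ![normal (T i) ⨯₃ F i, F i]) ∧
      Carves (Set.range fun i => halfPlane (T i (κ i)) (normal (T i) ⨯₃ F i) (F i)) P := by
  have hF0 : ∀ i, F i ≠ 0 := fun i => (hF i).ne_zero (hP.normal_ne_zero i)
  refine ⟨fun i => linearIndependent_of_orthogonal (hP.normal_ne_zero i) (hF0 i)
    (hF i).normal_dot, hP.carves ?_ ?_⟩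
  · rw [hP.frontier_eq]
    refine Set.iUnion_subset fun i x hx => ⟨_, ⟨i, rfl⟩, ?_⟩
    exact mem_halfPlane_of_dot_nonneg (hP.normal_ne_zero i) (hF0 i) (hF i).normal_dot
      (normal_dot_of_mem hx _) ((hF i).dot_nonneg (hP.normal_ne_zero i) hx)
  · rw [Set.disjoint_left]
    rintro x ⟨_, ⟨i, rfl⟩, hx⟩ hxP
    have h1 := dot_of_mem_halfPlane (hF i).normal_dot hx
    rw [normal_dot_sub_vertex _ _ _ 0] at h1
    have := hP.dot_neg_of_cuts hθ (hcut i) (hF0 i) (hF i).normal_dot hxP h1.1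
    linarith [h1.2]

end Polytope

/-! ### Carveability gives a half-plane for each facial triangle -/

theorem mem_halfPlane_iff {p u v x : Space} (hm : u ⨯₃ v ≠ 0) (hx : (u ⨯₃ v) ⬝ᵥ (x - p) = 0) :
    x ∈ halfPlane p u v ↔ 0 ≤ ((u ⨯₃ v) ⨯₃ u) ⬝ᵥ (x - p) := by
  have hM := dotProduct_self_pos hm
  constructor
  · rintro ⟨s, t, ht, rfl⟩
    have e : p + s • u + t • v - p = s • u + t • v := by module
    have : ((u ⨯₃ v) ⨯₃ u) ⬝ᵥ (s • u + t • v) = t * ((u ⨯₃ v) ⬝ᵥ (u ⨯₃ v)) := by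
      simp only [vec3_dotProduct, cross_zero, cross_one, cross_two, Pi.add_apply, Pi.smul_apply,
        smul_eq_mul]
      ring
    rw [e, this]
    positivity
  · intro h
    have h1 := cross_decomposition u v (x - p)
    rw [hx, zero_smul, add_zero] at h1
    refine ⟨((v ⨯₃ (u ⨯₃ v)) ⬝ᵥ (x - p)) / ((u ⨯₃ v) ⬝ᵥ (u ⨯₃ v)),
      (((u ⨯₃ v) ⨯₃ u) ⬝ᵥ (x - p)) / ((u ⨯₃ v) ⬝ᵥ (u ⨯₃ v)), by positivity, ?_⟩
    rw [div_eq_inv_mul, div_eq_inv_mul, mul_smul, mul_smul, add_assoc, ← smul_add, ← h1,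
      smul_smul, inv_mul_cancel₀ hM.ne', one_smul]
    module

theorem eq_zero_of_infinite_quadratic {a b c : ℝ} {S : Set ℝ} (hS : S.Infinite)
    (h : ∀ t ∈ S, a + t * b + t ^ 2 * c = 0) : a = 0 ∧ b = 0 ∧ c = 0 := by
  open Polynomial in
  have h0 : (C a + C b * X + C c * X ^ 2 : ℝ[X]) = 0 := by
    refine Polynomial.eq_zero_of_infinite_isRoot _ (hS.mono fun t ht => ?_)
    have := h t ht
    simp only [Set.mem_ofPred_eq, Polynomial.IsRoot.def, Polynomial.eval_add, Polynomial.eval_C,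
      Polynomial.eval_mul, Polynomial.eval_X, Polynomial.eval_pow]
    linarith
  have h1 := congrArg (fun p => Polynomial.coeff p 0) h0
  have h2 := congrArg (fun p => Polynomial.coeff p 1) h0
  have h3 := congrArg (fun p => Polynomial.coeff p 2) h0
  simp [Polynomial.coeff_X, Polynomial.coeff_C] at h1 h2 h3
  exact ⟨h1, h2, h3⟩

/-- Affine coordinates in the plane through `A` that is spanned by `a` and `b`. -/
def planePoint (A a b : Space) (y : ℝ × ℝ) : Space := A + y.1 • a + y.2 • b

theorem continuous_planePoint (A a b : Space) : Continuous (planePoint A a b) := by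
  unfold planePoint; fun_prop

theorem dot_planePoint_sub (A a b p m : Space) (y : ℝ × ℝ) :
    m ⬝ᵥ (planePoint A a b y - p) = m ⬝ᵥ (A - p) + y.1 * (m ⬝ᵥ a) + y.2 * (m ⬝ᵥ b) := by
  have e : planePoint A a b y - p = (A - p) + y.1 • a + y.2 • b := by unfold planePoint; module
  rw [e, dotProduct_add, dotProduct_add, dotProduct_smul, dotProduct_smul, smul_eq_mul, smul_eq_mul]

/-- If finitely many half-planes cover an open part of a plane, then one of them that meets this
part lies in the plane, so that its complement in the plane is convex. A parabola distinguishes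
the half-planes inside the plane: the others meet it in at most two points. -/
theorem exists_halfPlane_convex {W : Set (Set Space)} (hW : W.Finite)
    (hH : ∀ H ∈ W, IsHalfPlane H) (A a b : Space) {V : Set (ℝ × ℝ)} (hV : IsOpen V)
    (hne : V.Nonempty) (hsub : ∀ y ∈ V, planePoint A a b y ∈ ⋃₀ W) :
    ∃ H ∈ W, (∃ y ∈ V, planePoint A a b y ∈ H) ∧ Convex ℝ {y | planePoint A a b y ∉ H} := by
  obtain ⟨y₀, hy₀⟩ := hne
  have hc : Continuous fun t : ℝ => (y₀.1 + t, y₀.2 + t ^ 2) := by fun_prop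
  have hS : {t : ℝ | (y₀.1 + t, y₀.2 + t ^ 2) ∈ V}.Infinite := by
    refine infinite_of_mem_nhds (0 : ℝ) (hc.continuousAt.preimage_mem_nhds ?_)
    simpa using hV.mem_nhds hy₀
  obtain ⟨H, hHW, hinf⟩ : ∃ H ∈ W, {t : ℝ | (y₀.1 + t, y₀.2 + t ^ 2) ∈ V ∧
      planePoint A a b (y₀.1 + t, y₀.2 + t ^ 2) ∈ H}.Infinite := by
    by_contra! hfin
    refine hS ((hW.biUnion hfin).subset fun t ht => ?_)
    obtain ⟨H, hHW, hHt⟩ := hsub _ ht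
    exact Set.mem_biUnion hHW ⟨ht, hHt⟩
  refine ⟨H, hHW, ?_, ?_⟩
  · obtain ⟨t, ht⟩ := hinf.nonempty
    exact ⟨_, ht⟩
  obtain ⟨p, u, v, hli, rfl⟩ := hH H hHW
  have hm : u ⨯₃ v ≠ 0 := crossProduct_ne_zero_iff_linearIndependent.2 hli
  obtain ⟨h1, h2, h3⟩ := eq_zero_of_infinite_quadratic
      (a := (u ⨯₃ v) ⬝ᵥ (A - p) + y₀.1 * ((u ⨯₃ v) ⬝ᵥ a) + y₀.2 * ((u ⨯₃ v) ⬝ᵥ b))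
      (b := (u ⨯₃ v) ⬝ᵥ a) (c := (u ⨯₃ v) ⬝ᵥ b) hinf (by
    rintro t ⟨-, s, r, -, hsr⟩
    have h := dot_planePoint_sub A a b p (u ⨯₃ v) (y₀.1 + t, y₀.2 + t ^ 2)
    rw [hsr] at h
    have e : (u ⨯₃ v) ⬝ᵥ (p + s • u + r • v - p) = 0 := by
      simp only [vec3_dotProduct, cross_zero, cross_one, cross_two, Pi.add_apply, Pi.smul_apply,
        smul_eq_mul, Pi.sub_apply]
      ring
    rw [e] at h
    linarith)
  rw [h2, h3, mul_zero, mul_zero, add_zero, add_zero] at h1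
  have key : {y | planePoint A a b y ∉ halfPlane p u v} =
      {y : ℝ × ℝ | y.1 * (((u ⨯₃ v) ⨯₃ u) ⬝ᵥ a) + y.2 * (((u ⨯₃ v) ⨯₃ u) ⬝ᵥ b) <
        -(((u ⨯₃ v) ⨯₃ u) ⬝ᵥ (A - p))} := by
    ext y
    have hy : (u ⨯₃ v) ⬝ᵥ (planePoint A a b y - p) = 0 := by
      rw [dot_planePoint_sub, h1, h2, h3]; ring
    rw [Set.mem_ofPred_eq, Set.mem_ofPred_eq, mem_halfPlane_iff hm hy, dot_planePoint_sub, not_le]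
    constructor <;> intro h <;> linarith
  rw [key]
  refine convex_halfSpace_lt (f := fun y : ℝ × ℝ => y.1 * (((u ⨯₃ v) ⨯₃ u) ⬝ᵥ a) +
    y.2 * (((u ⨯₃ v) ⨯₃ u) ⬝ᵥ b)) ⟨fun x y => ?_, fun c x => ?_⟩ _
  · simp only [Prod.fst_add, Prod.snd_add]; ring
  · simp only [Prod.smul_fst, Prod.smul_snd, smul_eq_mul]; ring

theorem planePoint_bary {t : Fin 3 → Space} (ht : normal t ≠ 0) {x : Space}
    (hx : normal t ⬝ᵥ (x - t 0) = 0) :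
    planePoint (t 0) (t 1 - t 0) (t 2 - t 0) (bary t 1 x, bary t 2 x) = x := by
  have h1 := sum_bary ht x
  have h2 := sum_bary_smul ht hx
  rw [Fin.sum_univ_three] at h1 h2
  have h0 : bary t 0 x = 1 - bary t 1 x - bary t 2 x := by linarith
  rw [h0] at h2
  nth_rewrite 3 [← h2]
  unfold planePoint
  module

theorem planePoint_mem_triangle (t : Fin 3 → Space) {y : ℝ × ℝ} (h1 : 0 ≤ y.1) (h2 : 0 ≤ y.2)
    (h3 : y.1 + y.2 ≤ 1) : planePoint (t 0) (t 1 - t 0) (t 2 - t 0) y ∈ triangle t := by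
  refine mem_triangle_iff.2 ⟨![1 - y.1 - y.2, y.1, y.2], ?_, ?_, ?_⟩
  · intro k; fin_cases k <;> simp <;> linarith
  · rw [Fin.sum_univ_three]; simp
    ring
  · rw [Fin.sum_univ_three]; simp [planePoint]; module

theorem sum_cyclic {M : Type*} [AddCommMonoid M] (f : Fin 3 → M) (k : Fin 3) :
    ∑ m, f m = f k + f (k + 1) + f (k + 2) := by
  rw [Fin.sum_univ_three]
  fin_cases k
  · rfl
  · change f 0 + f 1 + f 2 = f 1 + f 2 + f 0
    rw [add_assoc, add_comm]
  · change f 0 + f 1 + f 2 = f 2 + f 0 + f 1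
    rw [add_comm, add_assoc]

section Polytope

variable {P : Set Space} {n : ℕ} {T : Fin n → Fin 3 → Space}

/-- If `P` can be carved, then the convex hull of its section by the plane of a facial triangle
does not meet the interior of the triangle, so that a line through a vertex of the triangle
separates them. -/
theorem IsTriangulatedPolytope.exists_inCone (hP : IsTriangulatedPolytope P T)
    (hc : Carveable P) (i : Fin n) :
    ∃ k F, InCone (T i) k F ∧ SectionNonpos P (T i) (T i k) F := by
  obtain ⟨W, hW, hWH, hcarve⟩ := hc
  obtain ⟨hcov, hdis⟩ := hP.of_carves hcarve
  have hN := hP.normal_ne_zero i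
  have hM := dotProduct_self_pos hN
  set φ := planePoint (T i 0) (T i 1 - T i 0) (T i 2 - T i 0) with hφ
  set Q : Set (ℝ × ℝ) := φ ⁻¹' interior P with hQ
  set U : Set (ℝ × ℝ) := {y | 0 < y.1 ∧ 0 < y.2 ∧ y.1 + y.2 < 1} with hU
  have hQo : IsOpen Q := isOpen_interior.preimage (continuous_planePoint _ _ _)
  have hUo : IsOpen U := (isOpen_lt continuous_const continuous_fst).inter
    ((isOpen_lt continuous_const continuous_snd).inter
      (isOpen_lt (continuous_fst.add continuous_snd) continuous_const))
  have hUc : Convex ℝ U := by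
    rintro x ⟨h1, h2, h3⟩ y ⟨h4, h5, h6⟩ a b ha hb hab
    have hb' : b = 1 - a := by linarith
    rcases ha.eq_or_lt with rfl | ha
    · simp only [zero_add] at hab
      subst hab
      simpa [hU] using ⟨h4, h5, h6⟩
    · refine ⟨?_, ?_, ?_⟩ <;>
      · simp only [Prod.fst_add, Prod.snd_add, Prod.smul_fst, Prod.smul_snd, smul_eq_mul]
        nlinarith
  have hdisj : Disjoint (convexHull ℝ Q) U := by
    by_contra hnd
    obtain ⟨H, hHW, ⟨y, hy, hyH⟩, hconv⟩ := exists_halfPlane_convex hW hWH (T i 0)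
      (T i 1 - T i 0) (T i 2 - T i 0) (hQo.convexHull.inter hUo)
      (Set.not_disjoint_iff_nonempty_inter.1 hnd) (fun y hy => hcov (hP.triangle_subset_frontier i
        (planePoint_mem_triangle (T i) hy.2.1.le hy.2.2.1.le hy.2.2.2.le)))
    have hQH : Q ⊆ {y | φ y ∉ H} :=
      fun z hz hzH => Set.disjoint_left.1 hdis ⟨H, hHW, hzH⟩ hz
    exact convexHull_min hQH hconv hy.1 hyH
  obtain ⟨f, u, hfQ, hfU⟩ := geometric_hahn_banach_open (convex_convexHull ℝ Q) hQo.convexHull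
    hUc hdisj
  set g : Fin 3 → ℝ := ![0, f (1, 0), f (0, 1)] with hg
  have hfy : ∀ y : ℝ × ℝ, f y = y.1 * g 1 + y.2 * g 2 := by
    intro y
    have : y = y.1 • ((1 : ℝ), (0 : ℝ)) + y.2 • ((0 : ℝ), (1 : ℝ)) := by ext <;> simp
    conv_lhs => rw [this]
    rw [map_add, map_smul, map_smul]
    simp [hg]
  -- the values of `f` at the vertices are limits of its values inside the triangle
  have hug : ∀ k, u ≤ g k := by
    have hcl : ∀ y : ℝ × ℝ, 0 ≤ y.1 → 0 ≤ y.2 → y.1 + y.2 ≤ 1 → u ≤ f y := by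
      intro y h1 h2 h3
      have hc : Continuous fun s : ℝ => f ((1 - s) • y + s • ((3⁻¹ : ℝ), (3⁻¹ : ℝ))) := by
        fun_prop
      have ht := hc.tendsto 0
      simp only [sub_zero, one_smul, zero_smul, add_zero] at ht
      refine ge_of_tendsto (ht.mono_left (nhdsWithin_le_nhds (s := Set.Ioi 0))) ?_
      filter_upwards [Ioo_mem_nhdsGT (show (0 : ℝ) < 1 by norm_num)] with s hs
      refine hfU _ ⟨?_, ?_, ?_⟩ <;>
      · simp only [Prod.fst_add, Prod.snd_add, Prod.smul_fst, Prod.smul_snd, smul_eq_mul]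
        nlinarith [hs.1, hs.2]
    have h0 := hcl (0, 0) (by simp) (by simp) (by simp)
    have h1 := hcl (1, 0) (by simp) (by simp) (by simp)
    have h2 := hcl (0, 1) (by simp) (by simp) (by simp)
    rw [show ((0 : ℝ), (0 : ℝ)) = 0 from rfl, map_zero] at h0
    intro k
    fin_cases k
    · exact h0
    · exact h1
    · exact h2
  -- the separating line is moved parallel to itself until it meets the triangle
  obtain ⟨k, hk⟩ : ∃ k, ∀ m, g k ≤ g m := Finite.exists_min g
  by_cases hzero : g (k + 1) = g k ∧ g (k + 2) = g k
  · -- the functional vanishes, so the section is empty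
    have hemp : ∀ x ∈ interior P, normal (T i) ⬝ᵥ (x - T i 0) ≠ 0 := by
      intro x hx hx0
      have hxφ := planePoint_bary hN hx0
      have := hfQ (bary (T i) 1 x, bary (T i) 2 x)
        (subset_convexHull ℝ Q (show φ _ ∈ interior P by rw [hφ, hxφ]; exact hx))
      have h00 : ∀ m, g m = 0 := by
        have h3 : g 0 = 0 := rfl
        obtain ⟨h1, h2⟩ := hzero
        fin_cases k <;> simp at h1 h2 <;> intro m <;> fin_cases m <;> simp <;> linarith
      rw [hfy, h00, h00, mul_zero, mul_zero, add_zero] at this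
      have h3 := hug 0
      rw [h00] at h3
      linarith
    exact ⟨0, coneLeft (T i) 0, ⟨1, 0, zero_le_one, le_rfl, by norm_num, by simp⟩,
      fun x hx hx0 => absurd hx0 (hemp x hx)⟩
  refine ⟨k, ((g (k + 1) - g k) / (normal (T i) ⬝ᵥ normal (T i))) • coneLeft (T i) k +
    ((g (k + 2) - g k) / (normal (T i) ⬝ᵥ normal (T i))) • coneRight (T i) k,
    ⟨_, _, div_nonneg (sub_nonneg.2 (hk _)) hM.le, div_nonneg (sub_nonneg.2 (hk _)) hM.le, ?_,
      rfl⟩, ?_⟩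
  · rw [← add_div]
    refine div_pos (lt_of_le_of_ne (add_nonneg (sub_nonneg.2 (hk _)) (sub_nonneg.2 (hk _))) ?_) hM
    intro h0
    have h1 := hk (k + 1)
    have h2 := hk (k + 2)
    exact hzero ⟨by linarith, by linarith⟩
  · intro x hx hx0
    have hxφ := planePoint_bary hN hx0
    have h1 := hfQ (bary (T i) 1 x, bary (T i) 2 x)
      (subset_convexHull ℝ Q (show φ _ ∈ interior P by rw [hφ, hxφ]; exact hx))
    rw [hfy] at h1
    have hs := sum_bary hN x
    have hsm := sum_bary_smul hN hx0
    have e : x - T i k = bary (T i) (k + 1) x • (T i (k + 1) - T i k) +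
        bary (T i) (k + 2) x • (T i (k + 2) - T i k) := by
      rw [sum_cyclic _ k] at hs
      have h0 : bary (T i) k x = 1 - bary (T i) (k + 1) x - bary (T i) (k + 2) x := by linarith
      rw [sum_cyclic _ k, h0] at hsm
      rw [sub_eq_iff_eq_add]
      nth_rewrite 1 [← hsm]
      module
    rw [e]
    simp only [add_dotProduct, smul_dotProduct, dotProduct_add, dotProduct_smul,
      (coneLeft_dot (T i) k).1, (coneLeft_dot (T i) k).2, (coneRight_dot (T i) k).1,
      (coneRight_dot (T i) k).2, smul_eq_mul, mul_zero, add_zero, zero_add]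
    have e2 : bary (T i) (k + 1) x * ((g (k + 1) - g k) / (normal (T i) ⬝ᵥ normal (T i)) *
        (normal (T i) ⬝ᵥ normal (T i))) + bary (T i) (k + 2) x * ((g (k + 2) - g k) /
        (normal (T i) ⬝ᵥ normal (T i)) * (normal (T i) ⬝ᵥ normal (T i))) =
        (∑ m, bary (T i) m x * g m) - g k := by
      rw [div_mul_cancel₀ _ hM.ne', div_mul_cancel₀ _ hM.ne', sum_cyclic _ k]
      rw [sum_cyclic _ k] at hs
      linear_combination (-g k) * hs
    have e3 : ∑ m, bary (T i) m x * g m = bary (T i) 1 x * g 1 + bary (T i) 2 x * g 2 := by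
      rw [Fin.sum_univ_three, show g 0 = 0 from rfl]; ring
    have := hug k
    linarith

end Polytope

/-! ### Programs with counting loops -/

/-- Programs whose only loops run a counter through the input size, which is kept in cell `0` of
the integer array `0`: in `each v c`, the counter is cell `0` of the integer array `v`. -/
inductive Routine : Type
  | skip
  | setN (a : ℕ) (i e : NExp)
  | setR (a : ℕ) (i : NExp) (e : RExp)
  | seq (c d : Routine)
  | cond (b : BExp) (c d : Routine)
  | each (v : ℕ) (c : Routine)

namespace Routine

/-- Translation into the language of the real RAM. -/
def compile : Routine → Program
  | skip => .skip
  | setN a i e => .setN a i e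
  | setR a i e => .setR a i e
  | seq c d => .seq c.compile d.compile
  | cond b c d => .cond b c.compile d.compile
  | each v c => .seq (.setN v (.const 0) (.const 0))
      (.loop (.ltN (.get v (.const 0)) (.get 0 (.const 0)))
        (.seq c.compile (.setN v (.const 0) (.add (.get v (.const 0)) (.const 1)))))

open Classical in
/-- The effect of a routine on the memory. -/
noncomputable def exec : Routine → Memory → Memory
  | skip, s => s
  | setN a i e, s => s.setNat a (i.eval s) (e.eval s)
  | setR a i e, s => s.setReal a (i.eval s) (e.eval s)
  | seq c d, s => d.exec (c.exec s)
  | cond b c d, s => if b.Holds s then c.exec s else d.exec s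
  | each v c, s => (fun s' => (c.exec s').setNat v 0 (s'.nat v 0 + 1))^[s.nat 0 0] (s.setNat v 0 0)

/-- The routine contains an assignment to the integer array `a`. -/
def writesNat (a : ℕ) : Routine → Bool
  | skip => false
  | setN b _ _ => a == b
  | setR _ _ _ => false
  | seq c d => c.writesNat a || d.writesNat a
  | cond _ c d => c.writesNat a || d.writesNat a
  | each v c => a == v || c.writesNat a

/-- The routine contains an assignment to the real array `a`. -/
def writesReal (a : ℕ) : Routine → Bool
  | skip => false
  | setN _ _ _ => false
  | setR b _ _ => a == b
  | seq c d => c.writesReal a || d.writesReal a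
  | cond _ c d => c.writesReal a || d.writesReal a
  | each _ c => c.writesReal a

/-- No loop assigns to its own counter. -/
def WellFormed : Routine → Bool
  | seq c d => c.WellFormed && d.WellFormed
  | cond _ c d => c.WellFormed && d.WellFormed
  | each v c => !c.writesNat v && c.WellFormed
  | _ => true

/-- The depth to which loops are nested. -/
def depth : Routine → ℕ
  | seq c d => max c.depth d.depth
  | cond _ c d => max c.depth d.depth
  | each _ c => c.depth + 1
  | _ => 0

/-- An upper bound for the running time on inputs of size `n`. -/
def time (n : ℕ) : Routine → ℕ
  | skip => 1
  | setN _ i e => i.cost + e.cost + 1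
  | setR _ i e => i.cost + e.cost + 1
  | seq c d => c.time n + d.time n
  | cond b c d => b.cost + (c.time n + d.time n) + 1
  | each _ c => n * (c.time n + 12) + 9

theorem exec_nat (c : Routine) {a : ℕ} (h : c.writesNat a = false) (s : Memory) :
    (c.exec s).nat a = s.nat a := by
  induction c generalizing s with
  | skip => rfl
  | setN b i e =>
    have : a ≠ b := by simpa [writesNat] using h
    simp [exec, Memory.setNat, this]
  | setR b i e => rfl
  | seq c d ihc ihd =>
    simp only [writesNat, Bool.or_eq_false_iff] at h
    rw [exec, ihd h.2, ihc h.1]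
  | cond b c d ihc ihd =>
    simp only [writesNat, Bool.or_eq_false_iff] at h
    rw [exec]
    split
    · exact ihc h.1 s
    · exact ihd h.2 s
  | each v c ih =>
    simp only [writesNat, Bool.or_eq_false_iff, beq_eq_false_iff_ne] at h
    rw [exec]
    generalize s.nat 0 0 = m
    have h0 : (s.setNat v 0 0).nat a = s.nat a := by simp [Memory.setNat, h.1]
    rw [← h0]
    generalize s.setNat v 0 0 = s'
    induction m generalizing s' with
    | zero => rfl
    | succ m ihm =>
      rw [Function.iterate_succ_apply, ihm]
      simp only [Memory.setNat, Function.update_of_ne h.1]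
      exact ih h.2 s'

theorem exec_real (c : Routine) {a : ℕ} (h : c.writesReal a = false) (s : Memory) :
    (c.exec s).real a = s.real a := by
  induction c generalizing s with
  | skip => rfl
  | setN b i e => rfl
  | setR b i e =>
    have : a ≠ b := by simpa [writesReal] using h
    simp [exec, Memory.setReal, this]
  | seq c d ihc ihd =>
    simp only [writesReal, Bool.or_eq_false_iff] at h
    rw [exec, ihd h.2, ihc h.1]
  | cond b c d ihc ihd =>
    simp only [writesReal, Bool.or_eq_false_iff] at h
    rw [exec]
    split
    · exact ihc h.1 s
    · exact ihd h.2 s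
  | each v c ih =>
    rw [exec]
    generalize s.nat 0 0 = m
    have h0 : (s.setNat v 0 0).real a = s.real a := rfl
    rw [← h0]
    generalize s.setNat v 0 0 = s'
    induction m generalizing s' with
    | zero => rfl
    | succ m ihm =>
      rw [Function.iterate_succ_apply, ihm]
      exact ih h s'

theorem runs_compile (c : Routine) (hw : c.WellFormed = true) (h0 : c.writesNat 0 = false)
    (s : Memory) : ∃ t, t ≤ c.time (s.nat 0 0) ∧ Runs c.compile s t (c.exec s) := by
  induction c generalizing s with
  | skip => exact ⟨_, le_rfl, Runs.skip s⟩
  | setN a i e => exact ⟨_, le_rfl, Runs.setN a i e s⟩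
  | setR a i e => exact ⟨_, le_rfl, Runs.setR a i e s⟩
  | seq c d ihc ihd =>
    simp only [writesNat, Bool.or_eq_false_iff] at h0
    simp only [WellFormed, Bool.and_eq_true] at hw
    obtain ⟨t, ht, hr⟩ := ihc hw.1 h0.1 s
    obtain ⟨t', ht', hr'⟩ := ihd hw.2 h0.2 (c.exec s)
    rw [exec_nat c h0.1] at ht'
    exact ⟨t + t', add_le_add ht ht', hr.seq hr'⟩
  | cond b c d ihc ihd =>
    simp only [writesNat, Bool.or_eq_false_iff] at h0
    simp only [WellFormed, Bool.and_eq_true] at hw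
    obtain ⟨t, ht, hr⟩ := ihc hw.1 h0.1 s
    obtain ⟨t', ht', hr'⟩ := ihd hw.2 h0.2 s
    simp only [exec, compile, time]
    split
    · next hb => exact ⟨_, by omega, Runs.condTrue hb hr⟩
    · next hb => exact ⟨_, by omega, Runs.condFalse hb hr'⟩
  | each v c ih =>
    simp only [writesNat, Bool.or_eq_false_iff, beq_eq_false_iff_ne] at h0
    simp only [WellFormed, Bool.and_eq_true, Bool.not_eq_true'] at hw
    have hv : (0 : ℕ) ≠ v := h0.1
    have hloop : ∀ m (s : Memory), s.nat v 0 + m = s.nat 0 0 →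
        ∃ t, t ≤ m * (c.time (s.nat 0 0) + 12) + 6 ∧
          Runs (.loop (.ltN (.get v (.const 0)) (.get 0 (.const 0)))
            (.seq c.compile (.setN v (.const 0) (.add (.get v (.const 0)) (.const 1))))) s t
            ((fun s' => (c.exec s').setNat v 0 (s'.nat v 0 + 1))^[m] s) := by
      intro m
      induction m with
      | zero =>
        intro s hs
        refine ⟨_, ?_, Runs.loopFalse ?_⟩
        · simp [BExp.cost, NExp.cost]
        · simp only [BExp.Holds, NExp.eval]; omega
      | succ m ihm =>
        intro s hs
        obtain ⟨t, ht, hr⟩ := ih hw.2 h0.2 s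
        set s' := (c.exec s).setNat v 0 (s.nat v 0 + 1) with hs'
        have e0 : s'.nat 0 = s.nat 0 := by
          rw [hs']; simp only [Memory.setNat, Function.update_of_ne hv, exec_nat c h0.2]
        have ev : s'.nat v 0 = s.nat v 0 + 1 := by rw [hs']; simp [Memory.setNat]
        obtain ⟨t', ht', hr'⟩ := ihm s' (by rw [e0, ev]; omega)
        have hset := Runs.setN v (.const 0) (.add (.get v (.const 0)) (.const 1)) (c.exec s)
        simp only [NExp.eval, exec_nat c hw.1, ← hs'] at hset
        refine ⟨_, ?_, Runs.loopTrue ?_ (hr.seq hset) hr'⟩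
        · rw [e0] at ht'
          simp only [BExp.cost, NExp.cost]
          have : (m + 1) * (c.time (s.nat 0 0) + 12) =
            m * (c.time (s.nat 0 0) + 12) + (c.time (s.nat 0 0) + 12) := by ring
          omega
        · simp only [BExp.Holds, NExp.eval]; omega
    have e0 : (s.setNat v 0 0).nat 0 = s.nat 0 := by simp [Memory.setNat, hv]
    obtain ⟨t, ht, hr⟩ := hloop (s.nat 0 0) (s.setNat v 0 0) (by rw [e0]; simp [Memory.setNat])
    rw [e0] at ht
    refine ⟨_, ?_, (Runs.setN v (.const 0) (.const 0) s).seq hr⟩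
    simp only [NExp.cost, time]
    omega

theorem exists_time_le (c : Routine) : ∃ C, ∀ n, c.time n ≤ C * (n + 1) ^ c.depth := by
  have hpow : ∀ n k m : ℕ, k ≤ m → (n + 1) ^ k ≤ (n + 1) ^ m := fun n k m h =>
    Nat.pow_le_pow_right (Nat.succ_pos n) h
  induction c with
  | skip => exact ⟨1, fun n => by simp [time, depth]⟩
  | setN a i e => exact ⟨i.cost + e.cost + 1, fun n => by simp [time, depth]⟩
  | setR a i e => exact ⟨i.cost + e.cost + 1, fun n => by simp [time, depth]⟩
  | seq c d ihc ihd =>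
    obtain ⟨C, hC⟩ := ihc
    obtain ⟨D, hD⟩ := ihd
    refine ⟨C + D, fun n => ?_⟩
    rw [time, depth, add_mul]
    exact add_le_add ((hC n).trans (Nat.mul_le_mul_left _ (hpow _ _ _ (le_max_left _ _))))
      ((hD n).trans (Nat.mul_le_mul_left _ (hpow _ _ _ (le_max_right _ _))))
  | cond b c d ihc ihd =>
    obtain ⟨C, hC⟩ := ihc
    obtain ⟨D, hD⟩ := ihd
    refine ⟨C + D + (b.cost + 1), fun n => ?_⟩
    have h1 := (hC n).trans (Nat.mul_le_mul_left C (hpow n _ _ (le_max_left c.depth d.depth)))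
    have h2 := (hD n).trans (Nat.mul_le_mul_left D (hpow n _ _ (le_max_right c.depth d.depth)))
    have h3 : (b.cost + 1) * 1 ≤ (b.cost + 1) * (n + 1) ^ max c.depth d.depth :=
      Nat.mul_le_mul_left _ (Nat.one_le_pow _ _ (Nat.succ_pos n))
    rw [time, depth, add_mul, add_mul]
    omega
  | each v c ih =>
    obtain ⟨C, hC⟩ := ih
    refine ⟨C + 21, fun n => ?_⟩
    have h1 := hC n
    have h2 : 1 ≤ (n + 1) ^ c.depth := Nat.one_le_pow _ _ (Nat.succ_pos n)
    rw [time, depth, pow_succ]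
    calc n * (c.time n + 12) + 9 ≤ n * (C * (n + 1) ^ c.depth + 12 * (n + 1) ^ c.depth) +
          9 * (n + 1) ^ c.depth := by gcongr <;> omega
      _ ≤ (n + 1) * (C * (n + 1) ^ c.depth + 12 * (n + 1) ^ c.depth) +
          9 * ((n + 1) ^ c.depth * (n + 1)) := by
        gcongr
        · omega
        · exact Nat.le_mul_of_pos_right _ (Nat.succ_pos n)
      _ = (C + 21) * ((n + 1) ^ c.depth * (n + 1)) := by ring

/-- The second memory differs from the first one only in the counter `v` and in arrays to which the
routine assigns. -/
structure Frame (v : ℕ) (c : Routine) (s s' : Memory) : Prop where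
  nat : ∀ a, a ≠ v → c.writesNat a = false → s'.nat a = s.nat a
  real : ∀ a, c.writesReal a = false → s'.real a = s.real a

/-- Invariants of counting loops. -/
theorem exec_each {v : ℕ} {c : Routine} {s : Memory} (Inv : ℕ → Memory → Prop)
    (h0 : Inv 0 (s.setNat v 0 0))
    (hstep : ∀ m < s.nat 0 0, ∀ s', Frame v c s s' → s'.nat v 0 = m → Inv m s' →
      Inv (m + 1) ((c.exec s').setNat v 0 (m + 1))) :
    Inv (s.nat 0 0) ((each v c).exec s) := by
  rw [exec]
  have key : ∀ m ≤ s.nat 0 0, Frame v c s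
      ((fun s' => (c.exec s').setNat v 0 (s'.nat v 0 + 1))^[m] (s.setNat v 0 0)) ∧
      ((fun s' => (c.exec s').setNat v 0 (s'.nat v 0 + 1))^[m] (s.setNat v 0 0)).nat v 0 = m ∧
      Inv m ((fun s' => (c.exec s').setNat v 0 (s'.nat v 0 + 1))^[m] (s.setNat v 0 0)) := by
    intro m
    induction m with
    | zero =>
      intro _
      exact ⟨⟨fun a ha _ => by simp [Memory.setNat, ha], fun a _ => rfl⟩, by simp [Memory.setNat],
        h0⟩
    | succ m ih =>
      intro hm
      obtain ⟨hf, hv, hi⟩ := ih (by omega)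
      rw [Function.iterate_succ_apply']
      generalize (fun s' => (c.exec s').setNat v 0 (s'.nat v 0 + 1))^[m] (s.setNat v 0 0) = s'
        at hf hv hi
      refine ⟨⟨fun a ha hw => ?_, fun a hw => ?_⟩, by simp [Memory.setNat, hv], ?_⟩
      · simp only [Memory.setNat, Function.update_of_ne ha]
        rw [exec_nat c hw, hf.nat a ha hw]
      · exact (exec_real c hw s').trans (hf.real a hw)
      · simp only [hv]
        exact hstep m (by omega) s' hf hv hi
  exact (key _ le_rfl).2.2

end Routine

@[simp] theorem Memory.setNat_nat_self (s : Memory) (a i k : ℕ) : (s.setNat a i k).nat a i = k := by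
  simp [Memory.setNat]

theorem Memory.setNat_nat_of_ne (s : Memory) {a b : ℕ} (h : b ≠ a) (i k : ℕ) :
    (s.setNat a i k).nat b = s.nat b := by
  simp [Memory.setNat, h]

@[simp] theorem Memory.setNat_real (s : Memory) (a i k : ℕ) : (s.setNat a i k).real = s.real := rfl

@[simp] theorem Memory.setReal_real_self (s : Memory) (a i : ℕ) (r : ℝ) :
    (s.setReal a i r).real a i = r := by
  simp [Memory.setReal]

theorem Memory.setReal_real_of_index_ne (s : Memory) (a : ℕ) {i j : ℕ} (h : j ≠ i) (r : ℝ) :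
    (s.setReal a i r).real a j = s.real a j := by
  simp [Memory.setReal, h]

/-! ### Expressions for vectors and tests -/

/-- Vectors of real expressions. -/
abbrev VExp : Type := Fin 3 → RExp

namespace VExp

/-- The value of a vector of expressions. -/
noncomputable def eval (s : Memory) (u : VExp) : Space := fun k => (u k).eval s

def add (u v : VExp) : VExp := fun k => .add (u k) (v k)

def sub (u v : VExp) : VExp := fun k => .sub (u k) (v k)

def smul (e : RExp) (u : VExp) : VExp := fun k => .mul e (u k)

def dot (u v : VExp) : RExp :=
  .add (.add (.mul (u 0) (v 0)) (.mul (u 1) (v 1))) (.mul (u 2) (v 2))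

def cross (u v : VExp) : VExp :=
  ![.sub (.mul (u 1) (v 2)) (.mul (u 2) (v 1)), .sub (.mul (u 2) (v 0)) (.mul (u 0) (v 2)),
    .sub (.mul (u 0) (v 1)) (.mul (u 1) (v 0))]

/-- The vector in the first three cells of the real array `a`. -/
def cells (a : ℕ) : VExp := fun k => .get a (.const k)

/-- The normal vector of a triangle. -/
def normal (t : Fin 3 → VExp) : VExp := cross (sub (t 1) (t 0)) (sub (t 2) (t 0))

variable (s : Memory) (u v : VExp) (e : RExp)

theorem eval_add : (add u v).eval s = u.eval s + v.eval s := rfl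

theorem eval_sub : (sub u v).eval s = u.eval s - v.eval s := rfl

theorem eval_smul : (smul e u).eval s = e.eval s • u.eval s := rfl

theorem eval_dot : (dot u v).eval s = u.eval s ⬝ᵥ v.eval s := by
  rw [vec3_dotProduct]; rfl

theorem eval_cross : (cross u v).eval s = u.eval s ⨯₃ v.eval s := by
  ext k
  fin_cases k
  · simp only [Fin.zero_eta, cross_zero]; rfl
  · simp only [Fin.mk_one, cross_one]; rfl
  · simp only [Fin.reduceFinMk, cross_two]; rfl

theorem eval_normal (t : Fin 3 → VExp) :
    (normal t).eval s = Carving.normal fun k => (t k).eval s := by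
  simp only [normal, Carving.normal, eval_cross, eval_sub]

end VExp

namespace BExp

def or (b c : BExp) : BExp := .not (.and (.not b) (.not c))

/-- Conjunction over the three indices. -/
def all (f : Fin 3 → BExp) : BExp := .and (.and (f 0) (f 1)) (f 2)

def pos (e : RExp) : BExp := .ltR (.const 0) e

def neg (e : RExp) : BExp := .ltR e (.const 0)

def isZero (e : RExp) : BExp := .and (.not (pos e)) (.not (neg e))

/-- Equality of vectors. -/
def eqV (u v : VExp) : BExp := all fun k => isZero (.sub (u k) (v k))

variable (s : Memory)

theorem holds_and (b c : BExp) : (BExp.and b c).Holds s ↔ b.Holds s ∧ c.Holds s := Iff.rfl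

theorem holds_not (b : BExp) : (BExp.not b).Holds s ↔ ¬ b.Holds s := Iff.rfl

theorem holds_or (b c : BExp) : (or b c).Holds s ↔ b.Holds s ∨ c.Holds s := by
  simp only [or, Holds]; tauto

theorem holds_all (f : Fin 3 → BExp) : (all f).Holds s ↔ ∀ k, (f k).Holds s := by
  simp only [all, Holds, Fin.forall_fin_succ, Fin.forall_fin_zero_pi, Fin.succ_zero_eq_one,
    Fin.succ_one_eq_two, IsEmpty.forall_iff, and_true, and_assoc]

theorem holds_pos (e : RExp) : (pos e).Holds s ↔ 0 < e.eval s := by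
  simp [pos, Holds, RExp.eval]

theorem holds_neg (e : RExp) : (neg e).Holds s ↔ e.eval s < 0 := by
  simp [neg, Holds, RExp.eval]

theorem holds_isZero (e : RExp) : (isZero e).Holds s ↔ e.eval s = 0 := by
  rw [isZero, holds_and, holds_not, holds_not, holds_pos, holds_neg, not_lt, not_lt]
  exact ⟨fun h => le_antisymm h.1 h.2, fun h => ⟨h.le, h.ge⟩⟩

theorem holds_eqV (u v : VExp) : (eqV u v).Holds s ↔ u.eval s = v.eval s := by
  rw [eqV, holds_all, funext_iff]
  simp only [holds_isZero, RExp.eval, sub_eq_zero]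
  rfl

end BExp

namespace Routine

/-- The routines `f 0`, `f 1`, `f 2`, one after the other. -/
def seq3 (f : Fin 3 → Routine) : Routine := seq (f 0) (seq (f 1) (f 2))

/-- Store a vector in three consecutive cells of the real array `a`. -/
def store (a : ℕ) (b : NExp) (u : VExp) : Routine := seq3 fun k => setR a (.add b (.const k)) (u k)

/-- If neither the index nor the vector depends on the array `a`, then `store` is a simultaneous
assignment. -/
theorem exec_store {a : ℕ} {b : NExp} {u : VExp} {s : Memory} {B : ℕ} {w : Space}
    (hb : ∀ f : ℕ → ℝ, b.eval ⟨s.nat, Function.update s.real a f⟩ = B)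
    (hu : ∀ f : ℕ → ℝ, u.eval ⟨s.nat, Function.update s.real a f⟩ = w) :
    (∀ k : Fin 3, ((store a b u).exec s).real a (B + k) = w k) ∧
      (∀ m, (m < B ∨ B + 3 ≤ m) → ((store a b u).exec s).real a m = s.real a m) := by
  have hs : ∀ f : ℕ → ℕ → ℝ, f = s.real → (⟨s.nat, f⟩ : Memory) = s := by rintro f rfl; rfl
  have key : (store a b u).exec s = ((s.setReal a (B + 0) (w 0)).setReal a (B + 1)
      (w 1)).setReal a (B + 2) (w 2) := by
    have h0 : b.eval s = B := by simpa using hb (s.real a)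
    have h0' : u.eval s = w := by simpa using hu (s.real a)
    have h1 := hb (Function.update (s.real a) (B + 0) (w 0))
    have h1' := hu (Function.update (s.real a) (B + 0) (w 0))
    have h2 := hb (Function.update (Function.update (s.real a) (B + 0) (w 0)) (B + 1) (w 1))
    have h2' := hu (Function.update (Function.update (s.real a) (B + 0) (w 0)) (B + 1) (w 1))
    have e1 : ∀ (k : Fin 3) (s' : Memory), b.eval s' = B → u.eval s' = w →
        (setR a (.add b (.const k)) (u k)).exec s' = s'.setReal a (B + k) (w k) := by
      intro k s' h h'
      rw [← h']
      simp only [exec, NExp.eval, h]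
      rfl
    simp only [store, seq3, exec.eq_4]
    rw [e1 0 s h0 h0', e1 1, e1 2]
    · rfl
    · simpa [Memory.setReal] using h2
    · simpa [Memory.setReal] using h2'
    · simpa [Memory.setReal] using h1
    · simpa [Memory.setReal] using h1'
  rw [key]
  constructor
  · intro k
    fin_cases k <;> simp [Memory.setReal]
  · intro m hm
    have n0 : m ≠ B := by omega
    have n1 : m ≠ B + 1 := by omega
    have n2 : m ≠ B + 2 := by omega
    simp [Memory.setReal, n0, n1, n2]

end Routine

/-! ### Expressions for the geometric notions -/

/-- The content of cell `0` of the integer array `v`, where counters are kept. -/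
def NExp.cell (v : ℕ) : NExp := .get v (.const 0)

/-- The product by three. -/
def NExp.triple (e : NExp) : NExp := .add e (.add e e)

/-- The vertex `j` of the facial triangle whose number is in the counter `v`. -/
def VExp.vertex (v : ℕ) (j : Fin 3) : VExp := fun k =>
  .get 0 (.add (NExp.triple (NExp.triple (NExp.cell v))) (.const (3 * j + k)))

/-- The memory holds the input `T`. -/
structure HasInput {n : ℕ} (T : Fin n → Fin 3 → Space) (s : Memory) : Prop where
  nat : s.nat 0 0 = n
  real : s.real 0 = (inputMemory T).real 0

section Formulas

variable {n : ℕ} {T : Fin n → Fin 3 → Space} {s : Memory}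

theorem HasInput.exec (h : HasInput T s) (c : Routine) (h1 : c.writesNat 0 = false)
    (h2 : c.writesReal 0 = false) : HasInput T (c.exec s) :=
  ⟨by rw [c.exec_nat h1, h.nat], by rw [c.exec_real h2, h.real]⟩

theorem HasInput.update (h : HasInput T s) {a : ℕ} (ha : a ≠ 0) (f : ℕ → ℝ) :
    HasInput T ⟨s.nat, Function.update s.real a f⟩ where
  nat := h.nat
  real := by
    rw [← h.real]
    exact Function.update_of_ne ha.symm f s.real

theorem HasInput.eval_vertex (h : HasInput T s) {v : ℕ} {i : Fin n} (hi : s.nat v 0 = i)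
    (j : Fin 3) : (VExp.vertex v j).eval s = T i j := by
  ext k
  have e : (VExp.vertex v j).eval s k = s.real 0 (9 * i + (3 * j + k)) := by
    simp only [VExp.eval, VExp.vertex, RExp.eval, NExp.eval, NExp.triple, NExp.cell, hi]
    congr 1; ring
  have hj := j.isLt
  have hk := k.isLt
  have h1 : (9 * (i : ℕ) + (3 * j + k)) / 9 = i := by omega
  have h2 : Fin.ofNat 3 ((9 * (i : ℕ) + (3 * j + k)) % 9 / 3) = j := by
    ext; simp only [Fin.val_ofNat]; omega
  have h3 : Fin.ofNat 3 ((9 * (i : ℕ) + (3 * j + k)) % 3) = k := by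
    ext; simp only [Fin.val_ofNat]; omega
  rw [e, h.real]
  simp only [inputMemory, h1, h2, h3, true_and, Fin.isLt, dite_true]

/-- The test `LexPos`. -/
def BExp.lexPos (u : VExp) : BExp :=
  .or (.pos (u 2)) (.and (.not (.neg (u 2))) (.or (.pos (u 1)) (.and (.not (.neg (u 1)))
    (.pos (u 0)))))

theorem BExp.holds_lexPos (u : VExp) : (BExp.lexPos u).Holds s ↔ LexPos (u.eval s) := by
  simp only [BExp.lexPos, BExp.holds_or, BExp.holds_and, BExp.holds_not, BExp.holds_pos,
    BExp.holds_neg]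
  rfl

/-- The test `RayHits`. -/
def BExp.rayHits (x : VExp) (t : Fin 3 → VExp) : BExp :=
  .all fun k => .lexPos (.smul (VExp.dot (.sub (t 0) x) (.cross (.sub (t 1) x) (.sub (t 2) x)))
    (.cross (.sub (t (k + 1)) x) (.sub (t (k + 2)) x)))

theorem BExp.holds_rayHits (x : VExp) (t : Fin 3 → VExp) :
    (BExp.rayHits x t).Holds s ↔ RayHits (x.eval s) fun k => (t k).eval s := by
  simp only [BExp.rayHits, RayHits, BExp.holds_all, BExp.holds_lexPos, VExp.eval_smul,
    VExp.eval_dot, VExp.eval_cross, VExp.eval_sub]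

/-- The centroid of the triangle in the counter `v`. -/
def VExp.centroid (v : ℕ) : VExp :=
  .smul (.div (.const 1) (.const 3)) (.add (.add (.vertex v 0) (.vertex v 1)) (.vertex v 2))

theorem HasInput.eval_centroid (h : HasInput T s) {v : ℕ} {i : Fin n} (hi : s.nat v 0 = i) :
    (VExp.centroid v).eval s = (3⁻¹ : ℝ) • (T i 0 + T i 1 + T i 2) := by
  simp [VExp.centroid, VExp.eval_smul, VExp.eval_add, h.eval_vertex hi, RExp.eval]

/-- The test `HasEdge`. -/
def BExp.hasEdge (a b : VExp) (t : Fin 3 → VExp) (k : Fin 3) : BExp :=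
  .or (.and (.eqV (t k) a) (.eqV (t (k + 1)) b)) (.and (.eqV (t k) b) (.eqV (t (k + 1)) a))

theorem BExp.holds_hasEdge (a b : VExp) (t : Fin 3 → VExp) (k : Fin 3) :
    (BExp.hasEdge a b t k).Holds s ↔ HasEdge (a.eval s) (b.eval s) (fun k => (t k).eval s) k := by
  simp only [BExp.hasEdge, HasEdge, BExp.holds_or, BExp.holds_and, BExp.holds_eqV]

/-- The four cases of the definition of the diamond angle of `(X, Y)`, where `f` is applied to the
expression for the angle. The language has no conditional real expressions. -/
def angleCases {α : Type} (ite : BExp → α → α → α) (X Y : RExp) (f : RExp → α) : α :=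
  ite (.neg Y)
    (ite (.neg X) (f (.add (.const 3) (.div X (.sub (.sub (.const 0) X) Y))))
      (f (.add (.const 3) (.div X (.sub X Y)))))
    (ite (.neg X) (f (.sub (.const 1) (.div X (.sub Y X))))
      (f (.sub (.const 1) (.div X (.add X Y)))))

/-- The test `c` or the test `d`, depending on the test `b`. -/
def BExp.ite (b c d : BExp) : BExp := .or (.and b c) (.and (.not b) d)

theorem BExp.holds_ite (b c d : BExp) :
    (BExp.ite b c d).Holds s ↔ (b.Holds s → c.Holds s) ∧ (¬ b.Holds s → d.Holds s) := by
  rw [BExp.ite, BExp.holds_or, BExp.holds_and, BExp.holds_and, BExp.holds_not]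
  by_cases h : b.Holds s <;> simp [h]

theorem BExp.holds_angleCases {X Y : RExp} {f : RExp → BExp} {Q : ℝ → Prop}
    (h : ∀ e, (f e).Holds s ↔ Q (e.eval s)) :
    (angleCases BExp.ite X Y f).Holds s ↔ Q (diamondAngle (X.eval s) (Y.eval s)) := by
  simp only [angleCases, BExp.holds_ite, BExp.holds_neg, h, diamondAngle]
  split_ifs <;> simp [RExp.eval, *]

theorem Routine.exec_angleCases {X Y : RExp} {f : RExp → Routine} {g : ℝ → Memory}
    (h : ∀ e, (f e).exec s = g (e.eval s)) :
    (angleCases Routine.cond X Y f).exec s = g (diamondAngle (X.eval s) (Y.eval s)) := by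
  simp only [angleCases, Routine.exec, BExp.holds_neg, h, diamondAngle]
  split_ifs <;> simp [RExp.eval]

/-- The axis of the `k`-th edge of the triangle in the counter `v`. The orientations are in the real
array `8`. -/
def VExp.edgeAxis (v : ℕ) (k : Fin 3) : VExp :=
  .smul (.get 8 (.cell v)) (.sub (.vertex v (k + 1)) (.vertex v k))

/-- Cosine part of the angle `edgeAngle`. -/
def RExp.edgeX (v : ℕ) (k : Fin 3) (w : VExp) : RExp :=
  VExp.dot (.cross (.cross (.edgeAxis v k) (.sub (.vertex v (k + 2)) (.vertex v k)))
    (.edgeAxis v k)) w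

/-- Sine part of the angle `edgeAngle`. -/
def RExp.edgeY (v : ℕ) (k : Fin 3) (w : VExp) : RExp :=
  VExp.dot (.cross (.edgeAxis v k) (.sub (.vertex v (k + 2)) (.vertex v k))) w

/-- The real array `8` holds the orientations of the facial triangles. -/
def HasOrientations {n : ℕ} (T : Fin n → Fin 3 → Space) (s : Memory) : Prop :=
  ∀ i : Fin n, s.real 8 i = orientation T i

theorem HasInput.diamondAngle_edge (h : HasInput T s) (ho : HasOrientations T s) {v : ℕ} {i : Fin n}
    (hi : s.nat v 0 = i) (k : Fin 3) (w : VExp) :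
    diamondAngle ((RExp.edgeX v k w).eval s) ((RExp.edgeY v k w).eval s) =
      edgeAngle T i k (w.eval s) := by
  have e : (VExp.edgeAxis v k).eval s = edgeAxis T i k := by
    simp only [VExp.edgeAxis, VExp.eval_smul, VExp.eval_sub, h.eval_vertex hi, RExp.eval,
      NExp.eval, NExp.cell, hi, ho i, edgeAxis]
  simp only [RExp.edgeX, RExp.edgeY, VExp.eval_dot, VExp.eval_cross, VExp.eval_sub, e,
    h.eval_vertex hi, edgeAngle, axisAngle]

end Formulas

theorem ncard_lt_succ {n : ℕ} (p : Fin n → Prop) [DecidablePred p] {m : ℕ} (hm : m < n) :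
    {k : Fin n | (k : ℕ) < m + 1 ∧ p k}.ncard =
      {k : Fin n | (k : ℕ) < m ∧ p k}.ncard + if p ⟨m, hm⟩ then 1 else 0 := by
  split_ifs with h
  · rw [← Set.ncard_insert_of_notMem (a := (⟨m, hm⟩ : Fin n)) (by simp)]
    congr 1
    ext k
    simp only [Set.mem_ofPred_eq, Set.mem_insert_iff, Fin.ext_iff]
    constructor
    · rintro ⟨h1, h2⟩
      rcases Nat.lt_succ_iff_lt_or_eq.1 h1 with h3 | h3
      · exact Or.inr ⟨h3, h2⟩
      · exact Or.inl h3
    · rintro (h3 | ⟨h3, h2⟩)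
      · have : k = ⟨m, hm⟩ := Fin.ext h3
        subst this
        exact ⟨Nat.lt_succ_self _, h⟩
      · exact ⟨by omega, h2⟩
  · rw [add_zero]
    congr 1
    ext k
    simp only [Set.mem_ofPred_eq]
    constructor
    · rintro ⟨h1, h2⟩
      rcases Nat.lt_succ_iff_lt_or_eq.1 h1 with h3 | h3
      · exact ⟨h3, h2⟩
      · have : k = ⟨m, hm⟩ := Fin.ext h3
        subst this
        exact absurd h2 h
    · rintro ⟨h1, h2⟩
      exact ⟨by omega, h2⟩

namespace Routine

section Stages

variable {n : ℕ} {T : Fin n → Fin 3 → Space} {s : Memory}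

/-! ### Computation of the orientations -/

/-- Count, modulo two, the facial triangles that are hit by the ray from the centroid of the
triangle `i`. -/
def countHits : Routine :=
  seq (setN 5 (.const 0) (.const 0)) (each 3 (cond
    (.rayHits (.centroid 2) (.vertex 3)) (setN 5 (.const 0) (.sub (.const 1) (.cell 5))) skip))

/-- Tabulate the orientations. -/
def orientations : Routine :=
  each 2 (seq countHits
    (cond (.ite (.lexPos (.normal (.vertex 2))) (.ltN (.const 0) (.cell 5))
        (.not (.ltN (.const 0) (.cell 5))))
      (setR 8 (.cell 2) (.const 1)) (setR 8 (.cell 2) (.const (-1)))))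

open Classical in
theorem exec_countHits (h : HasInput T s) {i : Fin n} (hi : s.nat 2 0 = i) :
    (countHits.exec s).nat 5 0 =
      if Odd {k | RayHits ((3⁻¹ : ℝ) • (T i 0 + T i 1 + T i 2)) (T k)}.ncard then 1 else 0 := by
  set p : Fin n → Prop := fun k => RayHits ((3⁻¹ : ℝ) • (T i 0 + T i 1 + T i 2)) (T k) with hp
  have h' := h.exec (setN 5 (.const 0) (.const 0)) rfl rfl
  have key := exec_each (v := 3) (c := cond
    (.rayHits (.centroid 2) (.vertex 3)) (setN 5 (.const 0) (.sub (.const 1) (.cell 5))) skip)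
    (s := (setN 5 (.const 0) (.const 0)).exec s)
    (fun m s' => s'.nat 5 0 = if Odd {k : Fin n | (k : ℕ) < m ∧ p k}.ncard then 1 else 0)
    (by simp [exec, Memory.setNat, NExp.eval]) ?_
  · rw [h'.nat] at key
    rw [countHits, exec, key]
    simp [hp]
  intro m hm s' hf hv hinv
  rw [h'.nat] at hm
  have hs' : HasInput T s' := ⟨by rw [hf.nat 0 (by decide) rfl, h'.nat],
    by rw [hf.real 0 rfl, h'.real]⟩
  have hi' : s'.nat 2 0 = i := by
    rw [hf.nat 2 (by decide) rfl, exec_nat _ rfl, hi]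
  have hb : (BExp.rayHits (.centroid 2) (.vertex 3)).Holds s' ↔ p ⟨m, hm⟩ := by
    rw [BExp.holds_rayHits, hs'.eval_centroid hi']
    simp only [hs'.eval_vertex (i := ⟨m, hm⟩) hv, hp]
  rw [ncard_lt_succ p hm, Memory.setNat_nat_of_ne _ (by decide)]
  rw [exec]
  by_cases hpm : p ⟨m, hm⟩
  · rw [if_pos (hb.2 hpm), if_pos hpm]
    simp only [exec, NExp.eval, NExp.cell, Memory.setNat_nat_self, hinv, Nat.odd_add_one]
    split_ifs <;> simp_all
  · rw [if_neg (fun hh => hpm (hb.1 hh)), if_neg hpm]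
    simpa only [exec, add_zero] using hinv

open Classical in
theorem exec_orientations (h : HasInput T s) : HasOrientations T (orientations.exec s) := by
  have key := exec_each (v := 2) (c := seq countHits
    (cond (.ite (.lexPos (.normal (.vertex 2))) (.ltN (.const 0) (.cell 5))
        (.not (.ltN (.const 0) (.cell 5))))
      (setR 8 (.cell 2) (.const 1)) (setR 8 (.cell 2) (.const (-1))))) (s := s)
    (fun m s' => ∀ i : Fin n, (i : ℕ) < m → s'.real 8 i = orientation T i)
    (fun i hi => absurd hi (Nat.not_lt_zero _)) ?_
  · exact fun i => key i (by rw [h.nat]; exact i.isLt)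
  intro m hm s' hf hv hinv
  rw [h.nat] at hm
  have hs' : HasInput T s' := ⟨by rw [hf.nat 0 (by decide) rfl, h.nat],
    by rw [hf.real 0 rfl, h.real]⟩
  have hcount := exec_countHits hs' (i := ⟨m, hm⟩) hv
  have hs2 := hs'.exec countHits rfl rfl
  have hv2 : (countHits.exec s').nat 2 0 = m := by rw [exec_nat _ rfl, hv]
  have h8 : (countHits.exec s').real 8 = s'.real 8 := exec_real _ rfl _
  generalize hs2e : countHits.exec s' = s2 at hcount hs2 hv2 h8
  have hb : (BExp.ite (.lexPos (.normal (.vertex 2))) (.ltN (.const 0) (.cell 5))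
      (.not (.ltN (.const 0) (.cell 5)))).Holds s2 ↔ (LexPos (normal (T ⟨m, hm⟩)) ↔
      Odd {k | RayHits ((3⁻¹ : ℝ) • (T ⟨m, hm⟩ 0 + T ⟨m, hm⟩ 1 + T ⟨m, hm⟩ 2)) (T k)}.ncard) := by
    rw [BExp.holds_ite, BExp.holds_not, BExp.holds_lexPos, VExp.eval_normal]
    simp only [hs2.eval_vertex (i := ⟨m, hm⟩) hv2, BExp.Holds, NExp.eval, NExp.cell, hcount]
    by_cases h1 : LexPos (normal (T ⟨m, hm⟩)) <;> simp only [h1, if_true, if_false] <;>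
      split_ifs <;> simp_all
  have hset : exec (cond (.ite (.lexPos (.normal (.vertex 2))) (.ltN (.const 0) (.cell 5))
        (.not (.ltN (.const 0) (.cell 5))))
      (setR 8 (.cell 2) (.const 1)) (setR 8 (.cell 2) (.const (-1)))) s2 =
      s2.setReal 8 m (orientation T ⟨m, hm⟩) := by
    rw [exec, if_congr hb rfl rfl, orientation]
    split_ifs <;> simp [exec, NExp.eval, NExp.cell, hv2, RExp.eval]
  intro i hi
  rw [Memory.setNat_real, exec, hs2e, hset]
  by_cases him : (i : ℕ) = m
  · have : i = ⟨m, hm⟩ := Fin.ext him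
    rw [this, Memory.setReal_real_self]
  · rw [Memory.setReal_real_of_index_ne _ _ him, h8, hinv i (by omega)]

/-! ### Computation of the angles to the next facial triangles -/

/-- Keep the minimum of the positive angles in cell `0` of the real array `9`. -/
def updateMin (k m : Fin 3) : Routine :=
  cond (.hasEdge (.vertex 2 k) (.vertex 2 (k + 1)) (.vertex 3) m)
    (angleCases cond (.edgeX 2 k (.sub (.vertex 3 (m + 2)) (.vertex 2 k)))
      (.edgeY 2 k (.sub (.vertex 3 (m + 2)) (.vertex 2 k)))
      fun e => cond (.and (.pos e) (.ltR e (.get 9 (.const 0)))) (setR 9 (.const 0) e) skip)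
    skip

/-- Tabulate the angles at the edges `k` of the facial triangles in the real array `10 + k`. -/
def nextAngles (k : Fin 3) : Routine :=
  each 2 (seq (setR 9 (.const 0) (.const 4)) (seq (each 3 (seq3 fun m => updateMin k m))
    (setR (10 + k) (.cell 2) (.get 9 (.const 0)))))

theorem exec_updateMin (h : HasInput T s) (ho : HasOrientations T s) {i j : Fin n}
    (hi : s.nat 2 0 = i) (hj : s.nat 3 0 = j) (k m : Fin 3) :
    open Classical in
    ((updateMin k m).exec s).real 9 0 =
      if HasEdge (T i k) (T i (k + 1)) (T j) m ∧ 0 < edgeAngle T i k (T j (m + 2) - T i k) then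
        min (s.real 9 0) (edgeAngle T i k (T j (m + 2) - T i k)) else s.real 9 0 := by
  classical
  have hb : (BExp.hasEdge (.vertex 2 k) (.vertex 2 (k + 1)) (.vertex 3) m).Holds s ↔
      HasEdge (T i k) (T i (k + 1)) (T j) m := by
    rw [BExp.holds_hasEdge]
    simp only [h.eval_vertex hi, h.eval_vertex hj]
  obtain ⟨g, hgdef⟩ : ∃ g : ℝ → Memory,
      g = fun r => if 0 < r ∧ r < s.real 9 0 then s.setReal 9 0 r else s := ⟨_, rfl⟩
  have hg : ∀ e : RExp,
      (cond (.and (.pos e) (.ltR e (.get 9 (.const 0)))) (setR 9 (.const 0) e) skip).exec s =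
      g (e.eval s) := by
    intro e
    rw [exec, hgdef]
    refine if_congr ?_ rfl rfl
    rw [BExp.holds_and, BExp.holds_pos]
    rfl
  rw [updateMin, exec]
  by_cases he : HasEdge (T i k) (T i (k + 1)) (T j) m
  · rw [if_pos (hb.2 he), exec_angleCases hg, h.diamondAngle_edge ho hi, VExp.eval_sub,
      h.eval_vertex hi, h.eval_vertex hj, hgdef]
    simp only [he, true_and]
    split_ifs with h1 h2 h2
    · rw [Memory.setReal_real_self, min_eq_right h1.2.le]
    · exact absurd h1.1 h2
    · rw [min_eq_left (not_lt.1 fun h3 => h1 ⟨h2, h3⟩)]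
    · rfl
  · rw [if_neg (fun hh => he (hb.1 hh)), if_neg (fun hh => he hh.1)]
    rfl

/-- The minimum of `4` and of the positive angles to the triangles that satisfy `p`. -/
def IsMinAngle (T : Fin n → Fin 3 → Space) (i : Fin n) (k : Fin 3) (p : Fin n → Fin 3 → Prop)
    (θ : ℝ) : Prop :=
  θ ≤ 4 ∧
  (∀ l m, p l m → HasEdge (T i k) (T i (k + 1)) (T l) m →
    0 < edgeAngle T i k (T l (m + 2) - T i k) → θ ≤ edgeAngle T i k (T l (m + 2) - T i k)) ∧
  (θ = 4 ∨ ∃ l m, HasEdge (T i k) (T i (k + 1)) (T l) m ∧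
    0 < edgeAngle T i k (T l (m + 2) - T i k) ∧ edgeAngle T i k (T l (m + 2) - T i k) = θ)

theorem IsMinAngle.exec_updateMin (h : HasInput T s) (ho : HasOrientations T s) {i j : Fin n}
    (hi : s.nat 2 0 = i) (hj : s.nat 3 0 = j) (k m : Fin 3) {p : Fin n → Fin 3 → Prop}
    (hp : IsMinAngle T i k p (s.real 9 0)) :
    IsMinAngle T i k (fun l m' => p l m' ∨ (l = j ∧ m' = m))
      (((updateMin k m).exec s).real 9 0) := by
  rw [Routine.exec_updateMin h ho hi hj]
  obtain ⟨h4, hle, hex⟩ := hp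
  split_ifs with hc
  · refine ⟨(min_le_left _ _).trans h4, ?_, ?_⟩
    · rintro l m' (hl | ⟨rfl, rfl⟩) he hpos
      · exact (min_le_left _ _).trans (hle l m' hl he hpos)
      · exact min_le_right _ _
    · rcases min_choice (s.real 9 0) (edgeAngle T i k (T j (m + 2) - T i k)) with hm | hm
      · rw [hm]; exact hex
      · rw [hm]; exact Or.inr ⟨j, m, hc.1, hc.2, rfl⟩
  · refine ⟨h4, ?_, hex⟩
    rintro l m' (hl | ⟨rfl, rfl⟩) he hpos
    · exact hle l m' hl he hpos
    · exact absurd ⟨he, hpos⟩ hc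

theorem updateMin_writesNat (k m : Fin 3) (a : ℕ) : (updateMin k m).writesNat a = false := by
  simp [updateMin, angleCases, writesNat]

theorem updateMin_writesReal (k m : Fin 3) {a : ℕ} (ha : a ≠ 9) :
    (updateMin k m).writesReal a = false := by
  simp [updateMin, angleCases, writesReal, ha]

theorem exec_each_updateMin (h : HasInput T s) (ho : HasOrientations T s) {i : Fin n}
    (hi : s.nat 2 0 = i) (k : Fin 3) (h4 : s.real 9 0 = 4) :
    IsNextAngle T i k (((each 3 (seq3 fun m => updateMin k m)).exec s).real 9 0) := by
  have key := exec_each (v := 3) (c := seq3 fun m => updateMin k m) (s := s)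
    (fun m s' => IsMinAngle T i k (fun l _ => (l : ℕ) < m) (s'.real 9 0))
    ⟨by rw [Memory.setNat_real, h4], fun l _ hl => absurd hl (Nat.not_lt_zero _),
      Or.inl (by rw [Memory.setNat_real, h4])⟩ ?_
  · rw [h.nat] at key
    exact ⟨key.1, fun l m => key.2.1 l m l.isLt, key.2.2⟩
  intro m hm s0 hf hv hinv
  rw [h.nat] at hm
  have hs0 : HasInput T s0 := ⟨by rw [hf.nat 0 (by decide) rfl, h.nat],
    by rw [hf.real 0 rfl, h.real]⟩
  have hi0 : s0.nat 2 0 = i := by rw [hf.nat 2 (by decide) rfl, hi]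
  have ho0 : HasOrientations T s0 := fun l => by rw [hf.real 8 rfl]; exact ho l
  have step : ∀ (c : Routine), (∀ a, c.writesNat a = false) → (∀ a ≠ 9, c.writesReal a = false) →
      ∀ s, HasInput T s ∧ s.nat 2 0 = i ∧ s.nat 3 0 = m ∧ HasOrientations T s →
      HasInput T (c.exec s) ∧ (c.exec s).nat 2 0 = i ∧ (c.exec s).nat 3 0 = m ∧
        HasOrientations T (c.exec s) := by
    rintro c h1 h2 s ⟨h3, h5, h6, h7⟩
    exact ⟨h3.exec c (h1 0) (h2 0 (by decide)), by rw [exec_nat c (h1 2), h5],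
      by rw [exec_nat c (h1 3), h6], fun l => by rw [exec_real c (h2 8 (by decide))]; exact h7 l⟩
  have c0 : HasInput T s0 ∧ s0.nat 2 0 = i ∧ s0.nat 3 0 = m ∧ HasOrientations T s0 :=
    ⟨hs0, hi0, hv, ho0⟩
  have hw := fun m' => step (updateMin k m') (updateMin_writesNat k m')
    (fun a ha => updateMin_writesReal k m' ha)
  have c1 := hw 0 s0 c0
  have c2 := hw 1 _ c1
  have i1 := hinv.exec_updateMin (j := ⟨m, hm⟩) c0.1 c0.2.2.2 c0.2.1 c0.2.2.1 k 0
  have i2 := i1.exec_updateMin (j := ⟨m, hm⟩) c1.1 c1.2.2.2 c1.2.1 c1.2.2.1 k 1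
  have i3 := i2.exec_updateMin (j := ⟨m, hm⟩) c2.1 c2.2.2.2 c2.2.1 c2.2.2.1 k 2
  refine ⟨i3.1, fun l m' hl => i3.2.1 l m' ?_, i3.2.2⟩
  rcases Nat.lt_succ_iff_lt_or_eq.1 hl with h1 | h1
  · exact Or.inl (Or.inl (Or.inl h1))
  · have : l = ⟨m, hm⟩ := Fin.ext h1
    subst this
    fin_cases m'
    · exact Or.inl (Or.inl (Or.inr ⟨rfl, rfl⟩))
    · exact Or.inl (Or.inr ⟨rfl, rfl⟩)
    · exact Or.inr ⟨rfl, rfl⟩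

theorem exec_nextAngles (h : HasInput T s) (ho : HasOrientations T s) (k : Fin 3) :
    ∀ i : Fin n, IsNextAngle T i k (((nextAngles k).exec s).real (10 + k) i) := by
  have key := exec_each (v := 2) (c := seq (setR 9 (.const 0) (.const 4))
    (seq (each 3 (seq3 fun m => updateMin k m))
      (setR (10 + k) (.cell 2) (.get 9 (.const 0))))) (s := s)
    (fun m s' => ∀ i : Fin n, (i : ℕ) < m → IsNextAngle T i k (s'.real (10 + k) i))
    (fun i hi => absurd hi (Nat.not_lt_zero _)) ?_
  · exact fun i => key i (by rw [h.nat]; exact i.isLt)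
  intro m hm s0 hf hv hinv
  rw [h.nat] at hm
  have h10 : ∀ a, a < 9 → a ≠ 10 + (k : ℕ) := fun a ha => by omega
  have hw : ∀ a, a < 9 → (seq (setR 9 (.const 0) (.const 4))
    (seq (each 3 (seq3 fun m => updateMin k m))
      (setR (10 + k) (.cell 2) (.get 9 (.const 0))))).writesReal a = false := by
    intro a ha
    simp [writesReal, seq3, updateMin_writesReal k _ (show a ≠ 9 by omega), h10 a ha]
    omega
  have hs0 : HasInput T s0 := ⟨by rw [hf.nat 0 (by decide) rfl, h.nat],
    by rw [hf.real 0 (hw 0 (by norm_num)), h.real]⟩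
  have ho0 : HasOrientations T s0 := fun l => by rw [hf.real 8 (hw 8 (by norm_num))]; exact ho l
  set s1 := (setR 9 (.const 0) (.const 4)).exec s0 with hs1
  have a1 : HasInput T s1 := hs0.exec _ rfl rfl
  have a2 : HasOrientations T s1 := fun l => by rw [hs1, exec_real _ rfl]; exact ho0 l
  have a3 : s1.nat 2 0 = m := hv
  have a4 : s1.real 9 0 = 4 := by simp [hs1, exec, NExp.eval, RExp.eval]
  have hnext := exec_each_updateMin a1 a2 (i := ⟨m, hm⟩) a3 k a4
  have hkeep : ((each 3 (seq3 fun m => updateMin k m)).exec s1).real (10 + k) =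
      s0.real (10 + k) := by
    rw [exec_real, hs1, exec_real]
    · simp [writesReal]
      omega
    · simp [writesReal, seq3, updateMin_writesReal k _ (show 10 + (k : ℕ) ≠ 9 by omega)]
  have hv2 : ((each 3 (seq3 fun m => updateMin k m)).exec s1).nat 2 0 = m := by
    rw [exec_nat, a3]
    simp [writesNat, seq3, updateMin_writesNat]
  intro i hi
  rw [Memory.setNat_real, exec, ← hs1, exec]
  simp only [exec.eq_3, NExp.cell, NExp.eval, hv2, RExp.eval]
  by_cases him : (i : ℕ) = m
  · have : i = ⟨m, hm⟩ := Fin.ext him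
    subst this
    rw [Memory.setReal_real_self]
    exact hnext
  · rw [Memory.setReal_real_of_index_ne _ _ him, hkeep]
    exact hinv i (by omega)

end Stages

end Routine

/-! ### Clipping the cone of half-planes -/

theorem InCone.add_smul {t : Fin 3 → Space} {k : Fin 3} {F G : Space} (hF : InCone t k F)
    (hG : InCone t k G) {a b : ℝ} (ha : 0 < a) (hb : 0 ≤ b) : InCone t k (a • F + b • G) := by
  obtain ⟨p, q, hp, hq, hpq, rfl⟩ := hF
  obtain ⟨p', q', hp', hq', hpq', rfl⟩ := hG
  refine ⟨a * p + b * p', a * q + b * q', by positivity, by positivity, ?_, by module⟩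
  have h1 := mul_pos ha hpq
  have h2 := mul_nonneg hb hpq'.le
  linarith

/-- The vectors in the cone at the vertex `k` of `t` that satisfy the inequalities `F · z ≤ 0`, for
all `z` with `Z z`, form the cone spanned by `F₁` and `F₂`, without its apex. -/
structure IsClipped (t : Fin 3 → Space) (k : Fin 3) (Z : Space → Prop) (F₁ F₂ : Space) :
    Prop where
  fst : InCone t k F₁
  snd : InCone t k F₂
  nonpos : ∀ z, Z z → F₁ ⬝ᵥ z ≤ 0 ∧ F₂ ⬝ᵥ z ≤ 0
  complete : ∀ F, InCone t k F → (∀ z, Z z → F ⬝ᵥ z ≤ 0) →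
    ∃ a b : ℝ, 0 ≤ a ∧ 0 ≤ b ∧ F = a • F₁ + b • F₂

section Clip

variable {t : Fin 3 → Space} {k : Fin 3} {Z : Space → Prop} {F₁ F₂ z : Space}

theorem isClipped_cone (t : Fin 3 → Space) (k : Fin 3) :
    IsClipped t k (fun _ => False) (coneLeft t k) (coneRight t k) where
  fst := ⟨1, 0, zero_le_one, le_rfl, by norm_num, by simp⟩
  snd := ⟨0, 1, le_rfl, zero_le_one, by norm_num, by simp⟩
  nonpos := fun _ h => h.elim
  complete := by
    rintro F ⟨a, b, ha, hb, -, rfl⟩ -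
    exact ⟨a, b, ha, hb, rfl⟩

theorem IsClipped.symm (h : IsClipped t k Z F₁ F₂) : IsClipped t k Z F₂ F₁ where
  fst := h.snd
  snd := h.fst
  nonpos := fun z hz => (h.nonpos z hz).symm
  complete := by
    intro F hF hZ
    obtain ⟨a, b, ha, hb, e⟩ := h.complete F hF hZ
    exact ⟨b, a, hb, ha, by rw [e, add_comm]⟩

theorem IsClipped.of_nonpos (h : IsClipped t k Z F₁ F₂) (h1 : F₁ ⬝ᵥ z ≤ 0) (h2 : F₂ ⬝ᵥ z ≤ 0) :
    IsClipped t k (fun y => Z y ∨ y = z) F₁ F₂ where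
  fst := h.fst
  snd := h.snd
  nonpos := by
    rintro y (hy | rfl)
    · exact h.nonpos y hy
    · exact ⟨h1, h2⟩
  complete := fun F hF hZ => h.complete F hF fun y hy => hZ y (Or.inl hy)

theorem IsClipped.exists_pos (ht : normal t ≠ 0) (h : IsClipped t k Z F₁ F₂) (h1 : 0 < F₁ ⬝ᵥ z)
    (h2 : 0 < F₂ ⬝ᵥ z) (F : Space) (hF : InCone t k F) :
    ∃ y, (Z y ∨ y = z) ∧ 0 < F ⬝ᵥ y := by
  by_contra! hcon
  obtain ⟨a, b, ha, hb, rfl⟩ := h.complete F hF fun y hy => hcon y (Or.inl hy)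
  have h3 := hcon z (Or.inr rfl)
  rw [add_dotProduct, smul_dotProduct, smul_dotProduct, smul_eq_mul, smul_eq_mul] at h3
  have h4 := mul_nonneg ha h1.le
  have h5 := mul_nonneg hb h2.le
  have h6 : a = 0 := (mul_eq_zero.1 (show a * (F₁ ⬝ᵥ z) = 0 by linarith)).resolve_right h1.ne'
  have h7 : b = 0 := (mul_eq_zero.1 (show b * (F₂ ⬝ᵥ z) = 0 by linarith)).resolve_right h2.ne'
  exact hF.ne_zero ht (by rw [h6, h7]; simp)

/-- If the inequality fails for one of the generators, then it is replaced by the vector at which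
the inequality becomes an equation. -/
theorem IsClipped.replace (h : IsClipped t k Z F₁ F₂) (h1 : 0 < F₁ ⬝ᵥ z) (h2 : F₂ ⬝ᵥ z ≤ 0) :
    IsClipped t k (fun y => Z y ∨ y = z) ((F₁ ⬝ᵥ z) • F₂ - (F₂ ⬝ᵥ z) • F₁) F₂ where
  fst := by
    have := h.snd.add_smul h.fst h1 (neg_nonneg.2 h2)
    rwa [neg_smul, ← sub_eq_add_neg] at this
  snd := h.snd
  nonpos := by
    rintro y (hy | rfl)
    · obtain ⟨h3, h4⟩ := h.nonpos y hy
      refine ⟨?_, h4⟩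
      rw [sub_dotProduct, smul_dotProduct, smul_dotProduct, smul_eq_mul, smul_eq_mul]
      nlinarith
    · refine ⟨?_, h2⟩
      rw [sub_dotProduct, smul_dotProduct, smul_dotProduct, smul_eq_mul, smul_eq_mul]
      linarith
  complete := by
    intro F hF hZ
    obtain ⟨a, b, ha, hb, rfl⟩ := h.complete F hF fun y hy => hZ y (Or.inl hy)
    have h3 := hZ z (Or.inr rfl)
    rw [add_dotProduct, smul_dotProduct, smul_dotProduct, smul_eq_mul, smul_eq_mul] at h3
    rcases h2.eq_or_lt with h2 | h2
    · have h4 := mul_nonneg ha h1.le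
      have h6 : a = 0 := (mul_eq_zero.1 (show a * (F₁ ⬝ᵥ z) = 0 by
        rw [h2, mul_zero] at h3; linarith)).resolve_right h1.ne'
      exact ⟨0, b, le_rfl, hb, by rw [h6]; simp⟩
    · refine ⟨a / -(F₂ ⬝ᵥ z), (a * (F₁ ⬝ᵥ z) + b * (F₂ ⬝ᵥ z)) / (F₂ ⬝ᵥ z),
        div_nonneg ha (by linarith), div_nonneg_of_nonpos h3 h2.le, ?_⟩
      have e1 : a / -(F₂ ⬝ᵥ z) * (F₂ ⬝ᵥ z) = -a := by
        rw [div_neg, neg_mul, div_mul_cancel₀ _ h2.ne]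
      have e2 : a / -(F₂ ⬝ᵥ z) * (F₁ ⬝ᵥ z) +
          (a * (F₁ ⬝ᵥ z) + b * (F₂ ⬝ᵥ z)) / (F₂ ⬝ᵥ z) = b := by
        have := h2.ne
        field_simp
        ring
      rw [smul_sub, smul_smul, smul_smul, e1]
      nth_rewrite 1 [← e2]
      module

end Clip

/-! ### Expressions for the cuts -/

/-- The memory holds the input, the orientations, and the angles `θ`. -/
structure HasTables {n : ℕ} (T : Fin n → Fin 3 → Space) (θ : Fin n → Fin 3 → ℝ) (s : Memory) :
    Prop where
  input : HasInput T s
  orientations : HasOrientations T s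
  angles : ∀ (j : Fin n) (k : Fin 3), s.real (10 + k) j = θ j k

/-- The memory holds the tables, and the counters point to the triangles `i` and `j`. -/
structure AtPair {n : ℕ} (T : Fin n → Fin 3 → Space) (θ : Fin n → Fin 3 → ℝ) (i j : Fin n)
    (s : Memory) : Prop where
  tables : HasTables T θ s
  fst : s.nat 2 0 = i
  snd : s.nat 3 0 = j

/-- The height of the vertex `k` of the triangle in the counter `3` above the plane of the triangle in
the counter `2`. -/
def RExp.height (k : Fin 3) : RExp :=
  VExp.dot (.normal (.vertex 2)) (.sub (.vertex 3 k) (.vertex 2 0))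

/-- The test `InWedge`. The angles at the edges `k` are in the real array `10 + k`. -/
def BExp.inWedge (k : Fin 3) (w : VExp) : BExp :=
  angleCases BExp.ite (.edgeX 3 k w) (.edgeY 3 k w) fun e =>
    .and (.pos e) (.ltR e (.get (10 + k) (.cell 3)))

/-- The vector `crossingVector`, seen from the vertex `κ` of the triangle in the counter `2`. -/
def VExp.crossing (κ k l : Fin 3) : VExp :=
  .sub (.smul (.height l) (.sub (.vertex 3 k) (.vertex 2 κ)))
    (.smul (.height k) (.sub (.vertex 3 l) (.vertex 2 κ)))

/-- The vertex `k` is below the plane and the vertex `l` is above it. -/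
def BExp.crosses (k l : Fin 3) : BExp := .and (.neg (.height k)) (.pos (.height l))

/-- A normal vector of the `k`-th edge in the plane of the triangle in the counter `2`, if the edge
lies in this plane. -/
def VExp.edgeNormal (k : Fin 3) : VExp :=
  .cross (.normal (.vertex 2)) (.sub (.vertex 3 (k + 1)) (.vertex 3 k))

/-- The `k`-th edge lies in the plane, and the section has interior points next to it. -/
def BExp.bordersSection (k : Fin 3) : BExp :=
  .and (.isZero (.height k)) (.and (.isZero (.height (k + 1)))
    (.or (.inWedge k (.edgeNormal k)) (.inWedge k (.smul (.const (-1)) (.edgeNormal k)))))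

/-- The vectors of `IsCut`, with their conditions. -/
def cuts (κ k : Fin 3) : List (BExp × VExp) :=
  [(.crosses k (k + 1), .crossing κ k (k + 1)), (.crosses (k + 1) k, .crossing κ (k + 1) k),
    (.and (.or (.crosses k (k + 1)) (.crosses (k + 1) k)) (.isZero (.height (k + 2))),
      .sub (.vertex 3 (k + 2)) (.vertex 2 κ)),
    (.bordersSection k, .sub (.vertex 3 k) (.vertex 2 κ)),
    (.bordersSection k, .sub (.vertex 3 (k + 1)) (.vertex 2 κ))]

section Formulas

variable {n : ℕ} {T : Fin n → Fin 3 → Space} {θ : Fin n → Fin 3 → ℝ} {i j : Fin n} {s : Memory}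

/-- The array `7` does not belong to the tables. -/
theorem AtPair.update (h : AtPair T θ i j s) (f : ℕ → ℝ) :
    AtPair T θ i j ⟨s.nat, Function.update s.real 7 f⟩ := by
  have h7 : ∀ a, a ≠ 7 → (⟨s.nat, Function.update s.real 7 f⟩ : Memory).real a = s.real a :=
    fun a ha => Function.update_of_ne ha _ _
  exact
    { tables :=
        { input := ⟨h.tables.input.nat, by rw [h7 0 (by decide), h.tables.input.real]⟩
          orientations := fun l => by rw [h7 8 (by decide)]; exact h.tables.orientations l
          angles := fun l k => by rw [h7 (10 + k) (by omega)]; exact h.tables.angles l k }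
      fst := h.fst
      snd := h.snd }

theorem AtPair.eval_height (h : AtPair T θ i j s) (k : Fin 3) :
    (RExp.height k).eval s = height T i j k := by
  simp only [RExp.height, VExp.eval_dot, VExp.eval_normal, VExp.eval_sub,
    h.tables.input.eval_vertex h.fst, h.tables.input.eval_vertex h.snd, height]

theorem AtPair.holds_inWedge (h : AtPair T θ i j s) (k : Fin 3) (w : VExp) :
    (BExp.inWedge k w).Holds s ↔ InWedge T θ j k (w.eval s) := by
  rw [BExp.inWedge, BExp.holds_angleCases (Q := fun r => 0 < r ∧ r < θ j k),
    h.tables.input.diamondAngle_edge h.tables.orientations h.snd]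
  · rfl
  · intro e
    simp only [BExp.holds_and, BExp.holds_pos, BExp.Holds, RExp.eval, NExp.eval, NExp.cell, h.snd,
      h.tables.angles]

theorem AtPair.eval_crossing (h : AtPair T θ i j s) (κ k l : Fin 3) :
    (VExp.crossing κ k l).eval s = crossingVector T i (T i κ) j k l := by
  simp only [VExp.crossing, VExp.eval_sub, VExp.eval_smul, h.eval_height,
    h.tables.input.eval_vertex h.fst, h.tables.input.eval_vertex h.snd, crossingVector]

theorem AtPair.holds_crosses (h : AtPair T θ i j s) (k l : Fin 3) :
    (BExp.crosses k l).Holds s ↔ height T i j k < 0 ∧ 0 < height T i j l := by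
  rw [BExp.crosses, BExp.holds_and, BExp.holds_neg, BExp.holds_pos, h.eval_height, h.eval_height]

theorem AtPair.holds_bordersSection (h : AtPair T θ i j s) (k : Fin 3) :
    (BExp.bordersSection k).Holds s ↔ height T i j k = 0 ∧ height T i j (k + 1) = 0 ∧
      (InWedge T θ j k (normal (T i) ⨯₃ (T j (k + 1) - T j k)) ∨
        InWedge T θ j k (-(normal (T i) ⨯₃ (T j (k + 1) - T j k)))) := by
  have e : (VExp.edgeNormal k).eval s = normal (T i) ⨯₃ (T j (k + 1) - T j k) := by
    simp only [VExp.edgeNormal, VExp.eval_cross, VExp.eval_normal, VExp.eval_sub,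
      h.tables.input.eval_vertex h.fst, h.tables.input.eval_vertex h.snd]
  rw [BExp.bordersSection, BExp.holds_and, BExp.holds_and, BExp.holds_or, BExp.holds_isZero,
    BExp.holds_isZero, h.holds_inWedge, h.holds_inWedge, VExp.eval_smul, h.eval_height,
    h.eval_height, e]
  simp only [RExp.eval, Int.cast_neg, Int.cast_one, neg_smul, one_smul]

theorem AtPair.mem_cuts (h : AtPair T θ i j s) (κ k : Fin 3) (z : Space) :
    (∃ p ∈ cuts κ k, p.1.Holds s ∧ z = p.2.eval s) ↔ IsCut T θ i (T i κ) j k z := by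
  simp only [cuts, List.mem_cons, List.not_mem_nil, or_false, exists_eq_or_imp, exists_eq_left,
    h.eval_crossing, h.holds_crosses, h.holds_bordersSection, BExp.holds_and, BExp.holds_or,
    BExp.holds_isZero, h.eval_height, VExp.eval_sub, h.tables.input.eval_vertex h.fst,
    h.tables.input.eval_vertex h.snd, IsCut]
  exact or_congr Iff.rfl (or_congr Iff.rfl (or_congr and_assoc and_or_left.symm))

theorem AtPair.cuts_congr (h : AtPair T θ i j s) {s' : Memory} (h' : AtPair T θ i j s')
    (κ k : Fin 3) : ∀ p ∈ cuts κ k, (p.1.Holds s' ↔ p.1.Holds s) ∧ p.2.eval s' = p.2.eval s := by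
  simp only [cuts, List.mem_cons, List.not_mem_nil, or_false, forall_eq_or_imp, forall_eq,
    h.eval_crossing, h.holds_crosses, h.holds_bordersSection, BExp.holds_and, BExp.holds_or,
    BExp.holds_isZero, h.eval_height, VExp.eval_sub, h.tables.input.eval_vertex h.fst,
    h.tables.input.eval_vertex h.snd, h'.eval_crossing, h'.holds_crosses, h'.holds_bordersSection,
    h'.eval_height, h'.tables.input.eval_vertex h'.fst, h'.tables.input.eval_vertex h'.snd,
    and_self]

/-- The routine assigns neither to the input, the tables, nor the counter of the outer loop. -/
def Routine.KeepsTables (c : Routine) : Prop :=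
  c.writesNat 0 = false ∧ c.writesNat 2 = false ∧ c.writesReal 0 = false ∧
    c.writesReal 8 = false ∧ ∀ k : Fin 3, c.writesReal (10 + k) = false

theorem HasTables.exec (h : HasTables T θ s) (c : Routine) (hc : c.KeepsTables) :
    HasTables T θ (c.exec s) where
  input := h.input.exec c hc.1 hc.2.2.1
  orientations := fun l => by rw [c.exec_real hc.2.2.2.1]; exact h.orientations l
  angles := fun l k => by rw [c.exec_real (hc.2.2.2.2 k)]; exact h.angles l k

theorem AtPair.exec (h : AtPair T θ i j s) (c : Routine) (hc : c.KeepsTables)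
    (hc3 : c.writesNat 3 = false) : AtPair T θ i j (c.exec s) where
  tables := h.tables.exec c hc
  fst := by rw [c.exec_nat hc.2.1, h.fst]
  snd := by rw [c.exec_nat hc3, h.snd]

end Formulas

namespace Routine

section Stages

variable {n : ℕ} {T : Fin n → Fin 3 → Space} {θ : Fin n → Fin 3 → ℝ} {i j : Fin n} {s : Memory}

/-! ### Clipping by the cuts -/

/-- Store a vector in the first three cells of the real array `a`, by way of the array `7`. -/
def assign (a : ℕ) (u : VExp) : Routine :=
  seq (store 7 (.const 0) u) (store a (.const 0) (.cells 7))

theorem exec_store_zero {a : ℕ} {u : VExp} {w : Space}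
    (hu : ∀ f : ℕ → ℝ, u.eval ⟨s.nat, Function.update s.real a f⟩ = w) :
    (VExp.cells a).eval ((store a (.const 0) u).exec s) = w := by
  ext k
  have := (exec_store (b := .const 0) (B := 0) (fun _ => rfl) hu).1 k
  rwa [zero_add] at this

theorem exec_assign {a : ℕ} (ha : a ≠ 7) {u : VExp} {w : Space}
    (hu : ∀ f : ℕ → ℝ, u.eval ⟨s.nat, Function.update s.real 7 f⟩ = w) :
    (VExp.cells a).eval ((assign a u).exec s) = w := by
  rw [assign, exec]
  refine exec_store_zero fun f => ?_
  rw [← exec_store_zero hu]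
  ext k
  simp only [VExp.eval, VExp.cells, RExp.eval, NExp.eval, Function.update_of_ne ha.symm]

/-- Clip the cone spanned by the vectors in the real arrays `4` and `5`. The integer array `6` tells
whether anything is left. -/
def clip (z : VExp) : Routine :=
  cond (.pos (VExp.dot (.cells 4) z))
    (cond (.pos (VExp.dot (.cells 5) z)) (setN 6 (.const 0) (.const 0))
      (assign 4 (.sub (.smul (VExp.dot (.cells 4) z) (.cells 5))
        (.smul (VExp.dot (.cells 5) z) (.cells 4)))))
    (cond (.pos (VExp.dot (.cells 5) z))
      (assign 5 (.sub (.smul (VExp.dot (.cells 5) z) (.cells 4))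
        (.smul (VExp.dot (.cells 4) z) (.cells 5)))) skip)

/-- Clip by those vectors of a list whose conditions hold. -/
def clipAll (l : List (BExp × VExp)) : Routine :=
  l.foldr (fun p c => seq (cond p.1 (clip p.2) skip) c) skip

/-- The state after clipping by the vectors `z` with `Z z`. -/
def ClipState (t : Fin 3 → Space) (κ : Fin 3) (Z : Space → Prop) (s : Memory) : Prop :=
  (s.nat 6 0 = 1 ∧ IsClipped t κ Z ((VExp.cells 4).eval s) ((VExp.cells 5).eval s)) ∨
    (s.nat 6 0 = 0 ∧ ∀ F, InCone t κ F → ∃ z, Z z ∧ 0 < F ⬝ᵥ z)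

theorem ClipState.congr {t : Fin 3 → Space} {κ : Fin 3} {Z Z' : Space → Prop}
    (h : ClipState t κ Z s) (hZ : ∀ z, Z z ↔ Z' z) : ClipState t κ Z' s := by
  have : Z = Z' := funext fun z => propext (hZ z)
  rwa [← this]

theorem clip_keepsTables (z : VExp) : (clip z).KeepsTables :=
  ⟨rfl, rfl, rfl, rfl, fun k => by fin_cases k <;> rfl⟩

theorem ClipState.exec_clip {t : Fin 3 → Space} (ht : normal t ≠ 0) {κ : Fin 3}
    {Z : Space → Prop} (h : ClipState t κ Z s) {z : VExp} {w : Space} (hz0 : z.eval s = w)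
    (hz : ∀ f : ℕ → ℝ, z.eval ⟨s.nat, Function.update s.real 7 f⟩ = w) :
    ClipState t κ (fun y => Z y ∨ y = w) ((clip z).exec s) := by
  rcases h with ⟨hok, h⟩ | ⟨hok, h⟩
  · have hc : ∀ a, a ≠ 7 → ∀ f : ℕ → ℝ,
        (VExp.cells a).eval ⟨s.nat, Function.update s.real 7 f⟩ = (VExp.cells a).eval s := by
      intro a ha f
      ext k
      simp only [VExp.eval, VExp.cells, RExp.eval, NExp.eval, Function.update_of_ne ha]
    have hcells : ∀ (c : Routine) (a : ℕ), c.writesReal a = false →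
        (VExp.cells a).eval (c.exec s) = (VExp.cells a).eval s := by
      intro c a hw
      ext k
      simp only [VExp.eval, VExp.cells, RExp.eval, NExp.eval, exec_real c hw]
    have hp : ∀ a, (BExp.pos (VExp.dot (.cells a) z)).Holds s ↔ 0 < (VExp.cells a).eval s ⬝ᵥ w := by
      intro a
      rw [BExp.holds_pos, VExp.eval_dot, hz0]
    have hassign : ∀ a b c : ℕ, a ≠ 7 → b ≠ 7 → c ≠ 7 →
        (VExp.cells c).eval ((assign c (.sub (.smul (VExp.dot (.cells a) z) (.cells b))
          (.smul (VExp.dot (.cells b) z) (.cells a)))).exec s) =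
        ((VExp.cells a).eval s ⬝ᵥ w) • (VExp.cells b).eval s -
          ((VExp.cells b).eval s ⬝ᵥ w) • (VExp.cells a).eval s := by
      intro a b c ha hb hc'
      refine exec_assign hc' fun f => ?_
      rw [VExp.eval_sub, VExp.eval_smul, VExp.eval_smul, VExp.eval_dot, VExp.eval_dot, hz, hc a ha,
        hc b hb]
    rw [clip, exec]
    by_cases h1 : 0 < (VExp.cells 4).eval s ⬝ᵥ w
    · rw [if_pos ((hp 4).2 h1), exec]
      by_cases h2 : 0 < (VExp.cells 5).eval s ⬝ᵥ w
      · rw [if_pos ((hp 5).2 h2)]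
        exact Or.inr ⟨by simp [exec, NExp.eval], h.exists_pos ht h1 h2⟩
      · rw [if_neg (fun hh => h2 ((hp 5).1 hh))]
        refine Or.inl ⟨by rw [exec_nat _ rfl, hok], ?_⟩
        rw [hassign 4 5 4 (by decide) (by decide) (by decide), hcells _ 5 rfl]
        exact h.replace h1 (not_lt.1 h2)
    · rw [if_neg (fun hh => h1 ((hp 4).1 hh)), exec]
      by_cases h2 : 0 < (VExp.cells 5).eval s ⬝ᵥ w
      · rw [if_pos ((hp 5).2 h2)]
        refine Or.inl ⟨by rw [exec_nat _ rfl, hok], ?_⟩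
        rw [hassign 5 4 5 (by decide) (by decide) (by decide), hcells _ 4 rfl]
        exact (h.symm.replace h2 (not_lt.1 h1)).symm
      · rw [if_neg (fun hh => h2 ((hp 5).1 hh))]
        exact Or.inl ⟨hok, h.of_nonpos (not_lt.1 h1) (not_lt.1 h2)⟩
  · refine Or.inr ⟨?_, fun F hF => ?_⟩
    · rw [clip, exec]
      split
      · rw [exec]
        split
        · simp [exec, NExp.eval]
        · rw [exec_nat _ rfl, hok]
      · rw [exec]
        split
        · rw [exec_nat _ rfl, hok]
        · exact hok
    · obtain ⟨y, hy, hpos⟩ := h F hF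
      exact ⟨y, Or.inl hy, hpos⟩

theorem ClipState.exec_clipAll {t : Fin 3 → Space} (ht : normal t ≠ 0) {κ : Fin 3}
    {l : List (BExp × VExp)} : ∀ {Z : Space → Prop} {s : Memory}, AtPair T θ i j s →
    ClipState t κ Z s → (∀ s', AtPair T θ i j s' → ∀ p ∈ l,
      (p.1.Holds s' ↔ p.1.Holds s) ∧ p.2.eval s' = p.2.eval s) →
    AtPair T θ i j ((clipAll l).exec s) ∧
    ClipState t κ (fun z => Z z ∨ ∃ p ∈ l, p.1.Holds s ∧ z = p.2.eval s)
      ((clipAll l).exec s) := by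
  induction l with
  | nil => exact fun ha h _ => ⟨ha, h.congr (by simp)⟩
  | cons p l ih =>
    intro Z s ha h hl
    have hfirst : AtPair T θ i j ((cond p.1 (clip p.2) skip).exec s) ∧
        ClipState t κ (fun z => Z z ∨ (p.1.Holds s ∧ z = p.2.eval s))
        ((cond p.1 (clip p.2) skip).exec s) := by
      rw [exec]
      split
      · next hb =>
        refine ⟨ha.exec _ (clip_keepsTables _) rfl, (h.exec_clip ht (z := p.2) rfl fun f =>
          (hl _ (ha.update f) p List.mem_cons_self).2).congr ?_⟩
        simp [hb]
      · next hb =>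
        refine ⟨ha, h.congr ?_⟩
        simp [hb]
    have hrec := ih hfirst.1 hfirst.2 (fun s' hs' q hq => by
      have h1 := hl s' hs' q (List.mem_cons_of_mem _ hq)
      have h2 := hl _ hfirst.1 q (List.mem_cons_of_mem _ hq)
      exact ⟨h1.1.trans h2.1.symm, h1.2.trans h2.2.symm⟩)
    refine ⟨hrec.1, hrec.2.congr fun z => ?_⟩
    have h2 : ∀ q ∈ l, (q.1.Holds ((cond p.1 (clip p.2) skip).exec s) ∧
        z = q.2.eval ((cond p.1 (clip p.2) skip).exec s)) ↔ (q.1.Holds s ∧ z = q.2.eval s) := by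
      intro q hq
      have h2 := hl _ hfirst.1 q (List.mem_cons_of_mem _ hq)
      rw [h2.1, h2.2]
    rw [or_assoc, List.exists_mem_cons_iff]
    refine or_congr_right (or_congr_right ?_)
    exact exists_congr fun q => and_congr_right fun hq => h2 q hq

theorem exec_each_clipAll (h : HasTables T θ s) (hi : s.nat 2 0 = i)
    (hN : normal (T i) ≠ 0) (κ : Fin 3) (hc : ClipState (T i) κ (fun _ => False) s) :
    ClipState (T i) κ (fun z => ∃ j k, IsCut T θ i (T i κ) j k z)
      ((each 3 (seq3 fun k => clipAll (cuts κ k))).exec s) := by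
  have key := exec_each (v := 3) (c := seq3 fun k => clipAll (cuts κ k)) (s := s)
    (fun m s' => ClipState (T i) κ
      (fun z => ∃ j : Fin n, (j : ℕ) < m ∧ ∃ k, IsCut T θ i (T i κ) j k z) s')
    (ClipState.congr (s := s.setNat 3 0 0) hc (by simp)) ?_
  · rw [h.input.nat] at key
    exact key.congr (by simp)
  intro m hm s0 hf hv hinv
  rw [h.input.nat] at hm
  have ha : AtPair T θ i ⟨m, hm⟩ s0 :=
    { tables :=
        { input := ⟨by rw [hf.nat 0 (by decide) rfl, h.input.nat],
            by rw [hf.real 0 rfl, h.input.real]⟩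
          orientations := fun l => by rw [hf.real 8 rfl]; exact h.orientations l
          angles := fun l k => by
            rw [hf.real (10 + k) (by fin_cases k <;> rfl)]; exact h.angles l k }
      fst := by rw [hf.nat 2 (by decide) rfl, hi]
      snd := hv }
  have step : ∀ (k : Fin 3) {Z : Space → Prop} {s1 : Memory}, AtPair T θ i ⟨m, hm⟩ s1 →
      ClipState (T i) κ Z s1 → AtPair T θ i ⟨m, hm⟩ ((clipAll (cuts κ k)).exec s1) ∧
      ClipState (T i) κ (fun z => Z z ∨ IsCut T θ i (T i κ) ⟨m, hm⟩ k z)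
        ((clipAll (cuts κ k)).exec s1) := by
    intro k Z s1 h1 h2
    have := h2.exec_clipAll hN h1 (l := cuts κ k) fun s' hs' => h1.cuts_congr hs' κ k
    exact ⟨this.1, this.2.congr fun z => by rw [h1.mem_cuts]⟩
  have c1 := step 0 ha hinv
  have c2 := step 1 c1.1 c1.2
  have c3 := step 2 c2.1 c2.2
  refine ClipState.congr (s := Memory.setNat _ 3 0 (m + 1)) c3.2 fun z => ?_
  constructor
  · rintro (((⟨l, hl, k, hk⟩ | hk) | hk) | hk)
    · exact ⟨l, by omega, k, hk⟩
    · exact ⟨_, Nat.lt_succ_self _, _, hk⟩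
    · exact ⟨_, Nat.lt_succ_self _, _, hk⟩
    · exact ⟨_, Nat.lt_succ_self _, _, hk⟩
  · rintro ⟨l, hl, k, hk⟩
    rcases Nat.lt_succ_iff_lt_or_eq.1 hl with h1 | h1
    · exact Or.inl (Or.inl (Or.inl ⟨l, h1, k, hk⟩))
    · have : l = ⟨m, hm⟩ := Fin.ext h1
      subst this
      fin_cases k
      · exact Or.inl (Or.inl (Or.inr hk))
      · exact Or.inl (Or.inr hk)
      · exact Or.inr hk

end Stages

end Routine

namespace Routine

section Stages

variable {n : ℕ} {T : Fin n → Fin 3 → Space} {θ : Fin n → Fin 3 → ℝ} {i : Fin n} {s : Memory}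

/-! ### Search for the half-planes -/

/-- Output the half-plane of the plane of the triangle in the counter `2` that is bounded by a line
through the vertex `κ` and has the normal vector in the real array `4`. -/
def output (κ : Fin 3) : Routine :=
  seq (store 1 (.add (.triple (.triple (.cell 2))) (.const 0)) (.vertex 2 κ))
    (seq (store 1 (.add (.triple (.triple (.cell 2))) (.const 3))
        (.cross (.normal (.vertex 2)) (.cells 4)))
      (store 1 (.add (.triple (.triple (.cell 2))) (.const 6)) (.cells 4)))

/-- Look for a half-plane bounded by a line through the vertex `κ` of the triangle in the
counter `2`. The integer array `7` records success. -/
def tryVertex (κ : Fin 3) : Routine :=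
  seq (store 4 (.const 0) (.cross (.sub (.vertex 2 (κ + 2)) (.vertex 2 κ)) (.normal (.vertex 2))))
    (seq (store 5 (.const 0)
        (.cross (.normal (.vertex 2)) (.sub (.vertex 2 (κ + 1)) (.vertex 2 κ))))
      (seq (setN 6 (.const 0) (.const 1)) (seq (each 3 (seq3 fun k => clipAll (cuts κ k)))
        (cond (.ltN (.const 0) (.cell 6)) (seq (setN 7 (.const 0) (.const 1)) (output κ)) skip))))

/-- Look for a half-plane for each facial triangle. The integer array `1` records the answer. -/
def search : Routine :=
  seq (setN 1 (.const 0) (.const 1)) (each 2 (seq (setN 7 (.const 0) (.const 0))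
    (seq (seq3 tryVertex) (cond (.ltN (.const 0) (.cell 7)) skip (setN 1 (.const 0) (.const 0))))))

/-- The algorithm: orientations of the facial triangles, angles between neighbouring facial
triangles, and search for half-planes. The integer arrays hold the input size (`0`), the answer
(`1`), two counters (`2`, `3`), a parity (`5`), and two flags (`6`, `7`); the real arrays hold the
input (`0`), the output (`1`), the cone that is being clipped (`4`, `5`), a temporary vector (`7`),
the orientations (`8`), a minimum (`9`), and the angles (`10`, `11`, `12`). -/
def main : Routine := seq orientations (seq (seq3 nextAngles) search)

/-- The half-plane at the vertex `κ` of `T i` with normal vector `F` misses the interior of the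
polytope. -/
def Fits (T : Fin n → Fin 3 → Space) (θ : Fin n → Fin 3 → ℝ) (i : Fin n) (κ : Fin 3) (F : Space) :
    Prop :=
  InCone (T i) κ F ∧ ∀ j k z, IsCut T θ i (T i κ) j k z → F ⬝ᵥ z ≤ 0

/-- The `i`-th output is a half-plane that fits. -/
def OutputFits (T : Fin n → Fin 3 → Space) (θ : Fin n → Fin 3 → ℝ) (i : Fin n) (s : Memory) :
    Prop :=
  ∃ κ F, Fits T θ i κ F ∧ outputVector s i 0 = T i κ ∧
    outputVector s i 1 = normal (T i) ⨯₃ F ∧ outputVector s i 2 = F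

theorem OutputFits.congr (h : OutputFits T θ i s) {s' : Memory}
    (hs : ∀ m, 9 * (i : ℕ) ≤ m → m < 9 * i + 9 → s'.real 1 m = s.real 1 m) :
    OutputFits T θ i s' := by
  obtain ⟨κ, F, hF, h0, h1, h2⟩ := h
  have e : ∀ j : ℕ, j < 3 → outputVector s' i j = outputVector s i j := by
    intro j hj
    ext k
    exact hs _ (by omega) (by omega)
  exact ⟨κ, F, hF, by rw [e 0 (by norm_num), h0], by rw [e 1 (by norm_num), h1],
    by rw [e 2 (by norm_num), h2]⟩

theorem exec_output (h : HasInput T s) (hi : s.nat 2 0 = i) (κ : Fin 3) :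
    (outputVector ((output κ).exec s) i 0 = T i κ ∧
      outputVector ((output κ).exec s) i 1 = normal (T i) ⨯₃ (VExp.cells 4).eval s ∧
      outputVector ((output κ).exec s) i 2 = (VExp.cells 4).eval s) ∧
    ∀ m, (m < 9 * (i : ℕ) ∨ 9 * (i : ℕ) + 9 ≤ m) →
      ((output κ).exec s).real 1 m = s.real 1 m := by
  have hb : ∀ (s : Memory), s.nat 2 0 = i → ∀ (c : ℕ) (f : ℕ → ℝ),
      (NExp.add (.triple (.triple (.cell 2))) (.const c)).eval
        ⟨s.nat, Function.update s.real 1 f⟩ = 9 * i + c := by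
    intro s hs c f
    simp only [NExp.eval, NExp.triple, NExp.cell, hs]
    ring
  have hv : ∀ (s : Memory), HasInput T s → s.nat 2 0 = i → ∀ k : Fin 3, ∀ f : ℕ → ℝ,
      (VExp.vertex 2 k).eval ⟨s.nat, Function.update s.real 1 f⟩ = T i k :=
    fun s hs hi k f => (hs.update (by decide) f).eval_vertex hi k
  have h4 : ∀ (s : Memory) (f : ℕ → ℝ),
      (VExp.cells 4).eval ⟨s.nat, Function.update s.real 1 f⟩ = (VExp.cells 4).eval s := by
    intro s f
    ext k
    exact congrFun (Function.update_of_ne (show (4 : ℕ) ≠ 1 by decide) f s.real) _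
  have hnext : ∀ (b : NExp) (u : VExp) (s : Memory), HasInput T s → s.nat 2 0 = i →
      HasInput T ((store 1 b u).exec s) ∧ ((store 1 b u).exec s).nat 2 0 = i ∧
      (VExp.cells 4).eval ((store 1 b u).exec s) = (VExp.cells 4).eval s := by
    intro b u s hs hi
    refine ⟨hs.exec _ rfl rfl, by rw [exec_nat _ rfl, hi], ?_⟩
    ext k
    simp only [VExp.eval, VExp.cells, RExp.eval, NExp.eval]
    rw [exec_real _ rfl]
  simp only [output, exec.eq_4]
  set s1 := (store 1 (.add (.triple (.triple (.cell 2))) (.const 0)) (.vertex 2 κ)).exec s with hs1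
  obtain ⟨b1, b2, b3⟩ := hnext (.add (.triple (.triple (.cell 2))) (.const 0)) (.vertex 2 κ) s h hi
  rw [← hs1] at b1 b2 b3
  set s2 := (store 1 (.add (.triple (.triple (.cell 2))) (.const 3))
        (.cross (.normal (.vertex 2)) (.cells 4))).exec s1 with hs2
  obtain ⟨c1, c2, c3⟩ := hnext (.add (.triple (.triple (.cell 2))) (.const 3))
        (.cross (.normal (.vertex 2)) (.cells 4)) s1 b1 b2
  rw [← hs2] at c1 c2 c3
  obtain ⟨p1, q1⟩ := exec_store (a := 1) (s := s) (hb s hi 0) (hv s h hi κ)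
  obtain ⟨p2, q2⟩ := exec_store (a := 1) (s := s1) (u := .cross (.normal (.vertex 2)) (.cells 4))
    (w := normal (T i) ⨯₃ (VExp.cells 4).eval s) (hb s1 b2 3) (fun f => by
      rw [VExp.eval_cross, VExp.eval_normal, h4, b3]
      simp only [hv s1 b1 b2])
  obtain ⟨p3, q3⟩ := exec_store (a := 1) (s := s2) (u := .cells 4)
    (w := (VExp.cells 4).eval s) (hb s2 c2 6) (fun f => by
      rw [h4, c3, b3])
  rw [← hs1] at p1 q1
  rw [← hs2] at p2 q2
  refine ⟨⟨?_, ?_, ?_⟩, fun m hm => ?_⟩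
  · ext k
    simp only [outputVector]
    rw [q3 _ (by omega), q2 _ (by omega), ← p1 k]
  · ext k
    simp only [outputVector]
    rw [q3 _ (by omega), ← p2 k]
  · ext k
    simp only [outputVector]
    rw [← p3 k]
  · rw [q3 _ (by omega), q2 _ (by omega), q1 _ (by omega)]

theorem tryVertex_keepsTables (κ : Fin 3) : (tryVertex κ).KeepsTables :=
  ⟨rfl, rfl, rfl, rfl, fun k => by fin_cases k <;> rfl⟩

theorem exec_tryVertex (h : HasTables T θ s) (hi : s.nat 2 0 = i) (hN : normal (T i) ≠ 0)
    (κ : Fin 3) :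
    ((∃ F, Fits T θ i κ F) → ((tryVertex κ).exec s).nat 7 0 = 1) ∧
    ((((tryVertex κ).exec s).nat 7 0 = s.nat 7 0 ∧ ((tryVertex κ).exec s).real 1 = s.real 1) ∨
      (((tryVertex κ).exec s).nat 7 0 = 1 ∧ OutputFits T θ i ((tryVertex κ).exec s))) ∧
    ∀ m, (m < 9 * (i : ℕ) ∨ 9 * (i : ℕ) + 9 ≤ m) →
      ((tryVertex κ).exec s).real 1 m = s.real 1 m := by
  have hup : ∀ (a : ℕ), a ≠ 0 → ∀ (s : Memory), HasInput T s → s.nat 2 0 = i →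
      ∀ (f : ℕ → ℝ) (k : Fin 3),
      (VExp.vertex 2 k).eval ⟨s.nat, Function.update s.real a f⟩ = T i k := by
    exact fun a ha s hs hi f k => (hs.update ha f).eval_vertex hi k
  set c1 := store 4 (.const 0)
    (.cross (.sub (.vertex 2 (κ + 2)) (.vertex 2 κ)) (.normal (.vertex 2))) with hc1
  set c2 := store 5 (.const 0)
    (.cross (.normal (.vertex 2)) (.sub (.vertex 2 (κ + 1)) (.vertex 2 κ))) with hc2
  set s1 := c1.exec s with hs1
  set s2 := c2.exec s1 with hs2
  set s3 := (setN 6 (.const 0) (.const 1)).exec s2 with hs3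
  set s4 := (each 3 (seq3 fun k => clipAll (cuts κ k))).exec s3 with hs4
  have e : (tryVertex κ).exec s = (cond (.ltN (.const 0) (.cell 6))
      (seq (setN 7 (.const 0) (.const 1)) (output κ)) skip).exec s4 := by
    simp only [tryVertex, exec.eq_4, hs4, hs3, hs2, hs1, hc1, hc2]
  have k0 : KeepsTables c1 := ⟨rfl, rfl, rfl, rfl, fun k => by fin_cases k <;> rfl⟩
  have k1 : KeepsTables c2 := ⟨rfl, rfl, rfl, rfl, fun k => by fin_cases k <;> rfl⟩
  have k2 : KeepsTables (setN 6 (.const 0) (.const 1)) :=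
    ⟨rfl, rfl, rfl, rfl, fun k => by fin_cases k <;> rfl⟩
  have k3 : KeepsTables (each 3 (seq3 fun k => clipAll (cuts κ k))) :=
    ⟨rfl, rfl, rfl, rfl, fun k => by fin_cases k <;> rfl⟩
  have t1 := h.exec c1 k0
  have t2 := t1.exec c2 k1
  have t3 := t2.exec _ k2
  have t4 := t3.exec _ k3
  have i1 : s1.nat 2 0 = i := by rw [hs1, exec_nat _ k0.2.1, hi]
  have i2 : s2.nat 2 0 = i := by rw [hs2, exec_nat _ k1.2.1, i1]
  have i3 : s3.nat 2 0 = i := by rw [hs3, exec_nat _ k2.2.1, i2]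
  have i4 : s4.nat 2 0 = i := by rw [hs4, exec_nat _ k3.2.1, i3]
  have f1 : (VExp.cells 4).eval s1 = coneLeft (T i) κ := by
    refine exec_store_zero fun f => ?_
    rw [VExp.eval_cross, VExp.eval_normal, VExp.eval_sub]
    simp only [hup 4 (by decide) s h.input hi, coneLeft]
  have f2 : (VExp.cells 5).eval s2 = coneRight (T i) κ := by
    refine exec_store_zero fun f => ?_
    rw [VExp.eval_cross, VExp.eval_normal, VExp.eval_sub]
    simp only [hup 5 (by decide) s1 t1.input i1, coneRight]
  have f3 : (VExp.cells 4).eval s3 = coneLeft (T i) κ := by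
    rw [← f1]
    ext k
    simp only [VExp.eval, VExp.cells, RExp.eval, NExp.eval]
    rw [hs3, exec_real _ rfl, hs2, exec_real _ rfl]
  have st3 : ClipState (T i) κ (fun _ => False) s3 := by
    refine Or.inl ⟨by simp [hs3, exec, NExp.eval], ?_⟩
    rw [f3, show (VExp.cells 5).eval s3 = coneRight (T i) κ from f2]
    exact isClipped_cone _ _
  have st4 := exec_each_clipAll t3 i3 hN κ st3
  rw [← hs4] at st4
  have n7 : s4.nat 7 0 = s.nat 7 0 := by
    rw [hs4, exec_nat _ rfl, hs3, exec_nat _ rfl, hs2, exec_nat _ rfl, hs1, exec_nat _ rfl]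
  have r1 : s4.real 1 = s.real 1 := by
    rw [hs4, exec_real _ rfl, hs3, exec_real _ rfl, hs2, exec_real _ rfl, hs1, exec_real _ rfl]
  rw [e, exec]
  rcases st4 with ⟨hok, hcl⟩ | ⟨hok, hno⟩
  · rw [if_pos (by simp only [BExp.Holds, NExp.eval, NExp.cell, hok]; norm_num), exec]
    set s5 := (setN 7 (.const 0) (.const 1)).exec s4 with hs5
    have h5 : HasInput T s5 := t4.input.exec _ rfl rfl
    have o5 := exec_output h5 (i := i) (by rw [hs5, exec_nat _ rfl, i4]) κ
    have n5 : ((output κ).exec s5).nat 7 0 = 1 := by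
      rw [exec_nat _ rfl, hs5]; simp [exec, NExp.eval]
    have e4 : (VExp.cells 4).eval s5 = (VExp.cells 4).eval s4 := rfl
    rw [e4] at o5
    refine ⟨fun _ => n5, Or.inr ⟨n5, κ, (VExp.cells 4).eval s4, ⟨hcl.fst, ?_⟩, o5.1⟩,
      fun m hm => by rw [o5.2 m hm, ← r1]; rfl⟩
    exact fun j k z hz => (hcl.nonpos z ⟨j, k, hz⟩).1
  · rw [if_neg (by simp only [BExp.Holds, NExp.eval, NExp.cell, hok]; norm_num), exec]
    refine ⟨?_, Or.inl ⟨n7, r1⟩, fun m _ => by rw [r1]⟩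
    rintro ⟨F, hF, hcut⟩
    obtain ⟨z, ⟨j, k, hz⟩, hpos⟩ := hno F hF
    exact absurd (hcut j k z hz) (not_le.2 hpos)

theorem exec_search (h : HasTables T θ s) (hN : ∀ i, normal (T i) ≠ 0) :
    ((search.exec s).nat 1 0 = 1 ∧ ∀ i, OutputFits T θ i (search.exec s)) ∨
      ((search.exec s).nat 1 0 = 0 ∧ ∃ i, ∀ κ F, ¬ Fits T θ i κ F) := by
  set s0 := (setN 1 (.const 0) (.const 1)).exec s with hs0
  have k0 : KeepsTables (setN 1 (.const 0) (.const 1)) :=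
    ⟨rfl, rfl, rfl, rfl, fun k => by fin_cases k <;> rfl⟩
  have h0 : HasTables T θ s0 := h.exec _ k0
  have key := exec_each (v := 2) (c := seq (setN 7 (.const 0) (.const 0))
    (seq (seq3 tryVertex) (cond (.ltN (.const 0) (.cell 7)) skip (setN 1 (.const 0) (.const 0)))))
    (s := s0)
    (fun m s' => (s'.nat 1 0 = 1 ∧ ∀ i : Fin n, (i : ℕ) < m → OutputFits T θ i s') ∨
      (s'.nat 1 0 = 0 ∧ ∃ i, ∀ κ F, ¬ Fits T θ i κ F))
    (Or.inl ⟨by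
      rw [Memory.setNat_nat_of_ne _ (by decide), hs0]; simp [exec, NExp.eval],
      fun i hi => absurd hi (Nat.not_lt_zero _)⟩) ?_
  · rw [h0.input.nat] at key
    rw [search, exec, ← hs0]
    exact key.imp (fun hh => ⟨hh.1, fun i => hh.2 i i.isLt⟩) id
  intro m hm s' hf hv hinv
  rw [h0.input.nat] at hm
  have h' : HasTables T θ s' :=
    { input := ⟨by rw [hf.nat 0 (by decide) rfl, h0.input.nat],
        by rw [hf.real 0 rfl, h0.input.real]⟩
      orientations := fun l => by rw [hf.real 8 rfl]; exact h0.orientations l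
      angles := fun l k => by
        rw [hf.real (10 + k) (by fin_cases k <;> rfl)]; exact h0.angles l k }
  set s1 := (setN 7 (.const 0) (.const 0)).exec s' with hs1
  set s2 := (tryVertex 0).exec s1 with hs2
  set s3 := (tryVertex 1).exec s2 with hs3
  set s4 := (tryVertex 2).exec s3 with hs4
  have e : (seq (setN 7 (.const 0) (.const 0)) (seq (seq3 tryVertex)
      (cond (.ltN (.const 0) (.cell 7)) skip (setN 1 (.const 0) (.const 0))))).exec s' =
      (cond (.ltN (.const 0) (.cell 7)) skip (setN 1 (.const 0) (.const 0))).exec s4 := by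
    simp only [seq3, exec.eq_4, hs4, hs3, hs2, hs1]
  have k1 : KeepsTables (setN 7 (.const 0) (.const 0)) :=
    ⟨rfl, rfl, rfl, rfl, fun k => by fin_cases k <;> rfl⟩
  have t1 : HasTables T θ s1 := h'.exec _ k1
  have t2 : HasTables T θ s2 := t1.exec _ (tryVertex_keepsTables 0)
  have t3 : HasTables T θ s3 := t2.exec _ (tryVertex_keepsTables 1)
  have i1 : s1.nat 2 0 = m := hv
  have i2 : s2.nat 2 0 = m := by rw [hs2, exec_nat _ rfl, i1]
  have i3 : s3.nat 2 0 = m := by rw [hs3, exec_nat _ rfl, i2]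
  have z1 : s1.nat 7 0 = 0 := by simp [hs1, exec, NExp.eval]
  have r1 : s1.real 1 = s'.real 1 := rfl
  obtain ⟨a1, a2, a3⟩ := exec_tryVertex t1 (i := ⟨m, hm⟩) i1 (hN _) 0
  obtain ⟨b1, b2, b3⟩ := exec_tryVertex t2 (i := ⟨m, hm⟩) i2 (hN _) 1
  obtain ⟨c1, c2, c3⟩ := exec_tryVertex t3 (i := ⟨m, hm⟩) i3 (hN _) 2
  rw [← hs2] at a1 a2 a3
  rw [← hs3] at b1 b2 b3
  rw [← hs4] at c1 c2 c3
  have keep : ∀ {s s' : Memory}, OutputFits T θ ⟨m, hm⟩ s → s'.real 1 = s.real 1 →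
      OutputFits T θ ⟨m, hm⟩ s' := fun hh hr => hh.congr fun _ _ _ => by rw [hr]
  have A : (s2.nat 7 0 = 1 ∧ OutputFits T θ ⟨m, hm⟩ s2) ∨
      (s2.nat 7 0 = 0 ∧ ∀ F, ¬ Fits T θ ⟨m, hm⟩ 0 F) := by
    rcases a2 with ⟨x, y⟩ | x
    · rw [z1] at x
      exact Or.inr ⟨x, fun F hF => by have := a1 ⟨F, hF⟩; omega⟩
    · exact Or.inl x
  have B : (s3.nat 7 0 = 1 ∧ OutputFits T θ ⟨m, hm⟩ s3) ∨
      (s3.nat 7 0 = 0 ∧ (∀ F, ¬ Fits T θ ⟨m, hm⟩ 0 F) ∧ ∀ F, ¬ Fits T θ ⟨m, hm⟩ 1 F) := by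
    rcases b2 with ⟨x, y⟩ | x
    · rcases A with ⟨u, w⟩ | ⟨u, w⟩
      · exact Or.inl ⟨by rw [x, u], keep w y⟩
      · rw [u] at x
        exact Or.inr ⟨x, w, fun F hF => by have := b1 ⟨F, hF⟩; omega⟩
    · exact Or.inl x
  have C : (s4.nat 7 0 = 1 ∧ OutputFits T θ ⟨m, hm⟩ s4) ∨
      (s4.nat 7 0 = 0 ∧ ∀ κ F, ¬ Fits T θ ⟨m, hm⟩ κ F) := by
    rcases c2 with ⟨x, y⟩ | x
    · rcases B with ⟨u, w⟩ | ⟨u, w, w'⟩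
      · exact Or.inl ⟨by rw [x, u], keep w y⟩
      · rw [u] at x
        refine Or.inr ⟨x, fun κ F hF => ?_⟩
        fin_cases κ
        · exact w F hF
        · exact w' F hF
        · have := c1 ⟨F, hF⟩; omega
    · exact Or.inl x
  have hold : ∀ l : Fin n, (l : ℕ) < m → OutputFits T θ l s' → OutputFits T θ l s4 := by
    intro l hl hh
    refine hh.congr fun x hx1 hx2 => ?_
    have hx : x < 9 * m ∨ 9 * m + 9 ≤ x := by omega
    rw [c3 x hx, b3 x hx, a3 x hx, r1]
  have n1 : s4.nat 1 0 = s'.nat 1 0 := by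
    rw [hs4, exec_nat _ rfl, hs3, exec_nat _ rfl, hs2, exec_nat _ rfl, hs1, exec_nat _ rfl]
  rw [e, exec, Memory.setNat_nat_of_ne _ (by decide)]
  have hset : ∀ (l : Fin n) (s : Memory), OutputFits T θ l s →
      OutputFits T θ l (s.setNat 2 0 (m + 1)) := fun l s hh => hh.congr fun _ _ _ => rfl
  rcases C with ⟨u, w⟩ | ⟨u, w⟩
  · rw [if_pos (by simp only [BExp.Holds, NExp.eval, NExp.cell, u]; norm_num), exec, n1]
    refine hinv.imp (fun hh => ⟨hh.1, fun l hl => hset l _ ?_⟩) id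
    rcases Nat.lt_succ_iff_lt_or_eq.1 hl with h1 | h1
    · exact hold l h1 (hh.2 l h1)
    · have : l = ⟨m, hm⟩ := Fin.ext h1
      subst this
      exact w
  · rw [if_neg (by simp only [BExp.Holds, NExp.eval, NExp.cell, u]; norm_num)]
    exact Or.inr ⟨by simp [exec, NExp.eval], _, w⟩

theorem exec_main (hN : ∀ i, normal (T i) ≠ 0) : ∃ θ : Fin n → Fin 3 → ℝ,
    (∀ j k, IsNextAngle T j k (θ j k)) ∧
    (((main.exec (inputMemory T)).nat 1 0 = 1 ∧
        ∀ i, OutputFits T θ i (main.exec (inputMemory T))) ∨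
      ((main.exec (inputMemory T)).nat 1 0 = 0 ∧ ∃ i, ∀ κ F, ¬ Fits T θ i κ F)) := by
  have h0 : HasInput T (inputMemory T) := ⟨by simp [inputMemory], rfl⟩
  set s1 := orientations.exec (inputMemory T) with hs1
  have h1 : HasInput T s1 := h0.exec _ rfl rfl
  have o1 : HasOrientations T s1 := exec_orientations h0
  have hw : ∀ k : Fin 3, (nextAngles k).writesNat 0 = false ∧ (nextAngles k).writesReal 0 = false ∧
      (nextAngles k).writesReal 8 = false := fun k => by fin_cases k <;> exact ⟨rfl, rfl, rfl⟩
  have step : ∀ (k : Fin 3) (s : Memory), HasInput T s → HasOrientations T s →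
      HasInput T ((nextAngles k).exec s) ∧ HasOrientations T ((nextAngles k).exec s) := by
    intro k s h o
    exact ⟨h.exec _ (hw k).1 (hw k).2.1, fun l => by rw [exec_real _ (hw k).2.2]; exact o l⟩
  have c2 := step 0 _ h1 o1
  have c3 := step 1 _ c2.1 c2.2
  have c4 := step 2 _ c3.1 c3.2
  set s2 := (nextAngles 0).exec s1 with hs2
  set s3 := (nextAngles 1).exec s2 with hs3
  set s4 := (nextAngles 2).exec s3 with hs4
  have e : main.exec (inputMemory T) = search.exec s4 := by
    simp only [main, seq3, exec.eq_4, hs4, hs3, hs2, hs1]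
  have n2 := exec_nextAngles h1 o1 0
  have n3 := exec_nextAngles c2.1 c2.2 1
  have n4 := exec_nextAngles c3.1 c3.2 2
  refine ⟨fun j k => s4.real (10 + k) j, ?_, ?_⟩
  · intro j k
    fin_cases k
    · change IsNextAngle T j 0 (s4.real 10 j)
      rw [hs4, exec_real _ rfl, hs3, exec_real _ rfl]
      exact n2 j
    · change IsNextAngle T j 1 (s4.real 11 j)
      rw [hs4, exec_real _ rfl]
      exact n3 j
    · exact n4 j
  · rw [e]
    exact exec_search ⟨c4.1, c4.2, fun _ _ => rfl⟩ hN

end Stages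

end Routine

/-- The boundary of a bounded set with interior points is not empty. -/
theorem IsTriangulatedPolytope.one_le {n : ℕ} {T : Fin n → Fin 3 → Space} {P : Set Space}
    (hP : IsTriangulatedPolytope P T) : 1 ≤ n := by
  by_contra hn
  have hn0 : n = 0 := by omega
  subst hn0
  have hfr : frontier P = ∅ := by rw [hP.frontier_eq]; simp
  have hclopen : IsClopen P := isClopen_iff_frontier_eq_empty.2 hfr
  rcases isClopen_iff.1 hclopen with h | h
  · have := hP.isConnected_interior.nonempty
    rw [h] at this
    simp at this
  · have := hP.isCompact
    rw [h] at this
    exact noncompact_univ Space this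

end Carving


/-- One program, with one constant `C`, treats all triangulated polytopes: it halts within
`C n ^ 2` steps, answers `1` if the polytope is carveable and `0` if it is not, and in the former
case outputs `n` half-planes that carve the polytope. -/
theorem mainTheorem2 :
    ∃ (A : Carving.Program) (C : ℕ),
      ∀ (n : ℕ) (T : Fin n → Fin 3 → Carving.Space) (P : Set Carving.Space),
        Carving.IsTriangulatedPolytope P T →
        ∃ (t : ℕ) (s : Carving.Memory),
          Carving.Runs A (Carving.inputMemory T) t s ∧
          t ≤ C * n ^ 2 ∧
          (Carving.Carveable P → Carving.outputAnswer s = 1 ∧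
            (∀ i : Fin n, LinearIndependent ℝ
              ![Carving.outputVector s i 1, Carving.outputVector s i 2]) ∧
            Carving.Carves (Set.range fun i : Fin n => Carving.outputHalfPlane s i) P) ∧
          (¬ Carving.Carveable P → Carving.outputAnswer s = 0) := by
  open Carving in
  obtain ⟨C, hC⟩ := Routine.main.exists_time_le
  refine ⟨Routine.main.compile, C * 4, fun n T P hP => ?_⟩
  obtain ⟨t, ht, hrun⟩ := Routine.main.runs_compile rfl rfl (inputMemory T)
  refine ⟨t, _, hrun, ?_, ?_⟩
  · have h0 : (inputMemory T).nat 0 0 = n := by simp [inputMemory]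
    rw [h0] at ht
    refine ht.trans ((hC n).trans ?_)
    rw [show Routine.main.depth = 2 from rfl, mul_assoc]
    have := hP.one_le
    exact Nat.mul_le_mul_left _ (by nlinarith)
  obtain ⟨θ, hθ, hout⟩ := Routine.exec_main (T := T) hP.normal_ne_zero
  rcases hout with ⟨hans, hfit⟩ | ⟨hans, i, hno⟩
  · choose κ F hF h0 h1 h2 using hfit
    obtain ⟨hli, hcar⟩ := hP.carves_of_cuts hθ (fun i => (hF i).1) (fun i => (hF i).2)
    refine ⟨fun _ => ⟨hans, fun i => by rw [h1, h2]; exact hli i, ?_⟩, fun hnc => absurd ?_ hnc⟩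
    · simpa only [outputHalfPlane, h0, h1, h2] using hcar
    · refine ⟨_, Set.finite_range _, ?_, hcar⟩
      rintro _ ⟨i, rfl⟩
      exact ⟨_, _, _, hli i, rfl⟩
  · refine ⟨fun hc => ?_, fun _ => hans⟩
    obtain ⟨κ, G, hG, hsec⟩ := hP.exists_inCone hc i
    exact absurd ⟨hG, fun j k z hz => hsec.cuts hP hθ hz⟩ (hno κ G)
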